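/- **Setting.** Let $s>1$, $s_0>0$, and let $V\in H^{s_0}(\mathbb T^2)$ have real Fourier coefficients $(v_n)_{n\in\mathbb Z^2}$. Write $|n|$ for the Euclidean norm of $n\in\mathbb Z^2$. Let $\kappa_0\in\mathbb R$ be such that $|v_n|\le \frac1{100}$ whenever $|n|\ge\kappa_0$, let $B(\kappa_0)=\{n\in\mathbb Z^2:|n|<\kappa_0\}$, and fix $\eta\in(\frac14,\frac13)$. Put $$\rho_{n_1n_2n_3n_4}=\sum_{j=1}^4(-1)^{j+1}\left(|n_j|^2+v_{n_j}\right).$$ Let $\widetilde{\mathcal A}_0$ be the set of $(n_1,n_2,n_3,n_4)\in(\mathbb Z^2)^4$ with $n_1-n_2+n_3=n_4$, $n_1\ne n_4$, $n_3\neq n_4$, $|\rho_{n_1n_2n_3n_4}|\le\eta$ and at least one $n_i\in B(\kappa_0)$. Let $\widetilde{\mathcal A}_1$ be the set of $(n_1,n_2,n_3,n_4)\in(\mathbb Z^2\setminus B(\kappa_0))^4$ with $n_1-n_2+n_3=n_4$, $n_1\ne n_4$, $n_3\ne n_4$ and $|n_1|^2-|n_2|^2+|n_3|^2-|n_4|^2=0$;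 such tuples are the rectangles with all vertices in $\mathbb Z^2\setminus B(\kappa_0)$. Given pairwise disjoint finite sets (generations) $\Lambda_1,\dots,\Lambda_N\subset\mathbb Z^2\setminus B(\kappa_0)$ with union $\Lambda$, a *nuclear family* is a tuple $(n_1,n_2,n_3,n_4)\in\widetilde{\mathcal A}_1$ such that for some $1\le j<N$ the *parents* $n_1,n_3$ lie in $\Lambda_j$ and the *children* $n_2,n_4$ lie in $\Lambda_{j+1}$. The two parents are *spouses* of each other and the two children are *siblings*. The trivial permutations of a family are those that leave in place or exchange the two parents, and leave in place or exchange the two children. **Theorem.** There are constants $\eta_1,\eta_2>0$ and $K_0\ge 1$ such that for every $\mathcal K\ge K_0$ there exist $N\ge4$ and a finite set $\Lambda=\Lambda_1\cup\dots\cup\Lambda_N\subset\mathbb Z^2\setminus B(\kappa_0)$, with pairwise disjoint generations $\Lambda_j$, such that (in particular $\eta_1,\eta_2$ do not depend on $\mathcal K$): * $1_\Lambda$ (closure) if $n_1,n_2,n_3\in\Lambda$ and $(n_1,n_2,n_3,n)\in\widetilde{\mathcal A}_1$, then $n\in\Lambda$; * $2_\Lambda$ (spouse and children) for $1\le j<N$,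 every $n\in\Lambda_j$ is a parent in a nuclear family, unique up to trivial permutations; * $3_\Lambda$ (sibling and parents) for $1\le j<N$, every $n\in\Lambda_{j+1}$ is a child in a nuclear family, unique up to trivial permutations; * $4_\Lambda$ (nondegeneracy) the sibling of a frequency is never equal to its spouse; * $5_\Lambda$ (faithfulness) every tuple of $\widetilde{\mathcal A}_1$ with all entries in $\Lambda$ is, up to a permutation of its entries, a nuclear family; * $6_\Lambda$ (no spreading to high harmonics) for every $n\in\mathbb Z^2\setminus\Lambda$ there are at most two tuples of $\widetilde{\mathcal A}_1$, up to permutation, that contain $n$ and two modes of $\Lambda$; * $7_\Lambda$ (absence of low harmonics resonant interactions) if $n_1,n_2,n_3\in\Lambda$ and $n\in B(\kappa_0)$, then no permutation of $(n_1,n_2,n_3,n)$ is in $\widetilde{\mathcal A}_0$; * $8_\Lambda$ (no spreading to low harmonics) for every $n\in\mathbb Z^2\setminus\Lambda$, no tuple of $\widetilde{\mathcal A}_0$ contains, in any order, $n$ and two entries belonging to $\Lambda$; and moreover $$\frac{\sum_{n\in\Lambda_{N-1}}|n|^{2s}}{\sum_{n\in\Lambda_3}|n|^{2s}}\ \ge\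 \frac12\,2^{(s-1)(N-4)}\ \ge\ \mathcal K^2,$$ and each generation $\Lambda_j$, $1\le j\le N$, consists of exactly $2^{N-1}$ frequencies, all satisfying $e^{\eta_1N^2}\le|n|\le e^{\eta_2N^2}$. -/

import Mathlib

/-- A frequency `n ∈ ℤ²`. -/
abbrev Mode : Type := Fin 2 → ℤ

/-- The Euclidean norm `|n|` of a frequency. -/
noncomputable def modeNorm (n : Mode) : ℝ :=
  Real.sqrt ((n 0 : ℝ) ^ 2 + (n 1 : ℝ) ^ 2)

/-- `V` belongs to the Sobolev space `H^{s₀}(𝕋²)`: it is square integrable and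
`∑ₙ ⟨n⟩^{2 s₀} |vₙ|² < ∞`, where `vₙ` are the Fourier coefficients and `⟨n⟩ = (1 + |n|²)^{1/2}`.
The torus is parametrized as `(ℝ/ℤ)²`, with characters `y ↦ exp (2 π i n·y)`;
under `x = 2 π y` these are the characters `x ↦ exp (i n·x)` of `(ℝ/2πℤ)²`. -/
def MemSobolev (s₀ : ℝ) (V : UnitAddTorus (Fin 2) → ℂ) : Prop :=
  MeasureTheory.MemLp V 2 MeasureTheory.volume ∧
    Summable fun n : Mode =>
      Real.sqrt (1 + modeNorm n ^ 2) ^ (2 * s₀) * ‖UnitAddTorus.mFourierCoeff V n‖ ^ 2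

/-- The Fourier coefficients of `V`, for potentials all of whose coefficients are real. -/
noncomputable def potCoeff (V : UnitAddTorus (Fin 2) → ℂ) (n : Mode) : ℝ :=
  (UnitAddTorus.mFourierCoeff V n).re

/-- The low modes `B(κ₀)`. -/
def lowModes (κ₀ : ℝ) : Set Mode := {n | modeNorm n < κ₀}

/-- The small divisor
`ρ = (|n₁|² + v_{n₁}) - (|n₂|² + v_{n₂}) + (|n₃|² + v_{n₃}) - (|n₄|² + v_{n₄})`. -/
noncomputable def smallDivisor (v : Mode → ℝ) (n₁ n₂ n₃ n₄ : Mode) : ℝ :=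
  (modeNorm n₁ ^ 2 + v n₁) - (modeNorm n₂ ^ 2 + v n₂)
    + (modeNorm n₃ ^ 2 + v n₃) - (modeNorm n₄ ^ 2 + v n₄)

/-- The set `𝒜₀(n)`: near-resonant triples for which at least one of the four modes
`n₁, n₂, n₃, n` is low (automatic when `n` itself is low). -/
def resonant₀ (v : Mode → ℝ) (κ₀ η : ℝ) (n : Mode) : Set (Mode × Mode × Mode) :=
  {p | p.1 - p.2.1 + p.2.2 = n ∧ p.1 ≠ n ∧ p.2.2 ≠ n ∧
    |smallDivisor v p.1 p.2.1 p.2.2 n| ≤ η ∧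
    (n ∈ lowModes κ₀ ∨ p.1 ∈ lowModes κ₀ ∨ p.2.1 ∈ lowModes κ₀ ∨ p.2.2 ∈ lowModes κ₀)}

/-- The set `𝒜₁(n)`: exactly resonant triples, all four modes being high
(so it is empty when `n` is low). -/
def resonant₁ (κ₀ : ℝ) (n : Mode) : Set (Mode × Mode × Mode) :=
  {p | n ∉ lowModes κ₀ ∧ p.1 - p.2.1 + p.2.2 = n ∧ p.1 ≠ n ∧ p.2.2 ≠ n ∧
    p.1 ∉ lowModes κ₀ ∧ p.2.1 ∉ lowModes κ₀ ∧ p.2.2 ∉ lowModes κ₀ ∧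
    modeNorm p.1 ^ 2 - modeNorm p.2.1 ^ 2 + modeNorm p.2.2 ^ 2 - modeNorm n ^ 2 = 0}

/-- The tuples `(n₁, n₂, n₃, n₄)` with `(n₁, n₂, n₃) ∈ 𝒜₀(n₄)`. -/
def tuples₀ (v : Mode → ℝ) (κ₀ η : ℝ) : Set (Fin 4 → Mode) :=
  {t | (t 0, t 1, t 2) ∈ resonant₀ v κ₀ η (t 3)}

/-- The tuples `(n₁, n₂, n₃, n₄)` with `(n₁, n₂, n₃) ∈ 𝒜₁(n₄)`. They are the (consecutive)
vertices of a nondegenerate rectangle of high modes. -/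
def tuples₁ (κ₀ : ℝ) : Set (Fin 4 → Mode) :=
  {t | (t 0, t 1, t 2) ∈ resonant₁ κ₀ (t 3)}

/-- `Λ = Λ₁ ∪ … ∪ Λ_N`. Only the generations with index in `{1, …, N}` matter. -/
def unionGen (N : ℕ) (gen : ℕ → Finset Mode) : Finset Mode :=
  (Finset.Icc 1 N).biUnion gen

/-- Nuclear families: rectangles with parents `n₁, n₃` in a generation `Λ_j` and children
`n₂, n₄` in `Λ_{j+1}`, for some `1 ≤ j < N`. -/
def IsNuclearFamily (κ₀ : ℝ) (N : ℕ) (gen : ℕ → Finset Mode) (t : Fin 4 → Mode) : Prop :=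
  t ∈ tuples₁ κ₀ ∧
    ∃ j, 1 ≤ j ∧ j < N ∧ t 0 ∈ gen j ∧ t 2 ∈ gen j ∧ t 1 ∈ gen (j + 1) ∧ t 3 ∈ gen (j + 1)

/-- `t'` is one of the four trivial permutations of `t`. -/
def IsTrivialPerm (t t' : Fin 4 → Mode) : Prop :=
  t' = ![t 0, t 1, t 2, t 3] ∨ t' = ![t 0, t 3, t 2, t 1] ∨
    t' = ![t 2, t 1, t 0, t 3] ∨ t' = ![t 2, t 3, t 0, t 1]

/-- Closure. -/
def Closure (κ₀ : ℝ) (N : ℕ) (gen : ℕ → Finset Mode) : Prop :=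
  ∀ n₁ ∈ unionGen N gen, ∀ n₂ ∈ unionGen N gen, ∀ n₃ ∈ unionGen N gen, ∀ n : Mode,
    (n₁, n₂, n₃) ∈ resonant₁ κ₀ n → n ∈ unionGen N gen

/-- Existence and uniqueness of spouse and children. -/
def UniqueSpouseChildren (κ₀ : ℝ) (N : ℕ) (gen : ℕ → Finset Mode) : Prop :=
  ∀ j, 1 ≤ j → j < N → ∀ n ∈ gen j,
    ∃ t, (IsNuclearFamily κ₀ N gen t ∧ (t 0 = n ∨ t 2 = n)) ∧
      ∀ t', IsNuclearFamily κ₀ N gen t' ∧ (t' 0 = n ∨ t' 2 = n) → IsTrivialPerm t t'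

/-- Existence and uniqueness of sibling and parents. -/
def UniqueSiblingParents (κ₀ : ℝ) (N : ℕ) (gen : ℕ → Finset Mode) : Prop :=
  ∀ j, 1 ≤ j → j < N → ∀ n ∈ gen (j + 1),
    ∃ t, (IsNuclearFamily κ₀ N gen t ∧ (t 1 = n ∨ t 3 = n)) ∧
      ∀ t', IsNuclearFamily κ₀ N gen t' ∧ (t' 1 = n ∨ t' 3 = n) → IsTrivialPerm t t'

/-- `m` is a spouse of `n`. -/
def IsSpouse (κ₀ : ℝ) (N : ℕ) (gen : ℕ → Finset Mode) (n m : Mode) : Prop :=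
  ∃ t, IsNuclearFamily κ₀ N gen t ∧ ((t 0 = n ∧ t 2 = m) ∨ (t 2 = n ∧ t 0 = m))

/-- `m` is a sibling of `n`. -/
def IsSibling (κ₀ : ℝ) (N : ℕ) (gen : ℕ → Finset Mode) (n m : Mode) : Prop :=
  ∃ t, IsNuclearFamily κ₀ N gen t ∧ ((t 1 = n ∧ t 3 = m) ∨ (t 3 = n ∧ t 1 = m))

/-- Nondegeneracy: the sibling of a frequency is never equal to its spouse. -/
def Nondegeneracy (κ₀ : ℝ) (N : ℕ) (gen : ℕ → Finset Mode) : Prop :=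
  ∀ n ∈ unionGen N gen, ∀ m m' : Mode,
    IsSibling κ₀ N gen n m → IsSpouse κ₀ N gen n m' → m ≠ m'

/-- Faithfulness: every rectangle contained in `Λ` is a nuclear family, after relabelling its
vertices (in a nuclear family the parents are listed in the first and third places). -/
def Faithfulness (κ₀ : ℝ) (N : ℕ) (gen : ℕ → Finset Mode) : Prop :=
  ∀ t ∈ tuples₁ κ₀, (∀ i, t i ∈ unionGen N gen) →
    ∃ σ : Equiv.Perm (Fin 4), IsNuclearFamily κ₀ N gen (t ∘ σ)

/-- No spreading to high harmonics: a frequency outside `Λ` is a vertex of at most two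
rectangles of high modes having two vertices in `Λ`. Tuples are counted up to
permutation, that is, through their vertex sets. -/
def NoSpreadingHigh (κ₀ : ℝ) (N : ℕ) (gen : ℕ → Finset Mode) : Prop :=
  ∀ n : Mode, n ∉ unionGen N gen →
    {R : Finset Mode | ∃ t ∈ tuples₁ κ₀, R = Finset.univ.image t ∧ n ∈ R ∧
      2 ≤ (R ∩ unionGen N gen).card}.encard ≤ 2

/-- Absence of resonant interactions of three modes of `Λ` with a low mode. -/
def NoLowInteraction (v : Mode → ℝ) (κ₀ η : ℝ) (N : ℕ) (gen : ℕ → Finset Mode) : Prop :=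
  ∀ n₁ ∈ unionGen N gen, ∀ n₂ ∈ unionGen N gen, ∀ n₃ ∈ unionGen N gen,
    ∀ n ∈ lowModes κ₀, ∀ σ : Equiv.Perm (Fin 4),
      (![n₁, n₂, n₃, n] : Fin 4 → Mode) ∘ σ ∉ tuples₀ v κ₀ η

/-- No spreading to low harmonics: no near-resonant tuple involving a low mode contains, in
whatever order, a frequency outside `Λ` and two entries in `Λ`. -/
def NoSpreadingLow (v : Mode → ℝ) (κ₀ η : ℝ) (N : ℕ) (gen : ℕ → Finset Mode) : Prop :=
  ∀ n : Mode, n ∉ unionGen N gen →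
    ¬ ∃ t ∈ tuples₀ v κ₀ η, (∃ k, t k = n) ∧
      ∃ i j, i ≠ j ∧ t i ∈ unionGen N gen ∧ t j ∈ unionGen N gen

/-!
Modes are identified with Gaussian integers. A tuple of `tuples₁` is a rectangle, and the set `Λ` is
built out of rectangles as follows. Put `K = N - 1` and fix `K` rectangles with vertices
`± Q k ± i (Q k + 1)`. A label (`Label`) selects one vertex in each of them, and a label has a value
(`value`): the value at these vertices of a fixed multi-affine polynomial in `K` variables with
Gaussian integer coefficients. The `j`-th generation is the set of values at the labels that select
`(+,+)` or `(-,-)` in the first `j - 1` rectangles and `(+,-)` or `(-,+)` in the others (`Adm`). If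
one coordinate runs through its four vertices, the values form a rectangle, since the polynomial is
affine in this coordinate. Two opposite vertices belong to one generation and the two other ones to
the next. These rectangles are the nuclear families (`Generic.value_family`), and every mode of
`Λ_j` is a parent in exactly one of them and a child in exactly one of them, up to the ends.

There must be no other rectangles. For generic coefficients (`Generic`), right angles between three
values, and pairs of right triangles with a common lattice vertex, only come from linear relations
between the evaluations of multi-affine polynomials at the labels. These relations are classified by
comparing moments (`mon_relation_three`, `GoodSizes.affine_relation_cases`): either all labels
involved lie in one family, or two pairs complete each other in two different coordinates. (For
coinciding rectangles there would be further relations; they are excluded because the lengths of the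
sides and diagonals of two different rectangles are never proportional, `vdist_mul_ne`.) The first
relation gives closure, faithfulness and the uniqueness of families. To bound by two the number of
rectangles through a point outside `Λ`, both relations are used, and in the first one it has to be
seen that a lattice point forms right triangles with at most two pairs of vertices of one rectangle.
This holds up to two exceptional points for each vertex (`rightOnPair_le_two`), which are not lattice
points because `Q k ≡ 5` modulo `15` and the coefficients are normalized modulo `15`
(`false_of_three_rightAt`).

Generic coefficients are found by counting. The box of Gaussian integers of size `R` contains only
`O(R² log R)` orthogonal pairs (`card_orthogonal_pairs_le`), out of about `R⁴`, so among
perturbations of given coefficients in a box few are bad for a given tuple of labels, and the number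
of tuples of labels is much smaller than the size of the box. This is done twice. A first
perturbation makes all relevant scalar products nonzero (`exists_generic_directions`). After a
dilation by `X` they are at least `X² / 2` in absolute value (`Gap`), which a second, relatively
small perturbation does not destroy. The second perturbation removes the accidental pairs of right
triangles (`exists_generic_right_angles`). The gap also settles the interactions with low modes: the
resonance function of a tuple containing a low mode and two modes of `Λ` is dominated by a large
scalar product, while the potential is bounded. It bounds the modes from below, too.

The counting leaves the coefficients free up to small perturbations, so the configuration can be
chosen close to a dilate of a prototype (`proto`): the product over all rectangles of a factor that
vanishes at `(-,-)` and is about `√2` times larger at `(+,+)` than at `(+,-)` and `(-,+)`. In the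
third generation `2 ^ (N - 3)` modes are not small, in the penultimate one only two, which are larger
by a factor `√2 ^ (N - 4)`. This is the growth by `2 ^ ((s - 1) (N - 4))`
(`growth_of_near_proto`). All parameters are powers, with fixed exponents, of quantities of the form
`N ^ O(N)` and `2 ^ N²`, whence the bounds `exp (O(N²))` for the modes.
-/

/-! ### Counting Gaussian integers in boxes -/

/-- The Gaussian integers whose real and imaginary parts are at most `R` in absolute value. -/
noncomputable def gaussBox (R : ℕ) : Finset GaussianInt :=
  (Finset.Icc (-R : ℤ) R ×ˢ Finset.Icc (-R : ℤ) R).image fun p => ⟨p.1, p.2⟩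

theorem mem_gaussBox {R : ℕ} {z : GaussianInt} :
    z ∈ gaussBox R ↔ (-R ≤ z.re ∧ z.re ≤ R) ∧ (-R ≤ z.im ∧ z.im ≤ R) := by
  unfold gaussBox
  simp only [Finset.mem_image, Finset.mem_product, Finset.mem_Icc, Prod.exists]
  constructor
  · rintro ⟨a, b, h, rfl⟩; exact h
  · intro h; exact ⟨z.re, z.im, h, rfl⟩

theorem card_gaussBox (R : ℕ) : (gaussBox R).card = (2 * R + 1) ^ 2 := by
  unfold gaussBox
  rw [Finset.card_image_of_injective, Finset.card_product, Int.card_Icc, sq]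
  · congr 1 <;> omega
  · rintro ⟨a, b⟩ ⟨c, d⟩ h
    simpa [Zsqrtd.ext_iff] using h

/-- The pairs of integers of sup norm `m`. -/
noncomputable def sphereBox (m : ℕ) : Finset (ℤ × ℤ) :=
  (({-(m : ℤ), (m : ℤ)} : Finset ℤ) ×ˢ Finset.Icc (-m : ℤ) m) ∪
    (Finset.Icc (-m : ℤ) m ×ˢ ({-(m : ℤ), (m : ℤ)} : Finset ℤ))

theorem card_sphereBox_le {m : ℕ} (hm : 1 ≤ m) : (sphereBox m).card ≤ 12 * m := by
  unfold sphereBox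
  refine (Finset.card_union_le _ _).trans ?_
  rw [Finset.card_product, Finset.card_product, Int.card_Icc]
  have h2 : ({-(m : ℤ), (m : ℤ)} : Finset ℤ).card ≤ 2 := Finset.card_le_two
  have h3 : ((m : ℤ) + 1 - -m).toNat = 2 * m + 1 := by omega
  rw [h3]
  nlinarith

/-- Two orthogonal Gaussian integers, the first one nonzero, are `g (α + i β)` and
`s (-β + i α)` with `α, β` coprime; this parametrizes orthogonal pairs. -/
theorem orthogonal_pairs_subset (R : ℕ) :
    (gaussBox R ×ˢ gaussBox R).filter
        (fun p => p.1.re * p.2.re + p.1.im * p.2.im = 0) ⊆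
      ({0} ×ˢ gaussBox R) ∪ (Finset.Icc 1 R).biUnion fun m =>
        (sphereBox m ×ˢ (Finset.Icc (-(R / m : ℕ) : ℤ) (R / m : ℕ) ×ˢ
          Finset.Icc (-(R / m : ℕ) : ℤ) (R / m : ℕ))).image
          fun q => (⟨q.2.1 * q.1.1, q.2.1 * q.1.2⟩, ⟨-(q.2.2 * q.1.2), q.2.2 * q.1.1⟩) := by
  rintro ⟨⟨a, b⟩, ⟨c, d⟩⟩ h
  simp only [Finset.mem_filter, Finset.mem_product, mem_gaussBox] at h
  obtain ⟨⟨⟨ha, hb⟩, hc, hd⟩, h0⟩ := h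
  rw [Finset.mem_union]
  by_cases hz : a = 0 ∧ b = 0
  · left
    rw [Finset.mem_product, Finset.mem_singleton, mem_gaussBox]
    exact ⟨Zsqrtd.ext hz.1 hz.2, hc, hd⟩
  right
  have hg : 0 < Int.gcd a b := Nat.pos_of_ne_zero fun h => hz (Int.gcd_eq_zero_iff.1 h)
  obtain ⟨α, β, hcop, hα, hβ⟩ := Int.exists_gcd_one hg
  set g : ℤ := (Int.gcd a b : ℤ) with hgdef
  have hgpos : 0 < g := Int.natCast_pos.2 hg
  obtain ⟨x, y, hxy⟩ := Int.isCoprime_iff_gcd_eq_one.2 hcop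
  have h1 : α * c + β * d = 0 := by
    have : g * (α * c + β * d) = 0 := by rw [hα, hβ] at h0; linarith
    rcases mul_eq_zero.1 this with h | h
    · omega
    · exact h
  set s := x * d - y * c with hs
  have hsα : s * α = d := by
    rw [hs]; linear_combination d * hxy - y * h1
  have hsβ : -(s * β) = c := by
    rw [hs]; linear_combination c * hxy - x * h1
  set m : ℕ := max α.natAbs β.natAbs with hm
  have hm1 : 1 ≤ m := by
    by_contra hcon
    have h1 : α = 0 := by omega
    have h2 : β = 0 := by omega
    rw [h1, h2] at hxy; simp at hxy
  have hgm : g.natAbs * m ≤ R := by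
    rcases max_choice α.natAbs β.natAbs with h | h
    · rw [hm, h, ← Int.natAbs_mul, mul_comm, ← hα]; omega
    · rw [hm, h, ← Int.natAbs_mul, mul_comm, ← hβ]; omega
  have hsm : s.natAbs * m ≤ R := by
    rcases max_choice α.natAbs β.natAbs with h | h
    · rw [hm, h, ← Int.natAbs_mul, hsα]; omega
    · rw [hm, h, ← Int.natAbs_mul]; omega
  have hgR : g.natAbs ≤ R / m := (Nat.le_div_iff_mul_le (by omega)).2 hgm
  have hsR : s.natAbs ≤ R / m := (Nat.le_div_iff_mul_le (by omega)).2 hsm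
  have hmR : m ≤ R := by
    refine le_trans ?_ hgm
    exact Nat.le_mul_of_pos_left _ (by omega)
  rw [Finset.mem_biUnion]
  refine ⟨m, Finset.mem_Icc.2 ⟨hm1, hmR⟩, Finset.mem_image.2 ⟨((α, β), (g, s)), ?_, ?_⟩⟩
  · simp only [Finset.mem_product, Finset.mem_Icc, sphereBox, Finset.mem_union,
      Finset.mem_insert, Finset.mem_singleton]
    refine ⟨?_, by omega, by omega⟩
    rcases max_choice α.natAbs β.natAbs with h | h
    · left; omega
    · right; omega
  · simp only [Prod.mk.injEq, Zsqrtd.ext_iff]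
    refine ⟨⟨?_, ?_⟩, hsβ, hsα⟩
    · rw [hα]; ring
    · rw [hβ]; ring

/-- A box of side `R` contains `O(R² log R)` orthogonal pairs. -/
theorem card_orthogonal_pairs_le (R : ℕ) (hR : 1 ≤ R) :
    ((((gaussBox R ×ˢ gaussBox R).filter
        (fun p => p.1.re * p.2.re + p.1.im * p.2.im = 0)).card : ℕ) : ℝ) ≤
      120 * R ^ 2 * (1 + Real.log R) := by
  have h1 := (Finset.card_le_card (orthogonal_pairs_subset R)).trans (Finset.card_union_le _ _)
  have h2 : (({0} ×ˢ gaussBox R : Finset (GaussianInt × GaussianInt)).card : ℝ) ≤ 9 * R ^ 2 := by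
    rw [Finset.card_product, Finset.card_singleton, card_gaussBox, one_mul]
    push_cast
    have : (1 : ℝ) ≤ R := by exact_mod_cast hR
    nlinarith
  have h3 : ∀ m ∈ Finset.Icc 1 R, (((sphereBox m ×ˢ (Finset.Icc (-(R / m : ℕ) : ℤ) (R / m : ℕ) ×ˢ
          Finset.Icc (-(R / m : ℕ) : ℤ) (R / m : ℕ))).image
          fun q => ((⟨q.2.1 * q.1.1, q.2.1 * q.1.2⟩ : GaussianInt),
            (⟨-(q.2.2 * q.1.2), q.2.2 * q.1.1⟩ : GaussianInt))).card : ℝ) ≤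
          108 * R ^ 2 * (m : ℝ)⁻¹ := by
    intro m hm
    rw [Finset.mem_Icc] at hm
    have hc : (Finset.Icc (-(R / m : ℕ) : ℤ) (R / m : ℕ)).card = 2 * (R / m) + 1 := by
      rw [Int.card_Icc]; omega
    have hd : 1 ≤ R / m := (Nat.le_div_iff_mul_le (by omega)).2 (by omega)
    have hle := (Finset.card_image_le (s := sphereBox m ×ˢ
      (Finset.Icc (-(R / m : ℕ) : ℤ) (R / m : ℕ) ×ˢ Finset.Icc (-(R / m : ℕ) : ℤ) (R / m : ℕ)))
      (f := fun q => ((⟨q.2.1 * q.1.1, q.2.1 * q.1.2⟩ : GaussianInt),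
            (⟨-(q.2.2 * q.1.2), q.2.2 * q.1.1⟩ : GaussianInt))))
    rw [Finset.card_product, Finset.card_product, hc] at hle
    have hle2 : (sphereBox m).card * ((2 * (R / m) + 1) * (2 * (R / m) + 1)) ≤
        12 * m * (3 * (R / m) * (3 * (R / m))) :=
      Nat.mul_le_mul (card_sphereBox_le hm.1) (Nat.mul_le_mul (by omega) (by omega))
    have hm0 : (0 : ℝ) < m := by exact_mod_cast hm.1
    have hdiv : ((R / m : ℕ) : ℝ) ≤ R / m := Nat.cast_div_le
    have : (((12 * m * (3 * (R / m) * (3 * (R / m))) : ℕ)) : ℝ) ≤ 108 * R ^ 2 * (m : ℝ)⁻¹ := by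
      rw [Nat.cast_mul, Nat.cast_mul, Nat.cast_mul, Nat.cast_mul]
      push_cast
      have : ((R / m : ℕ) : ℝ) * ((R / m : ℕ) : ℝ) ≤ (R / m) * (R / m) :=
        mul_le_mul hdiv hdiv (by positivity) (by positivity)
      calc 12 * (m : ℝ) * (3 * ((R / m : ℕ) : ℝ) * (3 * ((R / m : ℕ) : ℝ)))
          = 108 * m * (((R / m : ℕ) : ℝ) * ((R / m : ℕ) : ℝ)) := by ring
        _ ≤ 108 * m * ((R / m) * (R / m)) := by gcongr
        _ = _ := by field_simp
    exact le_trans (by exact_mod_cast hle.trans hle2) this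
  have h4 : ((∑ m ∈ Finset.Icc 1 R, (m : ℝ)⁻¹)) ≤ 1 + Real.log R := by
    have := harmonic_le_one_add_log R
    rw [harmonic_eq_sum_Icc] at this
    push_cast at this
    exact this
  have h5 : (0 : ℝ) ≤ Real.log R := Real.log_natCast_nonneg R
  have h6 := Finset.card_biUnion_le (s := Finset.Icc 1 R) (t := fun m =>
    (sphereBox m ×ˢ (Finset.Icc (-(R / m : ℕ) : ℤ) (R / m : ℕ) ×ˢ
          Finset.Icc (-(R / m : ℕ) : ℤ) (R / m : ℕ))).image
          fun q => ((⟨q.2.1 * q.1.1, q.2.1 * q.1.2⟩ : GaussianInt),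
            (⟨-(q.2.2 * q.1.2), q.2.2 * q.1.1⟩ : GaussianInt)))
  have h1' : ((((gaussBox R ×ˢ gaussBox R).filter
        (fun p => p.1.re * p.2.re + p.1.im * p.2.im = 0)).card : ℕ) : ℝ) ≤
        9 * R ^ 2 + ∑ m ∈ Finset.Icc 1 R, 108 * R ^ 2 * (m : ℝ)⁻¹ := by
    refine (Nat.cast_le.2 h1).trans ?_
    rw [Nat.cast_add]
    refine add_le_add h2 ((Nat.cast_le.2 h6).trans ?_)
    rw [Nat.cast_sum]
    exact Finset.sum_le_sum h3
  rw [← Finset.mul_sum] at h1'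
  have hR2 : (0 : ℝ) ≤ R ^ 2 := by positivity
  nlinarith [mul_le_mul_of_nonneg_left h4 hR2, mul_nonneg hR2 h5]

/-- A circle or a line in the plane contains at most `2 (2 R + 1)` points of the box. -/
theorem card_circle_le (R : ℕ) (A B C E : ℝ) (h : A ≠ 0 ∨ B ≠ 0 ∨ C ≠ 0 ∨ E ≠ 0)
    (s : Finset GaussianInt) (hs : s ⊆ gaussBox R)
    (hE : ∀ z ∈ s, A * ((z.re : ℝ) ^ 2 + (z.im : ℝ) ^ 2) + B * z.re + C * z.im + E = 0) :
    s.card ≤ 2 * (2 * R + 1) := by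
  have hI : (Finset.Icc (-R : ℤ) R).card = 2 * R + 1 := by rw [Int.card_Icc]; omega
  have key : ∀ f : GaussianInt → ℤ, (∀ z ∈ gaussBox R, f z ∈ Finset.Icc (-R : ℤ) R) →
      (∀ a ∈ s, ∀ b ∈ s, ∀ c ∈ s, f a = f b → f a = f c → a ≠ b → a ≠ c → b ≠ c → False) →
      s.card ≤ 2 * (2 * R + 1) := by
    intro f hf h3
    refine (Finset.card_le_mul_card_image (f := f) s 2 ?_).trans ?_
    · intro b _
      by_contra hcon
      push Not at hcon
      obtain ⟨x, y, z, hx, hy, hz, hxy, hxz, hyz⟩ := Finset.two_lt_card_iff.1 hcon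
      simp only [Finset.mem_filter] at hx hy hz
      exact h3 x hx.1 y hy.1 z hz.1 (hx.2.trans hy.2.symm) (hx.2.trans hz.2.symm) hxy hxz hyz
    · refine Nat.mul_le_mul_left 2 ((Finset.card_le_card ?_).trans_eq hI)
      intro b hb
      obtain ⟨z, hz, rfl⟩ := Finset.mem_image.1 hb
      exact hf z (hs hz)
  by_cases hAC : A = 0 ∧ C = 0
  · obtain ⟨rfl, rfl⟩ := hAC
    by_cases hB : B = 0
    · subst hB
      have hE0 : E ≠ 0 := by simpa using h
      have : s = ∅ := by
        refine Finset.eq_empty_of_forall_notMem fun z hz => hE0 ?_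
        simpa using hE z hz
      rw [this]; simp
    · refine key (fun z => z.im) (fun z hz => Finset.mem_Icc.2 (mem_gaussBox.1 hz).2) ?_
      intro a ha b hb c hc hab _ hne _ _
      have h1 := hE a ha
      have h2 := hE b hb
      have : (a.re : ℝ) = b.re := by
        have : B * ((a.re : ℝ) - b.re) = 0 := by linarith
        rcases mul_eq_zero.1 this with h | h
        · exact absurd h hB
        · linarith
      exact hne (Zsqrtd.ext (by exact_mod_cast this) hab)
  · refine key (fun z => z.re) (fun z hz => Finset.mem_Icc.2 (mem_gaussBox.1 hz).1) ?_
    intro a ha b hb c hc hab hac hne1 hne2 hne3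
    have h1 := hE a ha
    have h2 := hE b hb
    have h3 := hE c hc
    have hab' : (b.re : ℝ) = a.re := by exact_mod_cast hab.symm
    have hac' : (c.re : ℝ) = a.re := by exact_mod_cast hac.symm
    rw [hab'] at h2
    rw [hac'] at h3
    have n1 : (a.im : ℝ) - b.im ≠ 0 := fun h =>
      hne1 (Zsqrtd.ext hab (by exact_mod_cast sub_eq_zero.1 h))
    have n2 : (a.im : ℝ) - c.im ≠ 0 := fun h =>
      hne2 (Zsqrtd.ext hac (by exact_mod_cast sub_eq_zero.1 h))
    have n3 : (b.im : ℝ) - c.im ≠ 0 := fun h =>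
      hne3 (Zsqrtd.ext (hab.symm.trans hac) (by exact_mod_cast sub_eq_zero.1 h))
    have e1 : A * ((a.im : ℝ) + b.im) + C = 0 := by
      refine (mul_eq_zero.1 (?_ : ((a.im : ℝ) - b.im) * _ = 0)).resolve_left n1
      linear_combination h1 - h2
    have e2 : A * ((a.im : ℝ) + c.im) + C = 0 := by
      refine (mul_eq_zero.1 (?_ : ((a.im : ℝ) - c.im) * _ = 0)).resolve_left n2
      linear_combination h1 - h3
    have hA : A = 0 := by
      refine (mul_eq_zero.1 (?_ : ((b.im : ℝ) - c.im) * A = 0)).resolve_left n3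
      linear_combination e1 - e2
    exact hAC ⟨hA, by rw [hA] at e1; linarith⟩

/-! ### Right triangles -/

/-- The real inner product on `ℂ`. -/
def dot (u v : ℂ) : ℝ := u.re * v.re + u.im * v.im

/-- The triangle `n a b` has a right angle at `n` (for `τ = 0`), at `a` (for `τ = 1`) or at `b`
(for `τ = 2`). Degenerate triangles are allowed. -/
def RightAt (τ : Fin 3) (n a b : ℂ) : Prop :=
  match τ with
  | 0 => dot (a - n) (b - n) = 0
  | 1 => dot (n - a) (b - a) = 0
  | 2 => dot (n - b) (a - b) = 0

theorem card_circle_shift_le (R : ℕ) (A B C E x y : ℝ) (h : A ≠ 0 ∨ B ≠ 0 ∨ C ≠ 0 ∨ E ≠ 0)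
    (s : Finset GaussianInt) (hs : s ⊆ gaussBox R)
    (hE : ∀ z ∈ s, A * (((z.re : ℝ) - x) ^ 2 + ((z.im : ℝ) - y) ^ 2) + B * (z.re - x)
      + C * (z.im - y) + E = 0) :
    s.card ≤ 2 * (2 * R + 1) := by
  refine card_circle_le R A (B - 2 * A * x) (C - 2 * A * y)
    (A * (x ^ 2 + y ^ 2) - B * x - C * y + E) ?_ s hs fun z hz => ?_
  · by_contra hcon
    push Not at hcon
    obtain ⟨h1, h2, h3, h4⟩ := hcon
    rw [h1] at h2 h3 h4
    have h2' : B = 0 := by linarith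
    have h3' : C = 0 := by linarith
    rw [h2', h3'] at h4
    have h4' : E = 0 := by linarith
    simp [h1, h2', h3', h4'] at h
  · rw [← hE z hz]; ring

/-- If `Y = β Z + c` is not the spiral similarity of centre `n` and ratio `β`, the triangle
`n Z Y` is right-angled only for `Z` on a circle or a line. -/
theorem card_rightAt_le (R : ℕ) (τ : Fin 3) (n β c : ℂ) (hc : c ≠ (1 - β) * n)
    (s : Finset GaussianInt) (hs : s ⊆ gaussBox R)
    (hE : ∀ z ∈ s, RightAt τ n (z : ℂ) (β * z + c)) : s.card ≤ 2 * (2 * R + 1) := by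
  set d := c - (1 - β) * n with hd
  have hd0 : d ≠ 0 := sub_ne_zero.2 hc
  have hcd : c = d + (1 - β) * n := by rw [hd]; ring
  have hne : d.re ≠ 0 ∨ d.im ≠ 0 := by
    by_contra hcon
    push Not at hcon
    exact hd0 (Complex.ext hcon.1 hcon.2)
  rw [hcd] at hE
  clear_value d
  fin_cases τ
  · refine card_circle_shift_le R β.re d.re d.im 0 n.re n.im (by tauto) s hs fun z hz => ?_
    have := hE z hz
    simp only [RightAt, dot, Complex.sub_re, Complex.sub_im, Complex.add_re, Complex.add_im,
      Complex.mul_re, Complex.mul_im, Complex.one_re, Complex.one_im, ← GaussianInt.intCast_re,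
      ← GaussianInt.intCast_im] at this
    linear_combination this
  · refine card_circle_shift_le R (β.re - 1) d.re d.im 0 n.re n.im (by tauto) s hs fun z hz => ?_
    have := hE z hz
    simp only [RightAt, dot, Complex.sub_re, Complex.sub_im, Complex.add_re, Complex.add_im,
      Complex.mul_re, Complex.mul_im, Complex.one_re, Complex.one_im, ← GaussianInt.intCast_re,
      ← GaussianInt.intCast_im] at this
    linear_combination -this
  · refine card_circle_shift_le R (β.re ^ 2 + β.im ^ 2 - β.re)
      (2 * (β.re * d.re + β.im * d.im) - d.re) (2 * (β.re * d.im - β.im * d.re) - d.im)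
      (d.re ^ 2 + d.im ^ 2) n.re n.im ?_ s hs fun z hz => ?_
    · refine Or.inr (Or.inr (Or.inr ?_))
      rcases hne with h | h <;> positivity
    have := hE z hz
    simp only [RightAt, dot, Complex.sub_re, Complex.sub_im, Complex.add_re, Complex.add_im,
      Complex.mul_re, Complex.mul_im, Complex.one_re, Complex.one_im, ← GaussianInt.intCast_re,
      ← GaussianInt.intCast_im] at this
    linear_combination this

/-! ### Counting by linear functionals -/

/-- Among the vectors `g` with entries in `B`, those at which `r` linearly independent affine
functionals take one of the values in `W` have proportion at most `|W| / |B| ^ r`. -/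
theorem card_filter_eval_mem_le {ι : Type*} [Fintype ι] [DecidableEq ι] {r : ℕ}
    (v : Fin r → ι → GaussianInt)
    (hv : LinearIndependent ℂ (fun i => (fun S => ((v i S : GaussianInt) : ℂ))))
    (B : Finset GaussianInt) (b : Fin r → GaussianInt) (D : GaussianInt) (hD : D ≠ 0)
    (W : Finset (Fin r → GaussianInt)) :
    ((Fintype.piFinset fun _ : ι => B).filter
      (fun g => (fun i => b i + D * ∑ S, v i S * g S) ∈ W)).card * B.card ^ r ≤
      B.card ^ (Fintype.card ι) * W.card := by
  classical
  -- a set of coordinates on which the columns form a basis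
  obtain ⟨κ, a, ha, hspan, hli⟩ := exists_linearIndependent' ℂ
    (fun S : ι => (fun i : Fin r => ((v i S : GaussianInt) : ℂ)))
  have hfin : Finite κ := Finite.of_injective a ha
  have := Fintype.ofFinite κ
  have htop : Submodule.span ℂ (Set.range fun S : ι => (fun i : Fin r => ((v i S : GaussianInt) : ℂ)))
      = ⊤ := by
    have hrow := hv.rank_matrix (M := Matrix.of fun i S => ((v i S : GaussianInt) : ℂ))
    rw [Matrix.rank_eq_finrank_span_cols] at hrow
    refine Submodule.eq_top_of_finrank_eq ?_
    rw [Module.finrank_fin_fun]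
    exact hrow.trans (Fintype.card_fin r)
  have hcard : Fintype.card κ = r := by
    have h1 := finrank_span_eq_card hli
    rw [hspan, htop, finrank_top, Module.finrank_fin_fun] at h1
    exact h1.symm
  set T : Finset ι := Finset.univ.image a with hT
  have hTc : T.card = r := by
    rw [hT, Finset.card_image_of_injective _ ha, Finset.card_univ, hcard]
  set s := (Fintype.piFinset fun _ : ι => B).filter
      (fun g => (fun i => b i + D * ∑ S, v i S * g S) ∈ W) with hs
  let f : (ι → GaussianInt) → ({S // S ∉ T} → GaussianInt) × (Fin r → GaussianInt) :=
    fun g => (fun S => g S.1, fun i => b i + D * ∑ S, v i S * g S)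
  have hinj : Set.InjOn f s := by
    intro g _ g' _ hgg
    simp only [f, Prod.mk.injEq] at hgg
    obtain ⟨h1, h2⟩ := hgg
    have hoff : ∀ S, S ∉ T → g S = g' S := fun S hS => congrFun h1 ⟨S, hS⟩
    have hval : ∀ i, ∑ S, v i S * (g S - g' S) = 0 := by
      intro i
      have := congrFun h2 i
      have h3 : D * (∑ S, v i S * g S) = D * ∑ S, v i S * g' S := add_left_cancel this
      have h4 := mul_left_cancel₀ hD h3
      simp only [mul_sub, Finset.sum_sub_distrib, h4, sub_self]
    have hz : ∑ k, (((g (a k) - g' (a k) : GaussianInt) : ℂ)) •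
        (fun i : Fin r => ((v i (a k) : GaussianInt) : ℂ)) = 0 := by
      ext i
      have h5 := hval i
      rw [← Finset.sum_subset (Finset.subset_univ T)
        (fun S _ hS => by rw [hoff S hS, sub_self, mul_zero]), hT,
        Finset.sum_image (fun x _ y _ h => ha h)] at h5
      have h6 := congrArg GaussianInt.toComplex h5
      rw [map_sum, map_zero] at h6
      simp only [Finset.sum_apply, Pi.smul_apply, smul_eq_mul, Pi.zero_apply]
      rw [← h6]
      refine Finset.sum_congr rfl fun k _ => ?_
      rw [map_mul, mul_comm]
    have hc := Fintype.linearIndependent_iff.1 hli _ hz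
    ext1 S
    by_cases hS : S ∈ T
    · obtain ⟨k, _, rfl⟩ := Finset.mem_image.1 hS
      exact sub_eq_zero.1 (GaussianInt.toComplex_eq_zero.1 (hc k))
    · exact hoff S hS
  have hmaps : ∀ g ∈ s, f g ∈ (Fintype.piFinset fun _ : {S // S ∉ T} => B) ×ˢ W := by
    intro g hg
    rw [hs, Finset.mem_filter] at hg
    rw [Finset.mem_product]
    refine ⟨?_, hg.2⟩
    rw [Fintype.mem_piFinset]
    intro S
    exact Fintype.mem_piFinset.1 hg.1 S.1
  have hle := Finset.card_le_card_of_injOn f hmaps hinj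
  rw [Finset.card_product, Fintype.card_piFinset, Finset.prod_const, Finset.card_univ,
    Fintype.card_subtype_compl, Fintype.card_coe, hTc] at hle
  have hr : r ≤ Fintype.card ι := by rw [← hTc]; exact Finset.card_le_univ T
  calc s.card * B.card ^ r ≤ B.card ^ (Fintype.card ι - r) * W.card * B.card ^ r :=
        Nat.mul_le_mul_right _ hle
    _ = B.card ^ (Fintype.card ι - r + r) * W.card := by rw [pow_add]; ring
    _ = _ := by rw [Nat.sub_add_cancel hr]

/-- Union bound. -/
theorem exists_forall_not_of_card {α ε : Type*} [Fintype ε] (s : Finset α) (hs : s.Nonempty)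
    (bad : ε → α → Prop) (C : ℕ) (hC : Fintype.card ε < C)
    (h : ∀ e, ∃ t : Finset α, (∀ g ∈ s, bad e g → g ∈ t) ∧ t.card * C ≤ s.card) :
    ∃ g ∈ s, ∀ e, ¬ bad e g := by
  classical
  choose t ht1 ht2 using h
  by_contra hcon
  push Not at hcon
  have hsub : s ⊆ Finset.univ.biUnion t := by
    intro g hg
    obtain ⟨e, he⟩ := hcon g hg
    exact Finset.mem_biUnion.2 ⟨e, Finset.mem_univ _, ht1 e g hg he⟩
  have h1 := (Finset.card_le_card hsub).trans Finset.card_biUnion_le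
  have h2 : s.card * C ≤ Fintype.card ε * s.card := by
    calc s.card * C ≤ (∑ e, (t e).card) * C := Nat.mul_le_mul_right _ h1
      _ = ∑ e, (t e).card * C := Finset.sum_mul _ _ _
      _ ≤ ∑ _e : ε, s.card := Finset.sum_le_sum fun e _ => ht2 e
      _ = _ := by rw [Finset.sum_const, Finset.card_univ, smul_eq_mul]
  have h3 := hs.card_pos
  nlinarith

/-! ### Linear relations between evaluations of multi-affine polynomials -/

/-- The monomial with exponent set `S`, evaluated at `p`. Evaluation at `p` of multi-affine
polynomials is identified with the function `mon p` of the exponent set. -/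
def mon {R : Type*} [CommRing R] {K : ℕ} (p : Fin K → R) (S : Finset (Fin K)) : R := ∏ k ∈ S, p k

section relations

variable {K : ℕ}

@[simp] theorem mon_empty {R : Type*} [CommRing R] (p : Fin K → R) : mon p ∅ = 1 := by simp [mon]

@[simp] theorem mon_singleton {R : Type*} [CommRing R] (p : Fin K → R) (k : Fin K) :
    mon p {k} = p k := by simp [mon]

theorem mon_pair {R : Type*} [CommRing R] (p : Fin K → R) {k l : Fin K} (h : k ≠ l) :
    mon p {k, l} = p k * p l := by simp [mon, Finset.prod_pair h]

theorem mon_triple {R : Type*} [CommRing R] (p : Fin K → R) {k l m : Fin K} (h : k ≠ l)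
    (h2 : k ≠ m) (h3 : l ≠ m) : mon p {k, l, m} = p k * p l * p m := by
  rw [mon, Finset.prod_insert (by simp [h, h2]), Finset.prod_pair h3, mul_assoc]

theorem mon_relation_two {p q : Fin K → ℂ} (hpq : p ≠ q) {a b : ℂ}
    (h : ∀ S, a * mon p S + b * mon q S = 0) : a = 0 ∧ b = 0 := by
  obtain ⟨k, hk⟩ := Function.ne_iff.1 hpq
  have h0 := h ∅
  have h1 := h {k}
  simp only [mon_empty, mon_singleton, mul_one] at h0 h1
  have : a * (p k - q k) = 0 := by linear_combination h1 - q k * h0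
  have ha : a = 0 := (mul_eq_zero.1 this).resolve_right (sub_ne_zero.2 hk)
  exact ⟨ha, by simpa [ha] using h0⟩

/-- Evaluations at three distinct points are linearly independent, unless the points lie on a
coordinate line. -/
theorem mon_relation_three {p q z : Fin K → ℂ} (hpq : p ≠ q) (hpz : p ≠ z) (hqz : q ≠ z)
    {a b c : ℂ} (h : ∀ S, a * mon p S + b * mon q S + c * mon z S = 0)
    (hne : ¬ (a = 0 ∧ b = 0 ∧ c = 0)) : ∃ k, ∀ m, m ≠ k → p m = q m ∧ p m = z m := by
  have hb : b ≠ 0 := by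
    rintro rfl
    have := mon_relation_two hpz (a := a) (b := c) fun S => by linear_combination h S
    exact hne ⟨this.1, rfl, this.2⟩
  have ha : a ≠ 0 := by
    rintro rfl
    have := mon_relation_two hqz (a := b) (b := c) fun S => by linear_combination h S
    exact hne ⟨rfl, this.1, this.2⟩
  obtain ⟨k, hk⟩ := Function.ne_iff.1 hpq
  refine ⟨k, fun m hm => ?_⟩
  have h0 := h ∅
  have h1 := h {k}
  have h2 := h {m}
  have h3 := h {m, k}
  simp only [mon_empty, mon_singleton, mul_one, mon_pair _ hm] at h0 h1 h2 h3
  have hpzk : p k - z k ≠ 0 := by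
    intro h4
    have : b * (q k - z k) = 0 := by linear_combination h1 - z k * h0 - a * h4
    have h5 := (mul_eq_zero.1 this).resolve_left hb
    exact hk (by linear_combination h4 - h5)
  constructor
  · have : a * (p k - z k) * (p m - q m) = 0 := by
      linear_combination h3 - z k * h2 - q m * (h1 - z k * h0)
    exact sub_eq_zero.1 ((mul_eq_zero.1 this).resolve_left (mul_ne_zero ha hpzk))
  · have hc : c ≠ 0 := by
      rintro rfl
      have := mon_relation_two hpq (a := a) (b := b) fun S => by linear_combination h S
      exact ha this.1
    have h6 : a * (p k - q k) * (p m - z m) = 0 := by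
      linear_combination h3 - q k * h2 - z m * (h1 - q k * h0)
    exact sub_eq_zero.1 ((mul_eq_zero.1 h6).resolve_left (mul_ne_zero ha (sub_ne_zero.2 hk)))

variable {p q z y : Fin K → ℂ} {κ μ : ℂ}

/-- A common affine combination of two pairs of evaluations: equality of the means. -/
theorem affine_relation_mean
    (h : ∀ S, (1 - κ) * mon p S + κ * mon q S = (1 - μ) * mon z S + μ * mon y S) (k : Fin K) :
    (1 - κ) * p k + κ * q k = (1 - μ) * z k + μ * y k := by
  simpa using h {k}

/-- Equality of the covariances. -/
theorem affine_relation_cov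
    (h : ∀ S, (1 - κ) * mon p S + κ * mon q S = (1 - μ) * mon z S + μ * mon y S) {k l : Fin K}
    (hkl : k ≠ l) :
    κ * (1 - κ) * ((q k - p k) * (q l - p l)) = μ * (1 - μ) * ((y k - z k) * (y l - z l)) := by
  have h2 := h {k, l}
  simp only [mon_pair _ hkl] at h2
  have hk := affine_relation_mean h k
  have hl := affine_relation_mean h l
  linear_combination h2 - ((1 - κ) * p l + κ * q l) * hk - ((1 - μ) * z k + μ * y k) * hl

/-- Equality of the third central moments. -/
theorem affine_relation_third
    (h : ∀ S, (1 - κ) * mon p S + κ * mon q S = (1 - μ) * mon z S + μ * mon y S) {k l m : Fin K}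
    (hkl : k ≠ l) (hkm : k ≠ m) (hlm : l ≠ m) :
    κ * (1 - κ) * (1 - 2 * κ) * ((q k - p k) * (q l - p l) * (q m - p m)) =
      μ * (1 - μ) * (1 - 2 * μ) * ((y k - z k) * (y l - z l) * (y m - z m)) := by
  have h3 := h {k, l, m}
  simp only [mon_triple _ hkl hkm hlm] at h3
  have hk := affine_relation_mean h k
  have hl := affine_relation_mean h l
  have hm := affine_relation_mean h m
  have hckl := affine_relation_cov h hkl
  have hckm := affine_relation_cov h hkm
  have hclm := affine_relation_cov h hlm
  have e : ∀ (t x1 x2 x3 w1 w2 w3 : ℂ),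
      t * (1 - t) * (1 - 2 * t) * ((w1 - x1) * (w2 - x2) * (w3 - x3)) =
      ((1 - t) * (x1 * x2 * x3) + t * (w1 * w2 * w3))
      - t * (1 - t) * ((w1 - x1) * (w2 - x2)) * ((1 - t) * x3 + t * w3)
      - t * (1 - t) * ((w1 - x1) * (w3 - x3)) * ((1 - t) * x2 + t * w2)
      - t * (1 - t) * ((w2 - x2) * (w3 - x3)) * ((1 - t) * x1 + t * w1)
      - ((1 - t) * x1 + t * w1) * ((1 - t) * x2 + t * w2) * ((1 - t) * x3 + t * w3) := by
    intros; ring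
  rw [e, e, h3, hckl, hckm, hclm, hk, hl, hm]

/-- If the two points of one pair differ in at least three coordinates, then both pairs agree. -/
theorem affine_relation_eq_of_three
    (h : ∀ S, (1 - κ) * mon p S + κ * mon q S = (1 - μ) * mon z S + μ * mon y S)
    (hκ0 : κ ≠ 0) (hκ1 : κ ≠ 1) {k l m : Fin K} (hkl : k ≠ l) (hkm : k ≠ m) (hlm : l ≠ m)
    (hk : p k ≠ q k) (hl : p l ≠ q l) (hm : p m ≠ q m) :
    (p = z ∧ q = y) ∨ (p = y ∧ q = z) := by
  have ak : q k - p k ≠ 0 := sub_ne_zero.2 hk.symm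
  have al : q l - p l ≠ 0 := sub_ne_zero.2 hl.symm
  have am : q m - p m ≠ 0 := sub_ne_zero.2 hm.symm
  have hc1 : κ * (1 - κ) ≠ 0 := mul_ne_zero hκ0 (sub_ne_zero.2 hκ1.symm)
  have hckl := affine_relation_cov h hkl
  have hckm := affine_relation_cov h hkm
  have hclm := affine_relation_cov h hlm
  have hthird := affine_relation_third h hkl hkm hlm
  have hckl0 : μ * (1 - μ) * ((y k - z k) * (y l - z l)) ≠ 0 := by
    rw [← hckl]; exact mul_ne_zero hc1 (mul_ne_zero ak al)
  have hc2 : μ * (1 - μ) ≠ 0 := left_ne_zero_of_mul hckl0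
  have bk : y k - z k ≠ 0 := left_ne_zero_of_mul (right_ne_zero_of_mul hckl0)
  have bl : y l - z l ≠ 0 := right_ne_zero_of_mul (right_ne_zero_of_mul hckl0)
  set r := (y k - z k) / (q k - p k) with hr
  have hrk : y k - z k = r * (q k - p k) := by rw [hr]; field_simp
  have hr0 : r ≠ 0 := div_ne_zero bk ak
  -- the two difference vectors are proportional
  have hlmr : (y l - z l) * (q m - p m) = (y m - z m) * (q l - p l) := by
    have : κ * (1 - κ) * (q k - p k) * (μ * (1 - μ) * (y k - z k)) *
        ((y l - z l) * (q m - p m) - (y m - z m) * (q l - p l)) = 0 := by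
      linear_combination (μ * (1 - μ) * (y k - z k) * (y l - z l)) * hckm
        - (μ * (1 - μ) * (y k - z k) * (y m - z m)) * hckl
    have h2 := (mul_eq_zero.1 this).resolve_left
      (mul_ne_zero (mul_ne_zero hc1 ak) (mul_ne_zero hc2 bk))
    exact sub_eq_zero.1 h2
  have hkmr : (y k - z k) * (q m - p m) = (y m - z m) * (q k - p k) := by
    have : κ * (1 - κ) * (q l - p l) * (μ * (1 - μ) * (y l - z l)) *
        ((y k - z k) * (q m - p m) - (y m - z m) * (q k - p k)) = 0 := by
      linear_combination (μ * (1 - μ) * (y k - z k) * (y l - z l)) * hclm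
        - (μ * (1 - μ) * (y l - z l) * (y m - z m)) * hckl
    have h2 := (mul_eq_zero.1 this).resolve_left
      (mul_ne_zero (mul_ne_zero hc1 al) (mul_ne_zero hc2 bl))
    exact sub_eq_zero.1 h2
  have hrm : y m - z m = r * (q m - p m) := by
    refine mul_right_cancel₀ ak ?_
    linear_combination (q m - p m) * hrk - hkmr
  have hrl : y l - z l = r * (q l - p l) := by
    refine mul_right_cancel₀ am ?_
    linear_combination (q l - p l) * hrm + hlmr
  have hrr : κ * (1 - κ) = μ * (1 - μ) * r ^ 2 := by
    refine mul_right_cancel₀ (mul_ne_zero ak al) ?_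
    rw [hckl, hrk, hrl]; ring
  have hall : ∀ j, y j - z j = r * (q j - p j) := by
    intro j
    by_cases hjk : j = k
    · rw [hjk, hrk]
    have hcj := affine_relation_cov h (Ne.symm hjk)
    refine mul_left_cancel₀ (mul_ne_zero hc2 bk) ?_
    rw [hrk] at hcj ⊢
    rw [hrr] at hcj
    linear_combination -hcj
  have hskew : 1 - 2 * κ = (1 - 2 * μ) * r := by
    rw [hrk, hrl, hrm, hrr] at hthird
    refine mul_left_cancel₀ (mul_ne_zero (mul_ne_zero hc2 (pow_ne_zero 2 hr0))
      (mul_ne_zero (mul_ne_zero ak al) am)) ?_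
    linear_combination hthird
  have hr2 : (r - 1) * (r + 1) = 0 := by
    linear_combination (-(1 - 2 * κ) - (1 - 2 * μ) * r) * hskew + (-4) * hrr
  rcases mul_eq_zero.1 hr2 with hr1 | hr1
  · left
    have hr1 : r = 1 := sub_eq_zero.1 hr1
    have hκμ : κ = μ := by rw [hr1] at hskew; linear_combination (-1 / 2) * hskew
    have hpz : p = z := by
      ext j
      have h1 := affine_relation_mean h j
      have h2 := hall j
      rw [hr1] at h2
      rw [hκμ] at h1
      linear_combination h1 + μ * h2
    refine ⟨hpz, ?_⟩
    ext j
    have h2 := hall j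
    rw [hr1, hpz] at h2
    linear_combination -h2
  · right
    have hr1 : r = -1 := eq_neg_of_add_eq_zero_left hr1
    have hκμ : κ = 1 - μ := by rw [hr1] at hskew; linear_combination (-1 / 2) * hskew
    have hpz : q = z := by
      ext j
      have h1 := affine_relation_mean h j
      have h2 := hall j
      rw [hr1] at h2
      rw [hκμ] at h1
      linear_combination h1 + μ * h2
    refine ⟨?_, hpz⟩
    ext j
    have h2 := hall j
    rw [hr1, hpz] at h2
    linear_combination -h2

/-- If one pair differs in exactly one coordinate, then so does the other. -/
theorem affine_relation_one
    (h : ∀ S, (1 - κ) * mon p S + κ * mon q S = (1 - μ) * mon z S + μ * mon y S)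
    (hμ0 : μ ≠ 0) (hμ1 : μ ≠ 1) (hzy : z ≠ y) {k : Fin K} (hk : ∀ m, m ≠ k → p m = q m) :
    ∃ l, z l ≠ y l ∧ ∀ m, m ≠ l → z m = y m := by
  obtain ⟨l, hl⟩ := Function.ne_iff.1 hzy
  refine ⟨l, hl, fun m hm => ?_⟩
  have hc := affine_relation_cov h hm
  have h0 : (q m - p m) * (q l - p l) = 0 := by
    by_cases hmk : m = k
    · rw [hk l (by rw [← hmk]; exact hm.symm), sub_self, mul_zero]
    · rw [hk m hmk, sub_self, zero_mul]
  rw [h0, mul_zero] at hc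
  have hc2 : μ * (1 - μ) ≠ 0 := mul_ne_zero hμ0 (sub_ne_zero.2 hμ1.symm)
  have h1 := (mul_eq_zero.1 hc.symm).resolve_left hc2
  exact (sub_eq_zero.1 ((mul_eq_zero.1 h1).resolve_right (sub_ne_zero.2 (Ne.symm hl)))).symm

/-- If one pair differs in exactly two coordinates, then so does the other, and all four points
agree in the remaining coordinates. -/
theorem affine_relation_two
    (h : ∀ S, (1 - κ) * mon p S + κ * mon q S = (1 - μ) * mon z S + μ * mon y S)
    (hκ0 : κ ≠ 0) (hκ1 : κ ≠ 1) {k l : Fin K} (hkl : k ≠ l) (hk : p k ≠ q k) (hl : p l ≠ q l)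
    (hoff : ∀ m, m ≠ k → m ≠ l → p m = q m) :
    z k ≠ y k ∧ z l ≠ y l ∧ ∀ m, m ≠ k → m ≠ l → z m = p m ∧ y m = p m := by
  have hc1 : κ * (1 - κ) ≠ 0 := mul_ne_zero hκ0 (sub_ne_zero.2 hκ1.symm)
  have hckl := affine_relation_cov h hkl
  have hckl0 : μ * (1 - μ) * ((y k - z k) * (y l - z l)) ≠ 0 := by
    rw [← hckl]
    exact mul_ne_zero hc1 (mul_ne_zero (sub_ne_zero.2 hk.symm) (sub_ne_zero.2 hl.symm))
  have hc2 : μ * (1 - μ) ≠ 0 := left_ne_zero_of_mul hckl0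
  have bk : y k - z k ≠ 0 := left_ne_zero_of_mul (right_ne_zero_of_mul hckl0)
  have bl : y l - z l ≠ 0 := right_ne_zero_of_mul (right_ne_zero_of_mul hckl0)
  refine ⟨(sub_ne_zero.1 bk).symm, (sub_ne_zero.1 bl).symm, fun m hmk hml => ?_⟩
  have hc := affine_relation_cov h hmk
  rw [hoff m hmk hml, sub_self, zero_mul, mul_zero] at hc
  have h1 := (mul_eq_zero.1 hc.symm).resolve_left hc2
  have h2 := sub_eq_zero.1 ((mul_eq_zero.1 h1).resolve_right bk)
  have h3 := affine_relation_mean h m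
  rw [← hoff m hmk hml, h2] at h3
  have h4 : z m = p m := by linear_combination -h3
  exact ⟨h4, h2.trans h4⟩

end relations

/-! ### Right triangles formed by affine ratios -/

/-- The ratios `κ` for which the triangle with vertices `0, 1, κ` has a right angle. -/
def IsRightRatio (κ : ℂ) : Prop :=
  κ.re = 0 ∨ κ.re = 1 ∨ κ.re ^ 2 + κ.im ^ 2 = κ.re

/-- Four points `0`, `1`, `(x, y)`, `(u, v)` of the plane, all four of whose triangles are right,
are the vertices of a rectangle. -/
theorem rectangle_of_four_right {x y u v : ℝ} (hy : y ≠ 0) (hv : v ≠ 0)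
    (hne : ¬ (x = u ∧ y = v))
    (h1 : x = 0 ∨ x = 1 ∨ x ^ 2 + y ^ 2 = x) (h2 : u = 0 ∨ u = 1 ∨ u ^ 2 + v ^ 2 = u)
    (h3 : x * u + y * v = 0 ∨ x * (x - u) + y * (y - v) = 0 ∨ u * (u - x) + v * (v - y) = 0)
    (h4 : (x - 1) * (u - 1) + y * v = 0 ∨ (x - 1) * (x - u) + y * (y - v) = 0 ∨
      (u - 1) * (u - x) + v * (v - y) = 0) :
    x ^ 2 + y ^ 2 = (1 - u) ^ 2 + v ^ 2 ∧ u ^ 2 + v ^ 2 = (1 - x) ^ 2 + y ^ 2 := by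
  have py : 0 < y ^ 2 := by positivity
  have pv : 0 < v ^ 2 := by positivity
  rcases h1 with rfl | rfl | h1 <;> rcases h2 with rfl | rfl | h2 <;>
    rcases h3 with h3 | h3 | h3 <;> rcases h4 with h4 | h4 | h4 <;>
    first
    | grind
    | (exfalso; nlinarith)

theorem dot_mul_left (c u v : ℂ) : dot (c * u) (c * v) = Complex.normSq c * dot u v := by
  simp only [dot, Complex.mul_re, Complex.mul_im, Complex.normSq_apply]; ring

/-! ### The vertices of the rectangles -/

/-- The sign attached to a Boolean. -/
def bsign (b : Bool) : ℤ := if b then 1 else -1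

/-- The vertices `± Q ± i (Q + 1)` of a rectangle, labelled by their signs. -/
def vtx (Q : ℤ) (v : Bool × Bool) : GaussianInt := ⟨bsign v.1 * Q, bsign v.2 * (Q + 1)⟩

/-- A quarter of the squared distance between two vertices of the rectangle. -/
def vdist (Q : ℤ) (v w : Bool × Bool) : ℤ :=
  (if v.1 = w.1 then 0 else Q ^ 2) + if v.2 = w.2 then 0 else (Q + 1) ^ 2

theorem toComplex_vtx_re (Q : ℤ) (v : Bool × Bool) :
    (GaussianInt.toComplex (vtx Q v)).re = bsign v.1 * Q := by
  rw [← GaussianInt.intCast_re]; simp [vtx]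

theorem toComplex_vtx_im (Q : ℤ) (v : Bool × Bool) :
    (GaussianInt.toComplex (vtx Q v)).im = bsign v.2 * (Q + 1) := by
  rw [← GaussianInt.intCast_im]; simp [vtx]

theorem normSq_vtx_sub (Q : ℤ) (v w : Bool × Bool) :
    Complex.normSq (GaussianInt.toComplex (vtx Q v) - GaussianInt.toComplex (vtx Q w)) =
      4 * vdist Q v w := by
  rw [Complex.normSq_apply, Complex.sub_re, Complex.sub_im, toComplex_vtx_re, toComplex_vtx_im,
    toComplex_vtx_re, toComplex_vtx_im]
  rcases v with ⟨_ | _, _ | _⟩ <;> rcases w with ⟨_ | _, _ | _⟩ <;>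
    simp [vdist, bsign] <;> ring

theorem vtx_injective {Q : ℤ} (hQ : 5 ≤ Q) : Function.Injective (vtx Q) := by
  intro v w h
  rw [vtx, vtx, Zsqrtd.ext_iff] at h
  rcases v with ⟨_ | _, _ | _⟩ <;> rcases w with ⟨_ | _, _ | _⟩ <;>
    simp [bsign] at h ⊢ <;> omega

/-- Any three vertices of a rectangle form a right triangle. -/
theorem dot_vtx_eq_zero (Q : ℤ) {a b c : Bool × Bool} (hab : a ≠ b) (hac : a ≠ c) (hbc : b ≠ c) :
    dot (GaussianInt.toComplex (vtx Q b) - GaussianInt.toComplex (vtx Q a))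
        (GaussianInt.toComplex (vtx Q c) - GaussianInt.toComplex (vtx Q a)) = 0 ∨
    dot (GaussianInt.toComplex (vtx Q a) - GaussianInt.toComplex (vtx Q b))
        (GaussianInt.toComplex (vtx Q c) - GaussianInt.toComplex (vtx Q b)) = 0 ∨
    dot (GaussianInt.toComplex (vtx Q a) - GaussianInt.toComplex (vtx Q c))
        (GaussianInt.toComplex (vtx Q b) - GaussianInt.toComplex (vtx Q c)) = 0 := by
  simp only [dot, Complex.sub_re, Complex.sub_im, toComplex_vtx_re, toComplex_vtx_im]
  rcases a with ⟨_ | _, _ | _⟩ <;> rcases b with ⟨_ | _, _ | _⟩ <;>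
    rcases c with ⟨_ | _, _ | _⟩ <;> simp [bsign] at hab hac hbc ⊢

/-- The side lengths and diagonals of two different rectangles of the list are never in the same
ratio. Residues modulo `3` and `5` tell the two sides and the diagonal apart. -/
theorem vdist_mul_ne {Q R : ℤ} (hQ : Q % 15 = 5) (hR : R % 15 = 5) (hQ0 : 5 ≤ Q) (hR0 : 5 ≤ R)
    (hQR : Q ≠ R) {a b c d e f : Bool × Bool} (hab : a ≠ b) (hac : a ≠ c) (hbc : b ≠ c)
    (hde : d ≠ e) (hdf : d ≠ f) (hef : e ≠ f) :
    vdist Q b a * vdist R e d ≠ vdist Q c a * vdist R f d := by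
  obtain ⟨m, rfl⟩ : ∃ m, Q = 15 * m + 5 := ⟨Q / 15, by omega⟩
  obtain ⟨n, rfl⟩ : ∃ n, R = 15 * n + 5 := ⟨R / 15, by omega⟩
  have key : ∀ u w u' w' : Bool × Bool, u ≠ (false, false) → w ≠ (false, false) → u ≠ w →
      u' ≠ (false, false) → w' ≠ (false, false) → u' ≠ w' →
      vdist (15 * m + 5) u (false, false) * vdist (15 * n + 5) u' (false, false) ≠
      vdist (15 * m + 5) w (false, false) * vdist (15 * n + 5) w' (false, false) := by
    have hmn : m - n ≠ 0 := by omega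
    have hpos : 0 < 2 * (15 * m + 5) * (15 * n + 5) + (15 * m + 5) + (15 * n + 5) := by
      have := mul_nonneg (show 0 ≤ 15 * m + 5 by omega) (show 0 ≤ 15 * n + 5 by omega)
      nlinarith
    have hfin : (15 * m + 5 - (15 * n + 5)) *
      (2 * (15 * m + 5) * (15 * n + 5) + (15 * m + 5) + (15 * n + 5)) ≠ 0 :=
      mul_ne_zero (by omega) hpos.ne'
    rintro ⟨_ | _, _ | _⟩ ⟨_ | _, _ | _⟩ ⟨_ | _, _ | _⟩ ⟨_ | _, _ | _⟩ h1 h2 h3 h4 h5 h6 <;>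
      first
      | exact absurd rfl h1
      | exact absurd rfl h2
      | exact absurd rfl h3
      | exact absurd rfl h4
      | exact absurd rfl h5
      | exact absurd rfl h6
      | (simp only [vdist, if_true, if_false, zero_add, add_zero, Bool.true_eq_false]
         intro h
         first
         | exact hfin (by linear_combination h)
         | exact hfin (by linear_combination -h)
         | (ring_nf at h; omega))
  have hx : ∀ (T : ℤ) (v w : Bool × Bool),
      vdist T v w = vdist T (xor v.1 w.1, xor v.2 w.2) (false, false) := by
    intro T v w
    rcases v with ⟨_ | _, _ | _⟩ <;> rcases w with ⟨_ | _, _ | _⟩ <;> simp [vdist]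
  rw [hx _ b a, hx _ e d, hx _ c a, hx _ f d]
  have hx1 : ∀ v w : Bool × Bool, v ≠ w → (xor w.1 v.1, xor w.2 v.2) ≠ (false, false) := by decide
  have hx2 : ∀ u v w : Bool × Bool, v ≠ w →
      (xor v.1 u.1, xor v.2 u.2) ≠ (xor w.1 u.1, xor w.2 u.2) := by decide
  exact key _ _ _ _ (hx1 _ _ hab) (hx1 _ _ hac) (hx2 _ _ _ hbc) (hx1 _ _ hde) (hx1 _ _ hdf)
    (hx2 _ _ _ hef)

theorem IsRightRatio.im_ne_zero {κ : ℂ} (h : IsRightRatio κ) (h0 : κ ≠ 0) (h1 : κ ≠ 1) :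
    κ.im ≠ 0 := by
  intro hi
  rcases h with h | h | h
  · exact h0 (Complex.ext h hi)
  · exact h1 (Complex.ext h hi)
  · rw [hi] at h
    have : κ.re * (κ.re - 1) = 0 := by linarith
    rcases mul_eq_zero.1 this with h | h
    · exact h0 (Complex.ext h hi)
    · exact h1 (Complex.ext (by simpa using sub_eq_zero.1 h) hi)

theorem IsRightRatio.one_sub {κ : ℂ} (h : IsRightRatio κ) : IsRightRatio (1 - κ) := by
  simp only [IsRightRatio, Complex.sub_re, Complex.sub_im, Complex.one_re, Complex.one_im] at *
  rcases h with h | h | h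
  · right; left; linarith
  · left; linarith
  · right; right; linarith

section vertices

variable {Q R : ℤ} {κ μ : ℂ} {pk qk zk yk pl ql zl yl : Bool × Bool}

/-- The case of two pairs sharing a coordinate: then `0, 1, κ, μ` are the vertices of a rectangle
similar both to that of `Q` and to that of `R`. -/
theorem affine_relation_vertices_false_aux (hQ : Q % 15 = 5) (hR : R % 15 = 5) (hQ0 : 5 ≤ Q)
    (hR0 : 5 ≤ R) (hQR : Q ≠ R)
    (hκ : IsRightRatio κ) (hκ0 : κ ≠ 0) (hκ1 : κ ≠ 1) (hμ : IsRightRatio μ) (hμ0 : μ ≠ 0)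
    (hμ1 : μ ≠ 1) (hkpq : pk ≠ qk) (hkzy : zk ≠ yk) (hlpq : pl ≠ ql) (hlzy : zl ≠ yl)
    (hk : (1 - κ) * (vtx Q pk).toComplex + κ * (vtx Q qk).toComplex =
      (1 - μ) * (vtx Q zk).toComplex + μ * (vtx Q yk).toComplex)
    (hl : (1 - κ) * (vtx R pl).toComplex + κ * (vtx R ql).toComplex =
      (1 - μ) * (vtx R zl).toComplex + μ * (vtx R yl).toComplex)
    (hne : ¬ (qk = yk ∧ pl = zl)) (hpz : pk = zk) (hqy : ql = yl) : False := by
  have inj : ∀ {T : ℤ}, 5 ≤ T → ∀ {v w : Bool × Bool}, v ≠ w →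
      (vtx T v).toComplex - (vtx T w).toComplex ≠ 0 := fun hT v w h hh =>
    h (vtx_injective hT (GaussianInt.toComplex_injective (sub_eq_zero.1 hh)))
  subst hpz hqy
  have ek : κ * ((vtx Q qk).toComplex - (vtx Q pk).toComplex) =
      μ * ((vtx Q yk).toComplex - (vtx Q pk).toComplex) := by linear_combination hk
  have el : (1 - κ) * ((vtx R pl).toComplex - (vtx R ql).toComplex) =
      (1 - μ) * ((vtx R zl).toComplex - (vtx R ql).toComplex) := by linear_combination hl
  have hκ1' : 1 - κ ≠ 0 := sub_ne_zero.2 hκ1.symm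
  have hκμ : κ ≠ μ := by
    rintro rfl
    have h1 := mul_left_cancel₀ hκ0 ek
    have h2 := mul_left_cancel₀ hκ1' el
    refine hne ⟨?_, ?_⟩
    · by_contra h
      exact inj hQ0 h (by linear_combination h1)
    · by_contra h
      exact inj hR0 h (by linear_combination h2)
  have hqyk : qk ≠ yk := by
    rintro rfl
    exact hκμ (mul_right_cancel₀ (inj hQ0 hkpq.symm) ek)
  have hpzl : pl ≠ zl := by
    rintro rfl
    exact hκμ (by linear_combination -mul_right_cancel₀ (inj hR0 hlpq) el)
  -- the triangle `0, κ, μ` is similar to three vertices of the first rectangle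
  obtain ⟨c, hcκ, hcμ⟩ : ∃ c : ℂ, κ = c * ((vtx Q yk).toComplex - (vtx Q pk).toComplex) ∧
      μ = c * ((vtx Q qk).toComplex - (vtx Q pk).toComplex) := by
    have h1 := inj hQ0 hkpq.symm
    refine ⟨μ / ((vtx Q qk).toComplex - (vtx Q pk).toComplex), ?_, ?_⟩
    · rw [eq_comm, div_mul_eq_mul_div, ← ek, mul_div_cancel_right₀ _ h1]
    · rw [div_mul_cancel₀ _ h1]
  obtain ⟨c', hcκ', hcμ'⟩ : ∃ c : ℂ, κ - 1 = c * ((vtx R zl).toComplex - (vtx R ql).toComplex) ∧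
      μ - 1 = c * ((vtx R pl).toComplex - (vtx R ql).toComplex) := by
    have h1 := inj hR0 hlpq
    refine ⟨(μ - 1) / ((vtx R pl).toComplex - (vtx R ql).toComplex), ?_, ?_⟩
    · rw [eq_comm, div_mul_eq_mul_div, div_eq_iff h1]
      linear_combination el
    · rw [div_mul_cancel₀ _ h1]
  have t0 : dot κ μ = 0 ∨ dot κ (κ - μ) = 0 ∨ dot μ (μ - κ) = 0 := by
    rcases dot_vtx_eq_zero Q hkzy hkpq hqyk.symm with h | h | h
    · left; rw [hcκ, hcμ, dot_mul_left, h, mul_zero]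
    · right; left
      have e1 : κ = (-c) * ((vtx Q pk).toComplex - (vtx Q yk).toComplex) := by rw [hcκ]; ring
      have e2 : κ - μ = (-c) * ((vtx Q qk).toComplex - (vtx Q yk).toComplex) := by
        rw [hcκ, hcμ]; ring
      rw [e2]; nth_rewrite 1 [e1]
      rw [dot_mul_left, h, mul_zero]
    · right; right
      have e1 : μ = (-c) * ((vtx Q pk).toComplex - (vtx Q qk).toComplex) := by rw [hcμ]; ring
      have e2 : μ - κ = (-c) * ((vtx Q yk).toComplex - (vtx Q qk).toComplex) := by
        rw [hcκ, hcμ]; ring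
      rw [e2]; nth_rewrite 1 [e1]
      rw [dot_mul_left, h, mul_zero]
  have t1 : dot (κ - 1) (μ - 1) = 0 ∨ dot (κ - 1) (κ - μ) = 0 ∨ dot (μ - 1) (μ - κ) = 0 := by
    rcases dot_vtx_eq_zero R hlzy.symm hlpq.symm hpzl.symm with h | h | h
    · left; rw [hcκ', hcμ', dot_mul_left, h, mul_zero]
    · right; left
      have e1 : κ - 1 = (-c') * ((vtx R ql).toComplex - (vtx R zl).toComplex) := by rw [hcκ']; ring
      have e2 : κ - μ = (-c') * ((vtx R pl).toComplex - (vtx R zl).toComplex) := by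
        linear_combination hcκ' - hcμ'
      rw [e2, e1, dot_mul_left, h, mul_zero]
    · right; right
      have e1 : μ - 1 = (-c') * ((vtx R ql).toComplex - (vtx R pl).toComplex) := by rw [hcμ']; ring
      have e2 : μ - κ = (-c') * ((vtx R zl).toComplex - (vtx R pl).toComplex) := by
        linear_combination hcμ' - hcκ'
      rw [e2, e1, dot_mul_left, h, mul_zero]
  simp only [dot, Complex.sub_re, Complex.sub_im, Complex.one_re, Complex.one_im, sub_zero]
    at t0 t1
  obtain ⟨r1, r2⟩ := rectangle_of_four_right (hκ.im_ne_zero hκ0 hκ1) (hμ.im_ne_zero hμ0 hμ1)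
    (fun h => hκμ (Complex.ext h.1 h.2)) hκ hμ t0 t1
  -- the similarities give the side lengths of the rectangle `0, 1, κ, μ` up to scaling
  have n1 : Complex.normSq κ = Complex.normSq c * (4 * vdist Q yk pk) := by
    rw [← normSq_vtx_sub, ← map_mul, ← hcκ]
  have n2 : Complex.normSq μ = Complex.normSq c * (4 * vdist Q qk pk) := by
    rw [← normSq_vtx_sub, ← map_mul, ← hcμ]
  have n3 : Complex.normSq (κ - 1) = Complex.normSq c' * (4 * vdist R zl ql) := by
    rw [← normSq_vtx_sub, ← map_mul, ← hcκ']
  have n4 : Complex.normSq (μ - 1) = Complex.normSq c' * (4 * vdist R pl ql) := by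
    rw [← normSq_vtx_sub, ← map_mul, ← hcμ']
  have s1 : Complex.normSq κ = Complex.normSq (μ - 1) := by
    simp only [Complex.normSq_apply, Complex.sub_re, Complex.sub_im, Complex.one_re,
      Complex.one_im]
    linarith
  have s2 : Complex.normSq μ = Complex.normSq (κ - 1) := by
    simp only [Complex.normSq_apply, Complex.sub_re, Complex.sub_im, Complex.one_re,
      Complex.one_im]
    linarith
  have hc : Complex.normSq c ≠ 0 := by
    intro h
    rw [h, zero_mul] at n1
    exact hκ0 (Complex.normSq_eq_zero.1 n1)
  have hc' : Complex.normSq c' ≠ 0 := by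
    intro h
    rw [h, zero_mul] at n4
    exact hμ1 (sub_eq_zero.1 (Complex.normSq_eq_zero.1 n4))
  refine vdist_mul_ne hQ hR hQ0 hR0 hQR hkpq hkzy hqyk hlpq.symm hlzy.symm hpzl ?_
  have e1 : Complex.normSq c * (vdist Q yk pk : ℝ) = Complex.normSq c' * vdist R pl ql := by
    linarith
  have e2 : Complex.normSq c * (vdist Q qk pk : ℝ) = Complex.normSq c' * vdist R zl ql := by
    linarith
  have e3 : (vdist Q qk pk : ℝ) * vdist R pl ql = vdist Q yk pk * vdist R zl ql := by
    refine mul_left_cancel₀ (mul_ne_zero hc hc') ?_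
    linear_combination Complex.normSq c' * vdist R pl ql * e2 - Complex.normSq c' * vdist R zl ql * e1
  exact_mod_cast e3

/-- Pairs of vertices of two different rectangles of the list never admit a common affine
combination of their evaluations with right-angled ratios. -/
theorem affine_relation_vertices_false (hQ : Q % 15 = 5) (hR : R % 15 = 5) (hQ0 : 5 ≤ Q)
    (hR0 : 5 ≤ R) (hQR : Q ≠ R)
    (hκ : IsRightRatio κ) (hκ0 : κ ≠ 0) (hκ1 : κ ≠ 1) (hμ : IsRightRatio μ) (hμ0 : μ ≠ 0)
    (hμ1 : μ ≠ 1) (hkpq : pk ≠ qk) (hkzy : zk ≠ yk) (hlpq : pl ≠ ql) (hlzy : zl ≠ yl)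
    (hk : (1 - κ) * (vtx Q pk).toComplex + κ * (vtx Q qk).toComplex =
      (1 - μ) * (vtx Q zk).toComplex + μ * (vtx Q yk).toComplex)
    (hl : (1 - κ) * (vtx R pl).toComplex + κ * (vtx R ql).toComplex =
      (1 - μ) * (vtx R zl).toComplex + μ * (vtx R yl).toComplex)
    (hkl : (1 - κ) * ((vtx Q pk).toComplex * (vtx R pl).toComplex) +
        κ * ((vtx Q qk).toComplex * (vtx R ql).toComplex) =
      (1 - μ) * ((vtx Q zk).toComplex * (vtx R zl).toComplex) +
        μ * ((vtx Q yk).toComplex * (vtx R yl).toComplex))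
    (hne1 : ¬ (pk = zk ∧ qk = yk ∧ pl = zl ∧ ql = yl))
    (hne2 : ¬ (pk = yk ∧ qk = zk ∧ pl = yl ∧ ql = zl)) : False := by
  have inj : ∀ {T : ℤ}, 5 ≤ T → ∀ {v w : Bool × Bool}, v ≠ w →
      (vtx T v).toComplex - (vtx T w).toComplex ≠ 0 := fun hT v w h hh =>
    h (vtx_injective hT (GaussianInt.toComplex_injective (sub_eq_zero.1 hh)))
  have hκ1' : 1 - κ ≠ 0 := sub_ne_zero.2 hκ1.symm
  have hμ1' : 1 - μ ≠ 0 := sub_ne_zero.2 hμ1.symm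
  have hκs : 1 - κ ≠ 1 := fun h => hκ0 (by linear_combination -h)
  have hμs : 1 - μ ≠ 1 := fun h => hμ0 (by linear_combination -h)
  have i1 : κ * ((vtx Q qk).toComplex - (vtx Q pk).toComplex) *
      ((vtx R ql).toComplex - (vtx R zl).toComplex) =
      μ * ((vtx Q yk).toComplex - (vtx Q pk).toComplex) *
      ((vtx R yl).toComplex - (vtx R zl).toComplex) := by
    linear_combination hkl - (vtx R zl).toComplex * hk - (vtx Q pk).toComplex * hl
  have i2 : κ * ((vtx Q qk).toComplex - (vtx Q pk).toComplex) *
      ((vtx R ql).toComplex - (vtx R yl).toComplex) =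
      (1 - μ) * ((vtx Q zk).toComplex - (vtx Q pk).toComplex) *
      ((vtx R zl).toComplex - (vtx R yl).toComplex) := by
    linear_combination hkl - (vtx R yl).toComplex * hk - (vtx Q pk).toComplex * hl
  have i3 : (1 - κ) * ((vtx Q pk).toComplex - (vtx Q qk).toComplex) *
      ((vtx R pl).toComplex - (vtx R zl).toComplex) =
      μ * ((vtx Q yk).toComplex - (vtx Q qk).toComplex) *
      ((vtx R yl).toComplex - (vtx R zl).toComplex) := by
    linear_combination hkl - (vtx R zl).toComplex * hk - (vtx Q qk).toComplex * hl
  have i4 : (1 - κ) * ((vtx Q pk).toComplex - (vtx Q qk).toComplex) *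
      ((vtx R pl).toComplex - (vtx R yl).toComplex) =
      (1 - μ) * ((vtx Q zk).toComplex - (vtx Q qk).toComplex) *
      ((vtx R zl).toComplex - (vtx R yl).toComplex) := by
    linear_combination hkl - (vtx R yl).toComplex * hk - (vtx Q qk).toComplex * hl
  have a1 := inj hQ0 hkpq
  have a1' := inj hQ0 hkpq.symm
  have a2 := inj hR0 hlzy
  have a2' := inj hR0 hlzy.symm
  by_cases c1 : pk = zk
  · have c2 : ql = yl := by
      by_contra h
      rw [c1, sub_self, mul_zero, zero_mul, ← c1] at i2
      exact mul_ne_zero (mul_ne_zero hκ0 a1') (inj hR0 h) i2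
    exact affine_relation_vertices_false_aux hQ hR hQ0 hR0 hQR hκ hκ0 hκ1 hμ hμ0 hμ1 hkpq hkzy
      hlpq hlzy hk hl (fun h => hne1 ⟨c1, h.1, h.2, c2⟩) c1 c2
  by_cases c3 : pk = yk
  · have c4 : ql = zl := by
      by_contra h
      rw [c3, sub_self, mul_zero, zero_mul, ← c3] at i1
      exact mul_ne_zero (mul_ne_zero hκ0 a1') (inj hR0 h) i1
    exact affine_relation_vertices_false_aux hQ hR hQ0 hR0 hQR hκ hκ0 hκ1 hμ.one_sub hμ1' hμs
      hkpq hkzy.symm hlpq hlzy.symm (by linear_combination hk) (by linear_combination hl)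
      (fun h => hne2 ⟨c3, h.1, h.2, c4⟩) c3 c4
  by_cases c5 : qk = yk
  · have c6 : pl = zl := by
      by_contra h
      rw [c5, sub_self, mul_zero, zero_mul, ← c5] at i3
      exact mul_ne_zero (mul_ne_zero hκ1' a1) (inj hR0 h) i3
    exact affine_relation_vertices_false_aux hQ hR hQ0 hR0 hQR hκ.one_sub hκ1' hκs hμ.one_sub hμ1'
      hμs hkpq.symm hkzy.symm hlpq.symm hlzy.symm (by linear_combination hk)
      (by linear_combination hl) (fun h => c1 h.1) c5 c6
  by_cases c7 : qk = zk
  · have c8 : pl = yl := by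
      by_contra h
      rw [c7, sub_self, mul_zero, zero_mul, ← c7] at i4
      exact mul_ne_zero (mul_ne_zero hκ1' a1) (inj hR0 h) i4
    exact affine_relation_vertices_false_aux hQ hR hQ0 hR0 hQR hκ.one_sub hκ1' hκs hμ hμ0
      hμ1 hkpq.symm hkzy hlpq.symm hlzy (by linear_combination hk)
      (by linear_combination hl) (fun h => c3 h.1) c7 c8
  -- all four vertices differ in both coordinates: compare the two cross ratios
  have d1 : ql ≠ zl := by
    rintro rfl
    rw [sub_self, mul_zero] at i1
    exact mul_ne_zero (mul_ne_zero hμ0 (inj hQ0 (Ne.symm c3))) a2' i1.symm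
  have d2 : ql ≠ yl := by
    rintro rfl
    rw [sub_self, mul_zero] at i2
    exact mul_ne_zero (mul_ne_zero hμ1' (inj hQ0 (Ne.symm c1))) a2 i2.symm
  have d3 : pl ≠ zl := by
    rintro rfl
    rw [sub_self, mul_zero] at i3
    exact mul_ne_zero (mul_ne_zero hμ0 (inj hQ0 (Ne.symm c5))) a2' i3.symm
  have d4 : pl ≠ yl := by
    rintro rfl
    rw [sub_self, mul_zero] at i4
    exact mul_ne_zero (mul_ne_zero hμ1' (inj hQ0 (Ne.symm c7))) a2 i4.symm
  have hcr : ((vtx R ql).toComplex - (vtx R zl).toComplex) *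
      ((vtx R pl).toComplex - (vtx R yl).toComplex) *
      (((vtx Q zk).toComplex - (vtx Q pk).toComplex) *
      ((vtx Q yk).toComplex - (vtx Q qk).toComplex)) =
      ((vtx R ql).toComplex - (vtx R yl).toComplex) *
      ((vtx R pl).toComplex - (vtx R zl).toComplex) *
      (((vtx Q yk).toComplex - (vtx Q pk).toComplex) *
      ((vtx Q zk).toComplex - (vtx Q qk).toComplex)) := by
    have hne0 : κ * (1 - κ) * (((vtx Q qk).toComplex - (vtx Q pk).toComplex) *
        ((vtx Q pk).toComplex - (vtx Q qk).toComplex)) *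
        (μ * (1 - μ) * (((vtx R yl).toComplex - (vtx R zl).toComplex) *
        ((vtx R zl).toComplex - (vtx R yl).toComplex))) ≠ 0 :=
      mul_ne_zero (mul_ne_zero (mul_ne_zero hκ0 hκ1') (mul_ne_zero a1' a1))
        (mul_ne_zero (mul_ne_zero hμ0 hμ1') (mul_ne_zero a2' a2))
    refine mul_left_cancel₀ hne0 ?_
    have e14 := congrArg₂ (· * ·) i1 i4
    have e23 := congrArg₂ (· * ·) i2 i3
    beta_reduce at e14 e23
    linear_combination
      (μ * (1 - μ) * (((vtx R yl).toComplex - (vtx R zl).toComplex) *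
        ((vtx R zl).toComplex - (vtx R yl).toComplex)) *
        (((vtx Q zk).toComplex - (vtx Q pk).toComplex) *
      ((vtx Q yk).toComplex - (vtx Q qk).toComplex))) * e14 -
      (μ * (1 - μ) * (((vtx R yl).toComplex - (vtx R zl).toComplex) *
        ((vtx R zl).toComplex - (vtx R yl).toComplex)) *
        (((vtx Q yk).toComplex - (vtx Q pk).toComplex) *
      ((vtx Q zk).toComplex - (vtx Q qk).toComplex))) * e23
  have hn := congrArg Complex.normSq hcr
  simp only [map_mul, normSq_vtx_sub] at hn
  have opp : ∀ (T : ℤ) (a b c d : Bool × Bool), a ≠ b → a ≠ c → a ≠ d → b ≠ c → b ≠ d → c ≠ d →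
      vdist T a b = vdist T c d := by
    intro T a b c d
    rcases a with ⟨_ | _, _ | _⟩ <;> rcases b with ⟨_ | _, _ | _⟩ <;>
    rcases c with ⟨_ | _, _ | _⟩ <;> rcases d with ⟨_ | _, _ | _⟩ <;> simp [vdist]
  have hpos : ∀ {T : ℤ} {a b : Bool × Bool}, 0 ≤ vdist T a b := by
    intro T a b; unfold vdist; positivity
  have symm : ∀ (T : ℤ) (a b : Bool × Bool), vdist T a b = vdist T b a := by
    intro T a b
    rcases a with ⟨_ | _, _ | _⟩ <;> rcases b with ⟨_ | _, _ | _⟩ <;> simp [vdist]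
  rw [opp R pl yl ql zl d4 hlpq d3 d2.symm hlzy.symm d1,
    opp R ql yl pl zl d2 hlpq.symm d1 d4.symm hlzy.symm d3,
    opp Q yk qk zk pk (Ne.symm c5) hkzy.symm (Ne.symm c3) c7 hkpq.symm (Ne.symm c1),
    opp Q zk qk yk pk (Ne.symm c7) hkzy (Ne.symm c1) c5 hkpq.symm (Ne.symm c3)] at hn
  have hn' : ((vdist Q zk pk * vdist R ql zl : ℤ) : ℝ) ^ 2 =
      ((vdist Q yk pk * vdist R pl zl : ℤ) : ℝ) ^ 2 := by
    push_cast
    linear_combination hn / 256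
  have hn2 : (vdist Q zk pk * vdist R ql zl) ^ 2 = (vdist Q yk pk * vdist R pl zl) ^ 2 := by
    exact_mod_cast hn'
  rw [sq_eq_sq₀ (mul_nonneg hpos hpos) (mul_nonneg hpos hpos)] at hn2
  exact vdist_mul_ne hQ hR hQ0 hR0 hQR c1 c3 hkzy d1.symm d3.symm hlpq.symm hn2

end vertices

/-! ### Labels and their evaluations -/

/-- A choice of a vertex in each of `K` rectangles. -/
abbrev Label (K : ℕ) := Fin K → Bool × Bool

/-- The conditions on the sizes of the rectangles: they are distinct, and congruences modulo `3`
and `5` make the side lengths `Q`, `Q + 1` of distinct rectangles arithmetically unrelated. -/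
structure GoodSizes {K : ℕ} (Q : Fin K → ℤ) : Prop where
  mod : ∀ k, Q k % 15 = 5
  five_le : ∀ k, 5 ≤ Q k
  inj : Function.Injective Q

/-- The vertices selected by a label. -/
def corner {K : ℕ} (Q : Fin K → ℤ) (p : Label K) (k : Fin K) : GaussianInt := vtx (Q k) (p k)

/-- The functional "value of a multi-affine polynomial at the vertices selected by `p`", as the
vector of its values at the monomials. -/
def ev {K : ℕ} (Q : Fin K → ℤ) (p : Label K) (S : Finset (Fin K)) : GaussianInt :=
  mon (corner Q p) S

section labels

variable {K : ℕ} {Q : Fin K → ℤ}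

theorem toComplex_ev (p : Label K) (S : Finset (Fin K)) :
    (ev Q p S).toComplex = mon (fun k => (corner Q p k).toComplex) S := by
  simp [ev, mon, map_prod]

theorem GoodSizes.corner_inj (hQ : GoodSizes Q) {p q : Label K} {k : Fin K}
    (h : (corner Q p k).toComplex = (corner Q q k).toComplex) : p k = q k :=
  vtx_injective (hQ.five_le k) (GaussianInt.toComplex_injective h)

theorem GoodSizes.corner_ne (hQ : GoodSizes Q) {p q : Label K} {k : Fin K} (h : p k ≠ q k) :
    (corner Q p k).toComplex ≠ (corner Q q k).toComplex := fun h' => h (hQ.corner_inj h')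

theorem GoodSizes.eq_of_corner (hQ : GoodSizes Q) {p q : Label K}
    (h : (fun k => (corner Q p k).toComplex) = fun k => (corner Q q k).toComplex) : p = q :=
  funext fun k => hQ.corner_inj (congrFun h k)

theorem corner_congr {p q : Label K} {k : Fin K} (h : p k = q k) : corner Q p k = corner Q q k := by
  rw [corner, corner, h]

/-- A point of the plane which is, in two ways, an affine combination with right-angled ratio of
two evaluations: either the pairs coincide, or the four labels differ at a single place, or the
pairs vary at different places and the combination is itself the evaluation at some label. -/
theorem GoodSizes.affine_relation_cases (hQ : GoodSizes Q) {p q z y : Label K} {κ μ : ℂ}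
    (hpq : p ≠ q) (hzy : z ≠ y)
    (hκ : IsRightRatio κ) (hκ0 : κ ≠ 0) (hκ1 : κ ≠ 1) (hμ : IsRightRatio μ) (hμ0 : μ ≠ 0)
    (hμ1 : μ ≠ 1)
    (h : ∀ S, (1 - κ) * (ev Q p S).toComplex + κ * (ev Q q S).toComplex =
      (1 - μ) * (ev Q z S).toComplex + μ * (ev Q y S).toComplex) :
    ((p = z ∧ q = y) ∨ (p = y ∧ q = z)) ∨
    (∃ k, ∀ m, m ≠ k → p m = q m ∧ p m = z m ∧ p m = y m) ∨
    ∃ k l, k ≠ l ∧ p l ≠ q l ∧ (∀ m, m ≠ l → p m = q m) ∧ z k ≠ y k ∧ (∀ m, m ≠ k → z m = y m) ∧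
      (∀ m, m ≠ k → m ≠ l → p m = z m) ∧
      ∀ S, (1 - κ) * (ev Q p S).toComplex + κ * (ev Q q S).toComplex =
        (ev Q (Function.update p l (z l)) S).toComplex := by
  simp only [toComplex_ev] at h
  by_cases h3 : ∃ k l m, k ≠ l ∧ k ≠ m ∧ l ≠ m ∧ p k ≠ q k ∧ p l ≠ q l ∧ p m ≠ q m
  · obtain ⟨k, l, m, hkl, hkm, hlm, hk, hl, hm⟩ := h3
    left
    exact (affine_relation_eq_of_three h hκ0 hκ1 hkl hkm hlm (hQ.corner_ne hk) (hQ.corner_ne hl)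
      (hQ.corner_ne hm)).imp (fun h => ⟨hQ.eq_of_corner h.1, hQ.eq_of_corner h.2⟩)
      (fun h => ⟨hQ.eq_of_corner h.1, hQ.eq_of_corner h.2⟩)
  by_cases h2 : ∃ k l, k ≠ l ∧ p k ≠ q k ∧ p l ≠ q l
  · obtain ⟨k, l, hkl, hk, hl⟩ := h2
    left
    have hoff : ∀ m, m ≠ k → m ≠ l → p m = q m := fun m hmk hml => by
      by_contra hm
      exact h3 ⟨k, l, m, hkl, hmk.symm, hml.symm, hk, hl, hm⟩
    obtain ⟨zk, zl, hzoff⟩ := affine_relation_two h hκ0 hκ1 hkl (hQ.corner_ne hk) (hQ.corner_ne hl)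
      fun m hmk hml => by rw [corner_congr (hoff m hmk hml)]
    have hkl2 := h {k, l}
    simp only [mon_pair _ hkl] at hkl2
    by_contra hcon
    push Not at hcon
    refine affine_relation_vertices_false (hQ.mod k) (hQ.mod l) (hQ.five_le k) (hQ.five_le l)
      (hQ.inj.ne hkl) hκ hκ0 hκ1 hμ hμ0 hμ1 hk (fun h => zk (by rw [corner_congr h])) hl
      (fun h => zl (by rw [corner_congr h])) (affine_relation_mean h k) (affine_relation_mean h l)
      hkl2 ?_ ?_
    · rintro ⟨a, b, c, d⟩
      have h1 : p = z := funext fun m => by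
        by_cases hmk : m = k
        · rw [hmk, a]
        by_cases hml : m = l
        · rw [hml, c]
        exact (hQ.corner_inj (hzoff m hmk hml).1).symm
      refine hcon.1 h1 (funext fun m => ?_)
      by_cases hmk : m = k
      · rw [hmk, b]
      by_cases hml : m = l
      · rw [hml, d]
      rw [← hoff m hmk hml, hQ.corner_inj (hzoff m hmk hml).2]
    · rintro ⟨a, b, c, d⟩
      have h1 : p = y := funext fun m => by
        by_cases hmk : m = k
        · rw [hmk, a]
        by_cases hml : m = l
        · rw [hml, c]
        exact (hQ.corner_inj (hzoff m hmk hml).2).symm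
      refine hcon.2 h1 (funext fun m => ?_)
      by_cases hmk : m = k
      · rw [hmk, b]
      by_cases hml : m = l
      · rw [hml, d]
      rw [← hoff m hmk hml, hQ.corner_inj (hzoff m hmk hml).1]
  right
  obtain ⟨l, hl⟩ := Function.ne_iff.1 hpq
  have hoff : ∀ m, m ≠ l → p m = q m := fun m hm => by
    by_contra hm'
    exact h2 ⟨l, m, hm.symm, hl, hm'⟩
  obtain ⟨k, hk, hkoff⟩ := affine_relation_one h hμ0 hμ1 (fun h => hzy (hQ.eq_of_corner h))
    (k := l) fun m hm => by rw [corner_congr (hoff m hm)]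
  have hkoff' : ∀ m, m ≠ k → z m = y m := fun m hm => hQ.corner_inj (hkoff m hm)
  have hpz : ∀ m, m ≠ k → m ≠ l → p m = z m := fun m hmk hml => by
    have hm := affine_relation_mean h m
    simp only [← corner_congr (hoff m hml), ← corner_congr (hkoff' m hmk)] at hm
    exact hQ.corner_inj (by linear_combination hm)
  by_cases hkl : k = l
  · subst hkl
    exact Or.inl ⟨k, fun m hm => ⟨hoff m hm, hpz m hm hm, (hpz m hm hm).trans (hkoff' m hm)⟩⟩
  refine Or.inr ⟨k, l, hkl, hl, hoff, fun h => hk (by rw [corner_congr h]), hkoff', hpz, fun S => ?_⟩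
  have hm := affine_relation_mean h l
  simp only [← corner_congr (hkoff' l (Ne.symm hkl))] at hm
  have hcl : corner Q (Function.update p l (z l)) l = corner Q z l := by simp [corner]
  have hcm : ∀ m, m ≠ l → corner Q (Function.update p l (z l)) m = corner Q p m := fun m hm => by
    simp [corner, hm]
  have hq : ∀ T : Finset (Fin K), l ∉ T → ∏ m ∈ T, (corner Q q m).toComplex =
      ∏ m ∈ T, (corner Q p m).toComplex := fun T hT => Finset.prod_congr rfl fun m hm => by
    rw [corner_congr (hoff m fun h => hT (h ▸ hm))]
  have hu : ∀ T : Finset (Fin K), l ∉ T →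
      ∏ m ∈ T, (corner Q (Function.update p l (z l)) m).toComplex =
      ∏ m ∈ T, (corner Q p m).toComplex := fun T hT => Finset.prod_congr rfl fun m hm => by
    rw [hcm m fun h => hT (h ▸ hm)]
  simp only [toComplex_ev, mon]
  by_cases hS : l ∈ S
  · rw [← Finset.mul_prod_erase S _ hS, ← Finset.mul_prod_erase S _ hS,
      ← Finset.mul_prod_erase S _ hS, hcl, hq _ (Finset.notMem_erase l S),
      hu _ (Finset.notMem_erase l S)]
    linear_combination (∏ m ∈ S.erase l, (corner Q p m).toComplex) * hm
  · rw [hq S hS, hu S hS]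
    ring

end labels

/-! ### Right triangles on the vertices of one rectangle -/

/-- The six pairs of vertices of a rectangle: the two horizontal sides (`0`, `1`), the two vertical
sides (`2`, `3`) and the two diagonals (`4`, `5`). -/
def pairIndex (p q : Bool × Bool) : Fin 6 :=
  if p.1 = q.1 then (if p.1 then 2 else 3)
  else if p.2 = q.2 then (if p.2 then 0 else 1) else if p.1 = p.2 then 4 else 5

theorem eq_or_eq_of_pairIndex {p q z y : Bool × Bool} (hpq : p ≠ q) (hzy : z ≠ y)
    (h : pairIndex p q = pairIndex z y) : (p = z ∧ q = y) ∨ (p = y ∧ q = z) := by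
  revert p q z y; decide

/-- The point `(x, y)` forms a right triangle with the pair number `m` of vertices of the
rectangle of vertices `(± Q, ± P)`. -/
def RightOnPair (Q P x y : ℝ) (m : Fin 6) : Prop :=
  match m with
  | 0 => x = Q ∨ x = -Q ∨ x ^ 2 + (y - P) ^ 2 = Q ^ 2
  | 1 => x = Q ∨ x = -Q ∨ x ^ 2 + (y + P) ^ 2 = Q ^ 2
  | 2 => y = P ∨ y = -P ∨ (x - Q) ^ 2 + y ^ 2 = P ^ 2
  | 3 => y = P ∨ y = -P ∨ (x + Q) ^ 2 + y ^ 2 = P ^ 2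
  | 4 => Q * x + P * y = Q ^ 2 + P ^ 2 ∨ Q * x + P * y = -(Q ^ 2 + P ^ 2) ∨
      x ^ 2 + y ^ 2 = Q ^ 2 + P ^ 2
  | 5 => Q * x - P * y = Q ^ 2 + P ^ 2 ∨ Q * x - P * y = -(Q ^ 2 + P ^ 2) ∨
      x ^ 2 + y ^ 2 = Q ^ 2 + P ^ 2

/-- A point of the closed first quadrant, apart from three exceptional points, forms right triangles
with at most two pairs of vertices. The cases are whether the point lies on one of the lines carrying
the two sides through `(Q, P)`, and on which of the remaining lines and circles. -/
theorem rightOnPair_nonneg {Q P x y : ℝ} (hQ : 5 ≤ Q) (hP : P = Q + 1) (hx : 0 ≤ x) (hy : 0 ≤ y)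
    (hv : ¬ (x = Q ∧ y = P)) (h1 : ¬ (x = Q ∧ P * y = P ^ 2 + 2 * Q ^ 2))
    (h2 : ¬ (y = P ∧ Q * x = Q ^ 2 + 2 * P ^ 2)) :
    ∃ i j : Fin 6, ∀ m, RightOnPair Q P x y m → m = i ∨ m = j := by
  have hQ0 : 0 < Q := by linarith
  have hP0 : 0 < P := by linarith
  have hQx : 0 ≤ Q * x := by positivity
  have hPy : 0 ≤ P * y := by positivity
  have hxQ : x ≠ -Q := by intro h; linarith
  have hyP : y ≠ -P := by intro h; linarith
  by_cases c1 : x = Q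
  · have hyP' : y ≠ P := fun h => hv ⟨c1, h⟩
    have h1' : P * y ≠ P ^ 2 + 2 * Q ^ 2 := fun h => h1 ⟨c1, h⟩
    have hsq : y ^ 2 ≠ P ^ 2 := fun h => hyP' ((sq_eq_sq₀ hy hP0.le).1 h)
    have hmul : P * y ≠ P * P := fun h => hyP' (mul_left_cancel₀ hP0.ne' h)
    refine ⟨0, 1, fun m hm => ?_⟩
    subst c1
    fin_cases m <;> simp only [RightOnPair] at hm
    · left; rfl
    · right; rfl
    · rcases hm with h | h | h
      · exact absurd h hyP'
      · exact absurd h hyP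
      · exact absurd (by linear_combination h) hsq
    · rcases hm with h | h | h
      · exact absurd h hyP'
      · exact absurd h hyP
      · exfalso; nlinarith [sq_nonneg y]
    · rcases hm with h | h | h
      · exact absurd (by linear_combination h) hmul
      · exfalso; nlinarith
      · exact absurd (by linear_combination h) hsq
    · rcases hm with h | h | h
      · exfalso; nlinarith
      · exact absurd (by linear_combination -h) h1'
      · exact absurd (by linear_combination h) hsq
  by_cases c2 : y = P
  · have h2' : Q * x ≠ Q ^ 2 + 2 * P ^ 2 := fun h => h2 ⟨c2, h⟩
    have hsq : x ^ 2 ≠ Q ^ 2 := fun h => c1 ((sq_eq_sq₀ hx hQ0.le).1 h)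
    have hmul : Q * x ≠ Q * Q := fun h => c1 (mul_left_cancel₀ hQ0.ne' h)
    refine ⟨2, 3, fun m hm => ?_⟩
    subst c2
    fin_cases m <;> simp only [RightOnPair] at hm
    · rcases hm with h | h | h
      · exact absurd h c1
      · exact absurd h hxQ
      · exact absurd (by linear_combination h) hsq
    · rcases hm with h | h | h
      · exact absurd h c1
      · exact absurd h hxQ
      · exfalso; nlinarith [sq_nonneg x]
    · left; rfl
    · right; rfl
    · rcases hm with h | h | h
      · exact absurd (by linear_combination h) hmul
      · exfalso; nlinarith
      · exact absurd (by linear_combination h) hsq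
    · rcases hm with h | h | h
      · exact absurd (by linear_combination h) h2'
      · exfalso; nlinarith
      · exact absurd (by linear_combination h) hsq
  have hmulP : P * y ≠ P * P := fun h => c2 (mul_left_cancel₀ hP0.ne' h)
  have hmulQ : Q * x ≠ Q * Q := fun h => c1 (mul_left_cancel₀ hQ0.ne' h)
  have n1 : ¬ RightOnPair Q P x y 1 := by
    rintro (h | h | h)
    · exact c1 h
    · exact hxQ h
    · nlinarith [sq_nonneg x]
  by_cases c3 : x ^ 2 + y ^ 2 = Q ^ 2 + P ^ 2
  · refine ⟨4, 5, fun m hm => ?_⟩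
    fin_cases m
    · rcases hm with h | h | h
      · exact absurd h c1
      · exact absurd h hxQ
      · exact absurd (by linear_combination (c3 - h) / 2) hmulP
    · exact absurd hm n1
    · rcases hm with h | h | h
      · exact absurd h c2
      · exact absurd h hyP
      · exact absurd (by linear_combination (c3 - h) / 2) hmulQ
    · rcases hm with h | h | h
      · exact absurd h c2
      · exact absurd h hyP
      · exfalso; nlinarith
    · left; rfl
    · right; rfl
  have e0 : RightOnPair Q P x y 0 → x ^ 2 + (y - P) ^ 2 = Q ^ 2 := fun h =>
    (h.resolve_left c1).resolve_left hxQ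
  have e2 : RightOnPair Q P x y 2 → (x - Q) ^ 2 + y ^ 2 = P ^ 2 := fun h =>
    (h.resolve_left c2).resolve_left hyP
  have e3 : RightOnPair Q P x y 3 → (x + Q) ^ 2 + y ^ 2 = P ^ 2 := fun h =>
    (h.resolve_left c2).resolve_left hyP
  have e4 : RightOnPair Q P x y 4 → Q * x + P * y = Q ^ 2 + P ^ 2 := by
    rintro (h | h | h)
    · exact h
    · nlinarith
    · exact absurd h c3
  have e5 : RightOnPair Q P x y 5 →
      Q * x - P * y = Q ^ 2 + P ^ 2 ∨ Q * x - P * y = -(Q ^ 2 + P ^ 2) := by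
    rintro (h | h | h)
    · exact Or.inl h
    · exact Or.inr h
    · exact absurd h c3
  by_cases c23 : RightOnPair Q P x y 2 ∧ RightOnPair Q P x y 3
  · have a2 := e2 c23.1
    have a3 := e3 c23.2
    have hx0 : x = 0 := by
      have : Q * x = 0 := by linear_combination (a3 - a2) / 4
      exact (mul_eq_zero.1 this).resolve_left hQ0.ne'
    subst hx0
    have hyP2 : y ≤ P := by nlinarith
    refine ⟨2, 3, fun m hm => ?_⟩
    fin_cases m
    · exfalso
      have a0 := e0 hm
      have : P * y = P ^ 2 - Q ^ 2 := by linear_combination (a2 - a0) / 2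
      have h3 : (P - y) * P = Q ^ 2 := by linear_combination -this
      have h4 : (P - y) ^ 2 = Q ^ 2 := by linear_combination a0
      have h5 : P - y ≠ 0 := by
        intro h; rw [h] at h3; nlinarith
      have h6 : P = P - y := mul_left_cancel₀ h5 (by linear_combination h3 - h4)
      nlinarith
    · exact absurd hm n1
    · left; rfl
    · right; rfl
    · exfalso; have := e4 hm; nlinarith
    · exfalso; rcases e5 hm with h | h <;> nlinarith
  by_cases c45 : RightOnPair Q P x y 4 ∧ RightOnPair Q P x y 5
  · have a4 := e4 c45.1
    refine ⟨4, 5, fun m hm => ?_⟩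
    rcases e5 c45.2 with a5 | a5
    · have hy0 : y = 0 := by
        have : P * y = 0 := by linear_combination (a4 - a5) / 2
        exact (mul_eq_zero.1 this).resolve_left hP0.ne'
      subst hy0
      have hxP : x > Q + P := by
        by_contra hcon
        have : Q * x ≤ Q * (Q + P) := by nlinarith
        nlinarith
      fin_cases m
      · exfalso; have := e0 hm; nlinarith
      · exact absurd hm n1
      · exfalso; have := e2 hm; nlinarith
      · exfalso; have := e3 hm; nlinarith
      · left; rfl
      · right; rfl
    · have hx0 : x = 0 := by
        have : Q * x = 0 := by linear_combination (a4 + a5) / 2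
        exact (mul_eq_zero.1 this).resolve_left hQ0.ne'
      subst hx0
      have h3 : P * (y - P) = Q ^ 2 := by linear_combination a4
      have hyP2 : y > P := by
        by_contra hcon
        nlinarith
      fin_cases m
      · exfalso
        have a0 := e0 hm
        have h6 : P = y - P := mul_right_cancel₀ (sub_ne_zero.2 hyP2.ne')
          (by linear_combination h3 - a0)
        nlinarith
      · exact absurd hm n1
      · exfalso; have := e2 hm; nlinarith
      · exfalso; have := e3 hm; nlinarith
      · left; rfl
      · right; rfl
  by_cases c0 : RightOnPair Q P x y 0
  · have a0 := e0 c0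
    have v4 : RightOnPair Q P x y 2 → ¬ RightOnPair Q P x y 4 := fun b d => by
      have := e2 b
      have := e4 d
      exact hmulP (by linarith)
    have v5 : RightOnPair Q P x y 2 → ¬ RightOnPair Q P x y 5 := fun b d => by
      have := e2 b
      rcases e5 d with h | h <;> nlinarith
    have w4 : RightOnPair Q P x y 3 → ¬ RightOnPair Q P x y 4 := fun b d => by
      have := e3 b
      have := e4 d
      nlinarith
    have w5 : RightOnPair Q P x y 3 → ¬ RightOnPair Q P x y 5 := fun b d => by
      have := e3 b
      rcases e5 d with h | h <;> nlinarith
    by_cases b2 : RightOnPair Q P x y 2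
    · refine ⟨0, 2, fun m hm => ?_⟩
      fin_cases m <;> grind
    by_cases b3 : RightOnPair Q P x y 3
    · refine ⟨0, 3, fun m hm => ?_⟩
      fin_cases m <;> grind
    by_cases b4 : RightOnPair Q P x y 4
    · refine ⟨0, 4, fun m hm => ?_⟩
      fin_cases m <;> grind
    · refine ⟨0, 5, fun m hm => ?_⟩
      fin_cases m <;> grind
  · by_cases b2 : RightOnPair Q P x y 2 <;> by_cases b4 : RightOnPair Q P x y 4
    · refine ⟨2, 4, fun m hm => ?_⟩
      fin_cases m <;> grind
    · refine ⟨2, 5, fun m hm => ?_⟩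
      fin_cases m <;> grind
    · refine ⟨3, 4, fun m hm => ?_⟩
      fin_cases m <;> grind
    · refine ⟨3, 5, fun m hm => ?_⟩
      fin_cases m <;> grind

/-- Reflection of the six pairs in the vertical, respectively horizontal, axis. -/
theorem rightOnPair_neg_left {Q P x y : ℝ} (m : Fin 6) :
    RightOnPair Q P x y m ↔ RightOnPair Q P (-x) y ((![0, 1, 3, 2, 5, 4] : Fin 6 → Fin 6) m) := by
  fin_cases m
  · show _ ∨ _ ∨ _ ↔ _ ∨ _ ∨ _
    rw [neg_sq, neg_eq_iff_eq_neg, neg_inj]; tauto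
  · show _ ∨ _ ∨ _ ↔ _ ∨ _ ∨ _
    rw [neg_sq, neg_eq_iff_eq_neg, neg_inj]; tauto
  · show _ ∨ _ ∨ _ ↔ _ ∨ _ ∨ _
    rw [show (-x + Q) ^ 2 = (x - Q) ^ 2 by ring]
  · show _ ∨ _ ∨ _ ↔ _ ∨ _ ∨ _
    rw [show (-x - Q) ^ 2 = (x + Q) ^ 2 by ring]
  · show _ ∨ _ ∨ _ ↔ _ ∨ _ ∨ _
    rw [neg_sq, show Q * -x - P * y = -(Q * x + P * y) by ring, neg_eq_iff_eq_neg, neg_inj]; tauto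
  · show _ ∨ _ ∨ _ ↔ _ ∨ _ ∨ _
    rw [neg_sq, show Q * -x + P * y = -(Q * x - P * y) by ring, neg_eq_iff_eq_neg, neg_inj]; tauto

theorem rightOnPair_neg_right {Q P x y : ℝ} (m : Fin 6) :
    RightOnPair Q P x y m ↔ RightOnPair Q P x (-y) ((![1, 0, 2, 3, 5, 4] : Fin 6 → Fin 6) m) := by
  fin_cases m
  · show _ ∨ _ ∨ _ ↔ _ ∨ _ ∨ _
    rw [show (-y + P) ^ 2 = (y - P) ^ 2 by ring]
  · show _ ∨ _ ∨ _ ↔ _ ∨ _ ∨ _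
    rw [show (-y - P) ^ 2 = (y + P) ^ 2 by ring]
  · show _ ∨ _ ∨ _ ↔ _ ∨ _ ∨ _
    rw [neg_sq, neg_eq_iff_eq_neg, neg_inj]; tauto
  · show _ ∨ _ ∨ _ ↔ _ ∨ _ ∨ _
    rw [neg_sq, neg_eq_iff_eq_neg, neg_inj]; tauto
  · show _ ∨ _ ∨ _ ↔ _ ∨ _ ∨ _
    rw [neg_sq, show Q * x - P * -y = Q * x + P * y by ring]
  · show _ ∨ _ ∨ _ ↔ _ ∨ _ ∨ _
    rw [neg_sq, show Q * x + P * -y = Q * x - P * y by ring]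

/-- A point which is not a vertex of the rectangle forms a right triangle with at most two pairs
of vertices, outside of two exceptional positions on the lines carrying the sides. -/
theorem rightOnPair_le_two {Q P x y : ℝ} (hQ : 5 ≤ Q) (hP : P = Q + 1)
    (hv : ¬ (|x| = Q ∧ |y| = P)) (h1 : ¬ (|x| = Q ∧ P * |y| = P ^ 2 + 2 * Q ^ 2))
    (h2 : ¬ (|y| = P ∧ Q * |x| = Q ^ 2 + 2 * P ^ 2)) :
    ∃ i j : Fin 6, ∀ m, RightOnPair Q P x y m → m = i ∨ m = j := by
  obtain ⟨i, j, h⟩ := rightOnPair_nonneg hQ hP (abs_nonneg x) (abs_nonneg y) hv h1 h2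
  have hy : ∃ i j : Fin 6, ∀ m, RightOnPair Q P |x| y m → m = i ∨ m = j := by
    rcases abs_choice y with e | e
    · exact ⟨i, j, fun m hm => h m (by rw [e]; exact hm)⟩
    · refine ⟨(![1, 0, 2, 3, 5, 4] : Fin 6 → Fin 6) i, (![1, 0, 2, 3, 5, 4] : Fin 6 → Fin 6) j,
        fun m hm => ?_⟩
      have := h _ (by rw [e]; exact (rightOnPair_neg_right m).1 hm)
      clear * - this
      revert this; revert m i j; decide
  obtain ⟨i, j, h⟩ := hy
  rcases abs_choice x with e | e
  · exact ⟨i, j, fun m hm => h m (by rw [e]; exact hm)⟩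
  · refine ⟨(![0, 1, 3, 2, 5, 4] : Fin 6 → Fin 6) i, (![0, 1, 3, 2, 5, 4] : Fin 6 → Fin 6) j,
      fun m hm => ?_⟩
    have := h _ (by rw [e]; exact (rightOnPair_neg_left m).1 hm)
    clear * - this
    revert this; revert m i j; decide

theorem dot_comm (u v : ℂ) : dot u v = dot v u := by simp only [dot]; ring

theorem rightAt_affine {e m n a b : ℂ} (he : e ≠ 0) (τ : Fin 3) :
    RightAt τ (m + e * n) (m + e * a) (m + e * b) ↔ RightAt τ n a b := by
  have key : ∀ u v w t : ℂ, dot ((m + e * u) - (m + e * v)) ((m + e * w) - (m + e * t)) = 0 ↔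
      dot (u - v) (w - t) = 0 := fun u v w t => by
    rw [show (m + e * u) - (m + e * v) = e * (u - v) by ring,
      show (m + e * w) - (m + e * t) = e * (w - t) by ring, dot_mul_left, mul_eq_zero]
    simp [he]
  fin_cases τ <;> exact key _ _ _ _

theorem rightOnPair_of_rightAt {Q : ℤ} (hQ : 5 ≤ Q) {w : ℂ} {p q : Bool × Bool} (hpq : p ≠ q)
    {τ : Fin 3} (h : RightAt τ w (vtx Q p).toComplex (vtx Q q).toComplex) :
    RightOnPair Q (Q + 1) w.re w.im (pairIndex p q) := by
  have hQ' : (5 : ℝ) ≤ Q := by exact_mod_cast hQ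
  have hQ0 : (Q : ℝ) ≠ 0 := by positivity
  have hQ1 : (Q : ℝ) + 1 ≠ 0 := by positivity
  rcases p with ⟨_ | _, _ | _⟩ <;> rcases q with ⟨_ | _, _ | _⟩ <;>
    first
    | exact absurd rfl hpq
    | skip
  all_goals
    fin_cases τ <;>
    simp only [RightAt, dot, Complex.sub_re, Complex.sub_im, toComplex_vtx_re,
      toComplex_vtx_im, bsign, pairIndex, RightOnPair, Bool.false_eq_true, if_true, if_false,
      Int.cast_one, Int.cast_neg, one_mul, neg_mul, reduceCtorEq] at h ⊢
  all_goals
    first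
    | (right; right; linear_combination h)
    | (left; refine mul_left_cancel₀ hQ0 ?_; linear_combination h / 2)
    | (left; refine mul_left_cancel₀ hQ0 ?_; linear_combination -h / 2)
    | (right; left; refine mul_left_cancel₀ hQ0 ?_; linear_combination h / 2)
    | (right; left; refine mul_left_cancel₀ hQ0 ?_; linear_combination -h / 2)
    | (left; refine mul_left_cancel₀ hQ1 ?_; linear_combination h / 2)
    | (left; refine mul_left_cancel₀ hQ1 ?_; linear_combination -h / 2)
    | (right; left; refine mul_left_cancel₀ hQ1 ?_; linear_combination h / 2)
    | (right; left; refine mul_left_cancel₀ hQ1 ?_; linear_combination -h / 2)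
    | (left; linear_combination h / 2)
    | (left; linear_combination -h / 2)
    | (right; left; linear_combination h / 2)

theorem abs_eq_sign_mul (x : ℝ) : ∃ σ : ℤ, (σ = 1 ∨ σ = -1) ∧ x = σ * |x| := by
  rcases abs_choice x with e | e
  · exact ⟨1, Or.inl rfl, by rw [e]; simp⟩
  · exact ⟨-1, Or.inr rfl, by rw [e]; simp⟩

/-- A lattice point which is not a vertex of a rectangle `m + e (± Q ± i (Q + 1))`, with `e`
congruent to `1` modulo `15`, forms right triangles with at most two pairs of vertices. -/
theorem false_of_three_rightAt {Q : ℤ} (hQ : Q % 15 = 5) (hQ5 : 5 ≤ Q) {n m e f : GaussianInt}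
    (he : e = 1 + 15 * f) (hn : ∀ v, n ≠ m + e * vtx Q v) {p q z y s t : Bool × Bool}
    (hpq : p ≠ q) (hzy : z ≠ y) (hst : s ≠ t) (h12 : pairIndex p q ≠ pairIndex z y)
    (h13 : pairIndex p q ≠ pairIndex s t) (h23 : pairIndex z y ≠ pairIndex s t)
    {τ₁ τ₂ τ₃ : Fin 3}
    (r1 : RightAt τ₁ n.toComplex (m + e * vtx Q p).toComplex (m + e * vtx Q q).toComplex)
    (r2 : RightAt τ₂ n.toComplex (m + e * vtx Q z).toComplex (m + e * vtx Q y).toComplex)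
    (r3 : RightAt τ₃ n.toComplex (m + e * vtx Q s).toComplex (m + e * vtx Q t).toComplex) :
    False := by
  have he0 : e ≠ 0 := by
    rintro rfl
    have := congrArg Zsqrtd.re he
    simp at this
    omega
  have he0' : e.toComplex ≠ 0 := by
    rwa [Ne, GaussianInt.toComplex_eq_zero]
  obtain ⟨w, hw⟩ : ∃ w : ℂ, n.toComplex = m.toComplex + e.toComplex * w :=
    ⟨(n.toComplex - m.toComplex) / e.toComplex, by field_simp; ring⟩
  simp only [map_add, map_mul, hw, rightAt_affine he0'] at r1 r2 r3
  -- an integral multiple of `w` with Gaussian integer value gives an identity in `ℤ[i]`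
  have int : ∀ (c a b : ℤ), (c : ℝ) * w.re = a → (c : ℝ) * w.im = b →
      (c : GaussianInt) * (n - m) = e * ⟨a, b⟩ := by
    intro c a b ha hb
    apply GaussianInt.toComplex_injective
    have h1 : GaussianInt.toComplex ⟨a, b⟩ = c * w := by
      apply Complex.ext
      · rw [← GaussianInt.intCast_re]; simp [ha]
      · rw [← GaussianInt.intCast_im]; simp [hb]
    rw [map_mul, map_mul, map_sub, h1, hw]
    simp
    ring
  obtain ⟨σ, hσ, ex⟩ := abs_eq_sign_mul w.re
  obtain ⟨ρ, hρ, ey⟩ := abs_eq_sign_mul w.im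
  have hP0 : (0 : ℝ) < (Q : ℝ) + 1 := by
    have : (5 : ℝ) ≤ Q := by exact_mod_cast hQ5
    linarith
  obtain ⟨i, j, hij⟩ := rightOnPair_le_two (Q := Q) (P := Q + 1) (x := w.re) (y := w.im)
    (by exact_mod_cast hQ5) rfl
    (by
      rintro ⟨h1, h2⟩
      rw [h1] at ex
      rw [h2] at ey
      refine hn (decide (σ = 1), decide (ρ = 1)) ?_
      have := int 1 (σ * Q) (ρ * (Q + 1)) (by rw [ex]; push_cast; ring)
        (by rw [ey]; push_cast; ring)
      have h3 : vtx Q (decide (σ = 1), decide (ρ = 1)) = ⟨σ * Q, ρ * (Q + 1)⟩ := by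
        rcases hσ with rfl | rfl <;> rcases hρ with rfl | rfl <;> simp [vtx, bsign]
      rw [h3]
      rw [Int.cast_one, one_mul] at this
      rw [← this]; ring)
    (by
      rintro ⟨h1, h2⟩
      -- this exceptional point is excluded modulo `3`, where `Q + 1 = 0`
      have h3 := int (Q + 1) (σ * Q * (Q + 1)) (ρ * ((Q + 1) ^ 2 + 2 * Q ^ 2))
        (by rw [ex, h1]; push_cast; ring)
        (by rw [ey]; push_cast; rw [← h2]; ring)
      have h4 := congrArg (fun z : GaussianInt => ((z.im : ℤ) : ZMod 3)) h3
      have hQ3 : ((Q : ℤ) : ZMod 3) = 2 := by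
        rw [show Q = 3 * (5 * (Q / 15) + 1) + 2 by omega]
        push_cast
        rw [show (3 : ZMod 3) = 0 from rfl]; ring
      have h15 : (15 : ZMod 3) = 0 := rfl
      rw [he] at h4
      simp [hQ3, h15] at h4
      rw [show (2 + 1 : ZMod 3) = 0 from rfl, zero_mul] at h4
      rcases hρ with rfl | rfl <;> revert h4 <;> push_cast <;> decide)
    (by
      rintro ⟨h1, h2⟩
      -- this exceptional point is excluded modulo `5`, where `Q = 0`
      have h3 := int Q (σ * (Q ^ 2 + 2 * (Q + 1) ^ 2)) (ρ * (Q + 1) * Q)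
        (by rw [ex]; push_cast; rw [← h2]; ring)
        (by rw [ey, h1]; push_cast; ring)
      have h4 := congrArg (fun z : GaussianInt => ((z.re : ℤ) : ZMod 5)) h3
      have hQ5 : ((Q : ℤ) : ZMod 5) = 0 := by
        rw [show Q = 5 * (3 * (Q / 15) + 1) by omega]
        push_cast
        rw [show (5 : ZMod 5) = 0 from rfl]; ring
      have h15 : (15 : ZMod 5) = 0 := rfl
      rw [he] at h4
      simp [hQ5, h15] at h4
      rcases hσ with rfl | rfl <;> revert h4 <;> push_cast <;> decide)
  have a1 := hij _ (rightOnPair_of_rightAt hQ5 hpq r1)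
  have a2 := hij _ (rightOnPair_of_rightAt hQ5 hzy r2)
  have a3 := hij _ (rightOnPair_of_rightAt hQ5 hst r3)
  grind

/-! ### Generic coefficients: no accidental right angles -/

/-- The values of independent functionals lie in a set of at most `|B|ʳ / C` elements for at most
a proportion `1 / C` of the coefficients. -/
theorem card_filter_eval_mem_mul_le {ι : Type*} [Fintype ι] [DecidableEq ι] {r : ℕ}
    (v : Fin r → ι → GaussianInt)
    (hv : LinearIndependent ℂ (fun i => (fun S => ((v i S : GaussianInt) : ℂ))))
    (B : Finset GaussianInt) (hB : B.Nonempty) (b : Fin r → GaussianInt) (D : GaussianInt)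
    (hD : D ≠ 0) (W : Finset (Fin r → GaussianInt)) (C : ℕ) (hC : W.card * C ≤ B.card ^ r) :
    ((Fintype.piFinset fun _ : ι => B).filter
      (fun g => (fun i => b i + D * ∑ S, v i S * g S) ∈ W)).card * C ≤
      (Fintype.piFinset fun _ : ι => B).card := by
  have h := card_filter_eval_mem_le v hv B b D hD W
  rw [show (Fintype.piFinset fun _ : ι => B).card = B.card ^ Fintype.card ι by simp]
  refine Nat.le_of_mul_le_mul_right ?_ (pow_pos hB.card_pos r)
  calc _ = _ * B.card ^ r * C := by ring
    _ ≤ B.card ^ Fintype.card ι * W.card * C := Nat.mul_le_mul_right _ h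
    _ = B.card ^ Fintype.card ι * (W.card * C) := by ring
    _ ≤ _ := Nat.mul_le_mul_left _ hC

theorem zero_mem_gaussBox (R : ℕ) : (0 : GaussianInt) ∈ gaussBox R := by
  rw [mem_gaussBox]; simp

theorem dot_toComplex (u v : GaussianInt) :
    dot u.toComplex v.toComplex = ((u.re * v.re + u.im * v.im : ℤ) : ℝ) := by
  simp only [dot, ← GaussianInt.intCast_re, ← GaussianInt.intCast_im]
  push_cast; ring

/-- The rotation by a right angle, or the identity. -/
def turn (k : Bool) : GaussianInt := if k then 1 else ⟨0, 1⟩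

theorem turn_mul_mem_gaussBox {R : ℕ} {u : GaussianInt} (k : Bool) (hu : u ∈ gaussBox R) :
    turn k * u ∈ gaussBox R := by
  rw [mem_gaussBox] at *
  cases k <;> simp [turn]
  · omega
  · exact hu

/-- Let `L` be finitely many nonzero linear functionals with values in a box. For a suitable
choice of the coefficients, the values of two of the functionals are orthogonal, or parallel, only
when this is the case identically. -/
theorem exists_generic_directions {ι ε : Type*} [Fintype ι] [DecidableEq ι] [Fintype ε]
    (L : ε → ι → GaussianInt) (hL : ∀ e, L e ≠ 0) (b : ι → GaussianInt) (B R : ℕ) (hR1 : 1 ≤ R)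
    (hR : ∀ e, ∀ h ∈ Fintype.piFinset fun _ : ι => gaussBox B,
      ∑ S, L e S * (b S + h S) ∈ gaussBox R)
    (h1 : 2 * Fintype.card ε ^ 2 + 1 ≤ (2 * B + 1) ^ 2)
    (h2 : (120 * R ^ 2 * (1 + Real.log R)) * (2 * Fintype.card ε ^ 2 + 1 : ℕ) ≤
      ((2 * B + 1 : ℕ) : ℝ) ^ 4) :
    ∃ h ∈ Fintype.piFinset fun _ : ι => gaussBox B, ∀ (e e' : ε) (k : Bool),
      (∃ c : ℂ, (∀ S, (L e' S).toComplex = c * (L e S).toComplex) ∧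
        dot (turn k).toComplex c = 0) ∨
      dot (turn k * ∑ S, L e S * (b S + h S)).toComplex (∑ S, L e' S * (b S + h S)).toComplex
        ≠ 0 := by
  have hBne : (gaussBox B).Nonempty := ⟨0, zero_mem_gaussBox B⟩
  suffices key : _ by
    obtain ⟨h, hh, hh'⟩ := exists_forall_not_of_card (ε := ε × ε × Bool)
      (Fintype.piFinset fun _ : ι => gaussBox B)
      ⟨fun _ => 0, Fintype.mem_piFinset.2 fun _ => zero_mem_gaussBox B⟩
      (fun E h => ¬ (∃ c : ℂ, (∀ S, (L E.2.1 S).toComplex = c * (L E.1 S).toComplex) ∧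
          dot (turn E.2.2).toComplex c = 0) ∧
        dot (turn E.2.2 * ∑ S, L E.1 S * (b S + h S)).toComplex
          (∑ S, L E.2.1 S * (b S + h S)).toComplex = 0)
      (2 * Fintype.card ε ^ 2 + 1)
      (by rw [Fintype.card_prod, Fintype.card_prod, Fintype.card_bool, sq]; linarith) key
    refine ⟨h, hh, fun e e' k => ?_⟩
    by_contra hcon
    exact hh' (e, e', k) (by simpa only [not_or, ne_eq, not_not] using hcon)
  rintro ⟨e, e', k⟩
  simp only
  set Lc : ε → ι → ℂ := fun e S => (L e S).toComplex with hLc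
  have hLc0 : Lc e ≠ 0 := fun h0 => hL e (funext fun S => by
    have := congrFun h0 S
    simpa [hLc] using this)
  by_cases hind : LinearIndependent ℂ (fun i : Fin 2 => fun S =>
      (((![L e, L e'] : Fin 2 → ι → GaussianInt) i S : GaussianInt) : ℂ))
  · -- independent functionals: the bad pairs of values are orthogonal pairs in a box
    classical
    set W0 := (gaussBox R ×ˢ gaussBox R).filter
        (fun p => p.1.re * p.2.re + p.1.im * p.2.im = 0) with hW0
    let W : Finset (Fin 2 → GaussianInt) := W0.image fun p => ![star (turn k) * p.1, p.2]
    have hWcard : W.card * (2 * Fintype.card ε ^ 2 + 1) ≤ (gaussBox B).card ^ 2 := by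
      have hb := card_orthogonal_pairs_le R hR1
      rw [← hW0] at hb
      have hW : (W.card : ℝ) ≤ W0.card := Nat.cast_le.2 Finset.card_image_le
      rw [card_gaussBox, ← pow_mul]
      have : ((W.card * (2 * Fintype.card ε ^ 2 + 1) : ℕ) : ℝ) ≤ (((2 * B + 1) ^ 4 : ℕ) : ℝ) := by
        rw [Nat.cast_mul, Nat.cast_pow]
        refine le_trans ?_ h2
        exact mul_le_mul_of_nonneg_right (hW.trans hb) (Nat.cast_nonneg _)
      exact Nat.cast_le.1 this
    refine ⟨_, fun h hh hbad => ?_, card_filter_eval_mem_mul_le _ hind (gaussBox B) hBne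
      ![∑ S, L e S * b S, ∑ S, L e' S * b S] 1 one_ne_zero W _ hWcard⟩
    rw [Finset.mem_filter]
    refine ⟨hh, Finset.mem_image.2 ⟨(turn k * ∑ S, L e S * (b S + h S),
      ∑ S, L e' S * (b S + h S)), ?_, ?_⟩⟩
    · rw [hW0, Finset.mem_filter, Finset.mem_product]
      refine ⟨⟨turn_mul_mem_gaussBox k (hR e h hh), hR e' h hh⟩, ?_⟩
      have := hbad.2
      rw [dot_toComplex] at this
      exact_mod_cast this
    · have ht : star (turn k) * turn k = 1 := by cases k <;> simp [turn, Zsqrtd.ext_iff]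
      funext i
      fin_cases i
      · simp only [← mul_assoc, ht, one_mul, mul_add, Finset.sum_add_distrib]
        rfl
      · simp only [mul_add, one_mul, Finset.sum_add_distrib]
        rfl
  · -- proportional functionals: an accidental right angle forces their values to vanish
    have hc : ∃ c : ℂ, ∀ S, (L e' S).toComplex = c * (L e S).toComplex := by
      have h3 : ¬ LinearIndependent ℂ ![Lc e, Lc e'] := by
        intro h3
        apply hind
        convert h3 using 2 with i
        fin_cases i <;> rfl
      rw [LinearIndependent.pair_iff' hLc0] at h3
      push Not at h3
      obtain ⟨c, hc⟩ := h3
      exact ⟨c, fun S => (congrFun hc S).symm⟩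
    obtain ⟨c, hc⟩ := hc
    have hind1 : LinearIndependent ℂ (fun i : Fin 1 => fun S =>
      (((![L e] : Fin 1 → ι → GaussianInt) i S : GaussianInt) : ℂ)) := by
      rw [linearIndependent_unique_iff]
      exact hLc0
    refine ⟨_, fun h hh hbad => ?_, card_filter_eval_mem_mul_le _ hind1 (gaussBox B) hBne
      ![∑ S, L e S * b S] 1 one_ne_zero {fun _ => 0} _
      (by rw [Finset.card_singleton, one_mul, card_gaussBox, pow_one]; exact h1)⟩
    rw [Finset.mem_filter]
    refine ⟨hh, ?_⟩
    rw [Finset.mem_singleton]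
    have e1 : (∑ S, L e' S * (b S + h S)).toComplex = c * (∑ S, L e S * (b S + h S)).toComplex := by
      rw [map_sum, map_sum, Finset.mul_sum]
      refine Finset.sum_congr rfl fun S _ => ?_
      rw [map_mul, map_mul, hc S, mul_assoc]
    have h3 := hbad.2
    rw [e1, map_mul, mul_comm, mul_comm c, dot_mul_left, mul_eq_zero] at h3
    have h4 : ∑ S, L e S * (b S + h S) = 0 := by
      rcases h3 with h3 | h3
      · rw [Complex.normSq_eq_zero] at h3
        exact GaussianInt.toComplex_eq_zero.1 h3
      · exact absurd ⟨c, hc, h3⟩ hbad.1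
    funext i
    fin_cases i
    show ∑ S, L e S * b S + 1 * ∑ S, L e S * h S = 0
    rw [← h4]
    simp only [mul_add, one_mul, Finset.sum_add_distrib]

/-! ### Generic coefficients: no accidental pairs of right triangles -/

theorem sub_mem_gaussBox {R : ℕ} {u v : GaussianInt} (hu : u ∈ gaussBox R) (hv : v ∈ gaussBox R) :
    u - v ∈ gaussBox (2 * R) := by
  rw [mem_gaussBox] at *
  simp only [Zsqrtd.re_sub, Zsqrtd.im_sub]
  push_cast
  omega

/-- The right triangles in a box, of the type given by `τ`. -/
noncomputable def rightTriples (τ : Fin 3) (R : ℕ) :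
    Finset (GaussianInt × GaussianInt × GaussianInt) :=
  open Classical in
  (gaussBox R ×ˢ gaussBox R ×ˢ gaussBox R).filter fun t =>
    RightAt τ t.1.toComplex t.2.1.toComplex t.2.2.toComplex

theorem card_rightTriples_le (τ : Fin 3) {R : ℕ} (hR : 1 ≤ R) :
    ((rightTriples τ R).card : ℝ) ≤
      (2 * R + 1) ^ 2 * (480 * R ^ 2 * (1 + Real.log (2 * R))) := by
  classical
  set W0 := (gaussBox (2 * R) ×ˢ gaussBox (2 * R)).filter
        (fun p => p.1.re * p.2.re + p.1.im * p.2.im = 0) with hW0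
  have hb := card_orthogonal_pairs_le (2 * R) (by omega)
  rw [← hW0] at hb
  have key : (rightTriples τ R).card ≤ (gaussBox R ×ˢ W0).card := by
    have hdot : ∀ {a b c d : GaussianInt}, a ∈ gaussBox R → b ∈ gaussBox R → c ∈ gaussBox R →
        d ∈ gaussBox R → dot (a.toComplex - b.toComplex) (c.toComplex - d.toComplex) = 0 →
        (a - b, c - d) ∈ W0 := by
      intro a b c d ha hb hc hd h
      rw [hW0, Finset.mem_filter, Finset.mem_product]
      refine ⟨⟨sub_mem_gaussBox ha hb, sub_mem_gaussBox hc hd⟩, ?_⟩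
      rw [← map_sub, ← map_sub, dot_toComplex] at h
      exact_mod_cast h
    refine Finset.card_le_card_of_injOn (fun t => (t.1,
      (match τ with
      | 0 => (t.2.1 - t.1, t.2.2 - t.1)
      | 1 => (t.1 - t.2.1, t.2.2 - t.2.1)
      | 2 => (t.1 - t.2.2, t.2.1 - t.2.2)))) ?_ ?_
    · rintro ⟨n, p, q⟩ ht
      simp only [rightTriples, Finset.coe_filter, Finset.mem_product, Set.mem_ofPred_eq] at ht
      obtain ⟨⟨hn, hp, hq⟩, hr⟩ := ht
      simp only [Finset.coe_product, Set.mem_prod, Finset.mem_coe]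
      refine ⟨hn, ?_⟩
      fin_cases τ
      · exact hdot hp hn hq hn hr
      · exact hdot hn hp hq hp hr
      · exact hdot hn hq hp hq hr
    · rintro ⟨n, p, q⟩ - ⟨n', p', q'⟩ - h
      obtain ⟨rfl, h⟩ := Prod.mk.inj h
      fin_cases τ <;> obtain ⟨h1, h2⟩ := Prod.mk.inj h <;> simp only at h1 h2
      · rw [sub_left_inj.1 h1, sub_left_inj.1 h2]
      · rw [sub_right_inj.1 h1] at h2 ⊢
        rw [sub_left_inj.1 h2]
      · rw [sub_right_inj.1 h1] at h2 ⊢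
        rw [sub_left_inj.1 h2]
  have h2 : ((rightTriples τ R).card : ℝ) ≤ ((gaussBox R ×ˢ W0).card : ℕ) := Nat.cast_le.2 key
  refine h2.trans ?_
  rw [Finset.card_product, card_gaussBox]
  push_cast at hb ⊢
  refine mul_le_mul_of_nonneg_left ?_ (by positivity)
  linarith

/-- For a suitable choice of the coefficients, two right triangles with a common lattice vertex
and the four other vertices among the values of given functionals exist only if there is a
linear relation between the functionals which forces them. -/
theorem exists_generic_right_angles {ι ε : Type*} [Fintype ι] [DecidableEq ι] [Fintype ε]
    (L : ε → ι → GaussianInt) (b : ι → GaussianInt) (M R : ℕ) (hR1 : 1 ≤ R) (hMR : M ≤ R)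
    (hR : ∀ e, ∀ g ∈ Fintype.piFinset fun _ : ι => gaussBox M,
      ∑ S, L e S * (b S + 15 * g S) ∈ gaussBox R)
    (hcount : ((2 * R + 1) ^ 2 * (480 * R ^ 2 * (1 + Real.log (2 * R)))) *
      (2 * (2 * R + 1) * (2 * R + 1) ^ 2 * (9 * Fintype.card ε ^ 4 + 1) : ℕ) ≤
      ((2 * M + 1 : ℕ) : ℝ) ^ 8) :
    ∃ g ∈ Fintype.piFinset fun _ : ι => gaussBox M, ∀ (p q z y : ε) (τ₁ τ₂ : Fin 3),
      ∀ n ∈ gaussBox R,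
      LinearIndependent ℂ ![fun S => (L p S).toComplex, fun S => (L q S).toComplex,
        fun S => (L z S).toComplex] →
      RightAt τ₁ n.toComplex (∑ S, L p S * (b S + 15 * g S)).toComplex
        (∑ S, L q S * (b S + 15 * g S)).toComplex →
      RightAt τ₂ n.toComplex (∑ S, L z S * (b S + 15 * g S)).toComplex
        (∑ S, L y S * (b S + 15 * g S)).toComplex →
      n ≠ ∑ S, L y S * (b S + 15 * g S) →
      ∃ β γ δ : ℂ, (∀ S, (L y S).toComplex = β * (L z S).toComplex + γ * (L p S).toComplex +
          δ * (L q S).toComplex) ∧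
        (∑ S, L y S * (b S + 15 * g S)).toComplex - n.toComplex =
          β * ((∑ S, L z S * (b S + 15 * g S)).toComplex - n.toComplex) := by
  classical
  have hBne : (gaussBox M).Nonempty := ⟨0, zero_mem_gaussBox M⟩
  have h15 : (15 : GaussianInt) ≠ 0 := by
    intro h
    have := congrArg Zsqrtd.re h
    simp at this
  set C := 9 * Fintype.card ε ^ 4 + 1 with hC
  have count : ∀ τ, (rightTriples τ R).card * (2 * (2 * R + 1) * (2 * R + 1) ^ 2 * C) ≤
      (2 * M + 1) ^ 8 := fun τ => by
    have : (((rightTriples τ R).card * (2 * (2 * R + 1) * (2 * R + 1) ^ 2 * C) : ℕ) : ℝ) ≤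
        (((2 * M + 1) ^ 8 : ℕ) : ℝ) := by
      rw [Nat.cast_mul, Nat.cast_pow]
      exact le_trans (mul_le_mul_of_nonneg_right (card_rightTriples_le τ hR1)
        (Nat.cast_nonneg _)) hcount
    exact Nat.cast_le.1 this
  suffices key : _ by
    obtain ⟨g, hg, hg'⟩ := exists_forall_not_of_card
      (ε := (ε × ε × ε × ε) × (Fin 3 × Fin 3))
      (Fintype.piFinset fun _ : ι => gaussBox M)
      ⟨fun _ => 0, Fintype.mem_piFinset.2 fun _ => zero_mem_gaussBox M⟩
      (fun E g => ∃ n ∈ gaussBox R,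
        LinearIndependent ℂ ![fun S => (L E.1.1 S).toComplex, fun S => (L E.1.2.1 S).toComplex,
          fun S => (L E.1.2.2.1 S).toComplex] ∧
        RightAt E.2.1 n.toComplex (∑ S, L E.1.1 S * (b S + 15 * g S)).toComplex
          (∑ S, L E.1.2.1 S * (b S + 15 * g S)).toComplex ∧
        RightAt E.2.2 n.toComplex (∑ S, L E.1.2.2.1 S * (b S + 15 * g S)).toComplex
          (∑ S, L E.1.2.2.2 S * (b S + 15 * g S)).toComplex ∧
        n ≠ ∑ S, L E.1.2.2.2 S * (b S + 15 * g S) ∧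
        ¬ ∃ β γ δ : ℂ, (∀ S, (L E.1.2.2.2 S).toComplex = β * (L E.1.2.2.1 S).toComplex +
            γ * (L E.1.1 S).toComplex + δ * (L E.1.2.1 S).toComplex) ∧
          (∑ S, L E.1.2.2.2 S * (b S + 15 * g S)).toComplex - n.toComplex =
            β * ((∑ S, L E.1.2.2.1 S * (b S + 15 * g S)).toComplex - n.toComplex))
      C (by
        simp only [Fintype.card_prod, Fintype.card_fin]
        rw [hC]
        have : Fintype.card ε * (Fintype.card ε * (Fintype.card ε * Fintype.card ε)) * (3 * 3) =
          9 * Fintype.card ε ^ 4 := by ring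
        omega) key
    refine ⟨g, hg, fun p q z y τ₁ τ₂ n hn hi h1 h2 hne => ?_⟩
    by_contra hcon
    exact hg' ((p, q, z, y), τ₁, τ₂) ⟨n, hn, hi, h1, h2, hne, hcon⟩
  rintro ⟨⟨p, q, z, y⟩, τ₁, τ₂⟩
  simp only
  by_cases hind3 : LinearIndependent ℂ ![fun S => (L p S).toComplex, fun S => (L q S).toComplex,
          fun S => (L z S).toComplex]
  swap
  · exact ⟨∅, fun g _ ⟨n, _, h, _⟩ => absurd h hind3, by simp⟩
  have hsplit : ∀ e (g : ι → GaussianInt), ∑ S, L e S * (b S + 15 * g S) =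
      ∑ S, L e S * b S + 15 * ∑ S, L e S * g S := fun e g => by
    rw [Finset.mul_sum, ← Finset.sum_add_distrib]
    exact Finset.sum_congr rfl fun S _ => by ring
  by_cases hdep : ∃ β γ δ : ℂ, ∀ S, (L y S).toComplex = β * (L z S).toComplex +
            γ * (L p S).toComplex + δ * (L q S).toComplex
  · -- the values at `p`, `q`, `z` are free; when the first two and `n` are given, the second right
    -- angle puts the third one on a line or a circle
    obtain ⟨β, γ, δ, hy⟩ := hdep
    have hyv : ∀ g : ι → GaussianInt, (∑ S, L y S * (b S + 15 * g S)).toComplex =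
        β * (∑ S, L z S * (b S + 15 * g S)).toComplex +
        (γ * (∑ S, L p S * (b S + 15 * g S)).toComplex +
        δ * (∑ S, L q S * (b S + 15 * g S)).toComplex) := fun g => by
      simp only [map_sum, map_mul, Finset.mul_sum, ← Finset.sum_add_distrib]
      refine Finset.sum_congr rfl fun S _ => ?_
      rw [hy S]; ring
    let W : Finset (Fin 3 → GaussianInt) := (rightTriples τ₁ R).biUnion fun t =>
      ((gaussBox R).filter fun z : GaussianInt =>
        γ * t.2.1.toComplex + δ * t.2.2.toComplex ≠ (1 - β) * t.1.toComplex ∧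
        RightAt τ₂ t.1.toComplex z.toComplex
          (β * z.toComplex + (γ * t.2.1.toComplex + δ * t.2.2.toComplex))).image
        fun z => ![t.2.1, t.2.2, z]
    have hW : W.card ≤ (rightTriples τ₁ R).card * (2 * (2 * R + 1)) := by
      refine Finset.card_biUnion_le_card_mul _ _ _ fun t _ => Finset.card_image_le.trans ?_
      by_cases hc : γ * t.2.1.toComplex + δ * t.2.2.toComplex ≠ (1 - β) * t.1.toComplex
      · exact card_rightAt_le R τ₂ _ _ _ hc _ (Finset.filter_subset _ _)
          fun z hz => (Finset.mem_filter.1 hz).2.2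
      · rw [Finset.filter_false_of_mem fun z _ h => hc h.1]
        simp
    have hWC : W.card * C ≤ (gaussBox M).card ^ 3 := by
      rw [card_gaussBox, ← pow_mul]
      refine Nat.le_of_mul_le_mul_right ?_ (show 0 < (2 * M + 1) ^ 2 by positivity)
      have h1 : (2 * M + 1) ^ 2 ≤ (2 * R + 1) ^ 2 := Nat.pow_le_pow_left (by omega) 2
      calc W.card * C * (2 * M + 1) ^ 2
          ≤ ((rightTriples τ₁ R).card * (2 * (2 * R + 1))) * C * (2 * R + 1) ^ 2 :=
            Nat.mul_le_mul (Nat.mul_le_mul_right _ hW) h1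
        _ = (rightTriples τ₁ R).card * (2 * (2 * R + 1) * (2 * R + 1) ^ 2 * C) := by ring
        _ ≤ (2 * M + 1) ^ 8 := count τ₁
        _ = (2 * M + 1) ^ (2 * 3) * (2 * M + 1) ^ 2 := by ring
    have hind : LinearIndependent ℂ (fun i : Fin 3 => fun S =>
        (((![L p, L q, L z] : Fin 3 → ι → GaussianInt) i S : GaussianInt) : ℂ)) := by
      convert hind3 using 2 with i
      fin_cases i <;> rfl
    refine ⟨_, fun g hg hbad => ?_, card_filter_eval_mem_mul_le _ hind (gaussBox M) hBne
      ![∑ S, L p S * b S, ∑ S, L q S * b S, ∑ S, L z S * b S] 15 h15 W _ hWC⟩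
    obtain ⟨n, hn, -, h1, h2, hne, hno⟩ := hbad
    rw [Finset.mem_filter]
    refine ⟨hg, Finset.mem_biUnion.2 ⟨(n, ∑ S, L p S * (b S + 15 * g S),
      ∑ S, L q S * (b S + 15 * g S)), ?_, Finset.mem_image.2
        ⟨∑ S, L z S * (b S + 15 * g S), ?_, ?_⟩⟩⟩
    · simp only [rightTriples, Finset.mem_filter, Finset.mem_product]
      exact ⟨⟨hn, hR p g hg, hR q g hg⟩, h1⟩
    · rw [Finset.mem_filter]
      refine ⟨hR z g hg, fun h => hno ⟨β, γ, δ, hy, ?_⟩, ?_⟩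
      · rw [hyv]
        simp only at h
        linear_combination h
      · simp only
        rw [← hyv]
        exact h2
    · funext i
      fin_cases i <;> exact hsplit _ _
  · -- all four values are free, and the one at `z` lies on a line or a circle given by the others
    -- and `n`
    let W : Finset (Fin 4 → GaussianInt) := (rightTriples τ₁ R ×ˢ gaussBox R).biUnion fun t =>
      ((gaussBox R).filter fun z : GaussianInt =>
        t.2.toComplex ≠ (1 - 0) * t.1.1.toComplex ∧
        RightAt τ₂ t.1.1.toComplex z.toComplex (0 * z.toComplex + t.2.toComplex)).image
        fun z => ![t.2, t.1.2.1, t.1.2.2, z]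
    have hW : W.card ≤ ((rightTriples τ₁ R).card * (2 * R + 1) ^ 2) * (2 * (2 * R + 1)) := by
      rw [← card_gaussBox, ← Finset.card_product]
      refine Finset.card_biUnion_le_card_mul _ _ _ fun t _ => Finset.card_image_le.trans ?_
      by_cases hc : t.2.toComplex ≠ (1 - 0) * t.1.1.toComplex
      · exact card_rightAt_le R τ₂ _ _ _ hc _ (Finset.filter_subset _ _)
          fun z hz => (Finset.mem_filter.1 hz).2.2
      · rw [Finset.filter_false_of_mem fun z _ h => hc h.1]
        simp
    have hWC : W.card * C ≤ (gaussBox M).card ^ 4 := by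
      rw [card_gaussBox, ← pow_mul]
      refine (Nat.mul_le_mul_right _ hW).trans (le_trans (le_of_eq ?_) (count τ₁))
      ring
    have hind : LinearIndependent ℂ (fun i : Fin 4 => fun S =>
        (((![L y, L p, L q, L z] : Fin 4 → ι → GaussianInt) i S : GaussianInt) : ℂ)) := by
      have h4 : LinearIndependent ℂ (Fin.cons (fun S => (L y S).toComplex)
          ![fun S => (L p S).toComplex, fun S => (L q S).toComplex,
          fun S => (L z S).toComplex] : Fin 4 → ι → ℂ) := by
        rw [linearIndependent_finCons]
        refine ⟨hind3, fun hmem => hdep ?_⟩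
        rw [Submodule.mem_span_range_iff_exists_fun] at hmem
        obtain ⟨c, hc⟩ := hmem
        rw [Fin.sum_univ_three] at hc
        refine ⟨c 2, c 0, c 1, fun S => ?_⟩
        rw [← congrFun hc S]
        simp
        ring
      convert h4 using 2 with i
      fin_cases i <;> rfl
    refine ⟨_, fun g hg hbad => ?_, card_filter_eval_mem_mul_le _ hind (gaussBox M) hBne
      ![∑ S, L y S * b S, ∑ S, L p S * b S, ∑ S, L q S * b S, ∑ S, L z S * b S] 15 h15 W _ hWC⟩
    obtain ⟨n, hn, -, h1, h2, hne, hno⟩ := hbad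
    rw [Finset.mem_filter]
    refine ⟨hg, Finset.mem_biUnion.2 ⟨((n, ∑ S, L p S * (b S + 15 * g S),
      ∑ S, L q S * (b S + 15 * g S)), ∑ S, L y S * (b S + 15 * g S)), ?_, Finset.mem_image.2
        ⟨∑ S, L z S * (b S + 15 * g S), ?_, ?_⟩⟩⟩
    · simp only [rightTriples, Finset.mem_filter, Finset.mem_product]
      exact ⟨⟨⟨hn, hR p g hg, hR q g hg⟩, h1⟩, hR y g hg⟩
    · rw [Finset.mem_filter]
      refine ⟨hR z g hg, fun h => hne ?_, ?_⟩
      · simp only [sub_zero, one_mul] at h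
        exact (GaussianInt.toComplex_injective h).symm
      · simp only [zero_mul, zero_add]
        exact h2
    · funext i
      fin_cases i <;> exact hsplit _ _

/-! ### Admissible labels and families -/

/-- The label `p` selects one of the vertices `(+,+)`, `(-,-)` in the first `i` rectangles and one
of the vertices `(+,-)`, `(-,+)` in the others. -/
def Adm {K : ℕ} (i : ℕ) (p : Label K) : Prop := ∀ k : Fin K, (p k).1 = (p k).2 ↔ k.val < i

/-- The label is admissible for some index. -/
def AnyAdm {K : ℕ} (p : Label K) : Prop := ∃ i ≤ K, Adm i p

/-- The label is admissible, whatever its value at `k`. -/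
def FamAt {K : ℕ} (k : Fin K) (p : Label K) : Prop :=
  ∀ m, m ≠ k → ((p m).1 = (p m).2 ↔ m.val < k.val)

/-- Two unordered pairs coincide. -/
def SamePair {α : Type*} (p q z y : α) : Prop := (p = z ∧ q = y) ∨ (p = y ∧ q = z)

section families

variable {K : ℕ}

theorem FamAt.congr {k : Fin K} {p q : Label K} (h : FamAt k p) (hpq : ∀ m, m ≠ k → p m = q m) :
    FamAt k q := fun m hm => by rw [← hpq m hm]; exact h m hm

theorem FamAt.adm_succ {k : Fin K} {p : Label K} (h : FamAt k p) (hk : (p k).1 = (p k).2) :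
    Adm (k.val + 1) p := fun m => by
  by_cases hm : m = k
  · subst hm; simp [hk]
  · rw [h m hm]
    have : m.val ≠ k.val := fun h => hm (Fin.ext h)
    omega

theorem FamAt.adm {k : Fin K} {p : Label K} (h : FamAt k p) (hk : (p k).1 ≠ (p k).2) :
    Adm k.val p := fun m => by
  by_cases hm : m = k
  · subst hm; simp [hk]
  · rw [h m hm]

theorem FamAt.anyAdm {k : Fin K} {p : Label K} (h : FamAt k p) : AnyAdm p := by
  by_cases hk : (p k).1 = (p k).2
  · exact ⟨_, k.2, h.adm_succ hk⟩
  · exact ⟨_, k.2.le, h.adm hk⟩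

/-- If both kinds of vertices occur in a rectangle `k` for admissible labels that agree elsewhere,
then all labels that agree elsewhere are admissible. -/
theorem famAt_of_ne {k : Fin K} {p q : Label K} (hp : AnyAdm p) (hq : AnyAdm q)
    (hpq : ∀ m, m ≠ k → p m = q m) (h1 : (p k).1 = (p k).2) (h2 : (q k).1 ≠ (q k).2) :
    FamAt k p := by
  obtain ⟨i, -, hi⟩ := hp
  obtain ⟨j, -, hj⟩ := hq
  have hki := (hi k).1 h1
  have hkj := mt (hj k).2 h2
  intro m hm
  have hmk : m.val ≠ k.val := fun h => hm (Fin.ext h)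
  constructor
  · intro h
    rw [hpq m hm] at h
    have := (hj m).1 h
    omega
  · intro h
    exact (hi m).2 (by omega)

/-- Three admissible labels that agree except in one rectangle belong to a family. -/
theorem famAt_of_three {k : Fin K} {p q z : Label K} (hp : AnyAdm p) (hq : AnyAdm q)
    (hz : AnyAdm z) (hpq : p ≠ q) (hpz : p ≠ z) (hqz : q ≠ z)
    (h : ∀ m, m ≠ k → p m = q m ∧ p m = z m) : FamAt k p := by
  have ne : ∀ {a b : Label K}, a ≠ b → (∀ m, m ≠ k → a m = b m) → a k ≠ b k := fun hab h hk =>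
    hab (funext fun m => by
      by_cases hm : m = k
      · rw [hm, hk]
      · exact h m hm)
  have h1 : p k ≠ q k := ne hpq fun m hm => (h m hm).1
  have h2 : p k ≠ z k := ne hpz fun m hm => (h m hm).2
  have h3 : q k ≠ z k := ne hqz fun m hm => (h m hm).1.symm.trans (h m hm).2
  have key : ∀ a b c : Bool × Bool, a ≠ b → a ≠ c → b ≠ c →
      (a.1 = a.2 ∧ (b.1 ≠ b.2 ∨ c.1 ≠ c.2)) ∨ (b.1 = b.2 ∧ (a.1 ≠ a.2 ∨ c.1 ≠ c.2)) ∨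
      (c.1 = c.2 ∧ (a.1 ≠ a.2 ∨ b.1 ≠ b.2)) := by decide
  rcases key _ _ _ h1 h2 h3 with ⟨a, b | b⟩ | ⟨a, b | b⟩ | ⟨a, b | b⟩
  · exact famAt_of_ne hp hq (fun m hm => (h m hm).1) a b
  · exact famAt_of_ne hp hz (fun m hm => (h m hm).2) a b
  · exact (famAt_of_ne hq hp (fun m hm => (h m hm).1.symm) a b).congr fun m hm => (h m hm).1.symm
  · exact (famAt_of_ne hq hz (fun m hm => (h m hm).1.symm.trans (h m hm).2) a b).congr
      fun m hm => (h m hm).1.symm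
  · exact (famAt_of_ne hz hp (fun m hm => (h m hm).2.symm) a b).congr fun m hm => (h m hm).2.symm
  · exact (famAt_of_ne hz hq (fun m hm => (h m hm).2.symm.trans (h m hm).1) a b).congr
      fun m hm => (h m hm).2.symm

end families

/-! ### Generic configurations -/

/-- The value at `p` of the multi-affine polynomial with coefficients `c`. -/
noncomputable def value {K : ℕ} (Q : Fin K → ℤ) (c : Finset (Fin K) → GaussianInt) (p : Label K) :
    GaussianInt := ∑ S, ev Q p S * c S

/-- The properties of generic coefficients from which the combinatorial properties of the set of
values at the admissible labels follow: the points are distinct; right angles between them, and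
pairs of right triangles with a common lattice vertex, come only from linear relations between the
evaluations. The congruence on the coefficients makes the derivative with respect to any coordinate,
by which the vertices of a rectangle are multiplied, congruent to `1` modulo `15`. -/
structure Generic {K : ℕ} (Q : Fin K → ℤ) (c : Finset (Fin K) → GaussianInt) : Prop where
  sizes : GoodSizes Q
  coeff : ∀ S, ∃ f, c S = (if S.card = 1 then 1 else 0) + 15 * f
  inj : Function.Injective (value Q c)
  right : ∀ p q z, q ≠ p → z ≠ p →
    dot ((value Q c q).toComplex - (value Q c p).toComplex)
      ((value Q c z).toComplex - (value Q c p).toComplex) = 0 →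
    ∃ a : ℂ, ∀ S, (ev Q z S).toComplex - (ev Q p S).toComplex =
      a * ((ev Q q S).toComplex - (ev Q p S).toComplex)
  triangles : ∀ p q z y (τ₁ τ₂ : Fin 3) (n : GaussianInt), p ≠ q → z ≠ y →
    LinearIndependent ℂ ![fun S => (ev Q p S).toComplex, fun S => (ev Q q S).toComplex,
        fun S => (ev Q z S).toComplex] →
    RightAt τ₁ n.toComplex (value Q c p).toComplex (value Q c q).toComplex →
    RightAt τ₂ n.toComplex (value Q c z).toComplex (value Q c y).toComplex →
    n ≠ value Q c y →
    ∃ β γ δ : ℂ, (∀ S, (ev Q y S).toComplex = β * (ev Q z S).toComplex +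
          γ * (ev Q p S).toComplex + δ * (ev Q q S).toComplex) ∧
        (value Q c y).toComplex - n.toComplex = β * ((value Q c z).toComplex - n.toComplex)

section generic

variable {K : ℕ} {Q : Fin K → ℤ} {c : Finset (Fin K) → GaussianInt}

theorem toComplex_value (p : Label K) :
    (value Q c p).toComplex = ∑ S, (ev Q p S).toComplex * (c S).toComplex := by
  simp [value, map_sum]

theorem ev_of_agree {p q : Label K} {k : Fin K} (h : ∀ m, m ≠ k → q m = p m)
    (S : Finset (Fin K)) :
    ev Q q S = if k ∈ S then vtx (Q k) (q k) * ev Q p (S.erase k) else ev Q p S := by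
  have h' : ∀ T : Finset (Fin K), k ∉ T → ev Q q T = ev Q p T := fun T hT =>
    Finset.prod_congr rfl fun m hm => corner_congr (h m fun e => hT (e ▸ hm))
  split_ifs with hS
  · rw [← h' _ (Finset.notMem_erase k S)]
    exact (Finset.mul_prod_erase S (corner Q q) hS).symm
  · exact h' S hS

/-- The values at the labels which agree outside `k` are vertices of a rectangle. -/
theorem Generic.value_family (h : Generic Q c) (p : Label K) (k : Fin K) :
    ∃ m e f : GaussianInt, e = 1 + 15 * f ∧ ∀ q : Label K, (∀ m, m ≠ k → q m = p m) →
      value Q c q = m + e * vtx (Q k) (q k) := by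
  choose f hf using h.coeff
  refine ⟨∑ S, if k ∈ S then 0 else ev Q p S * c S,
    ∑ S, if k ∈ S then ev Q p (S.erase k) * c S else 0,
    ∑ S, if k ∈ S then ev Q p (S.erase k) * f S else 0, ?_, fun q hq => ?_⟩
  · have h1 : (1 : GaussianInt) = ∑ S : Finset (Fin K), if S = {k} then 1 else 0 := by simp
    rw [Finset.mul_sum]
    conv_rhs => rw [h1]
    rw [← Finset.sum_add_distrib]
    refine Finset.sum_congr rfl fun S _ => ?_
    by_cases hS : k ∈ S
    · simp only [hS, if_true]
      rw [hf S]
      by_cases hS1 : S = {k}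
      · subst hS1; simp [ev]
      · have : S.card ≠ 1 := fun h => by
          obtain ⟨a, rfl⟩ := Finset.card_eq_one.1 h
          rw [Finset.mem_singleton] at hS
          exact hS1 (by rw [hS])
        simp only [this, hS1, if_false]
        ring
    · have hS1 : S ≠ {k} := fun h => hS (by simp [h])
      simp [hS, hS1]
  · rw [Finset.sum_mul, ← Finset.sum_add_distrib]
    refine Finset.sum_congr rfl fun S _ => ?_
    rw [ev_of_agree hq]
    split_ifs <;> ring

theorem linearIndependent_three_iff {ι : Type*} {u v w : ι → ℂ} :
    LinearIndependent ℂ ![u, v, w] ↔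
      ∀ a b c : ℂ, (∀ S, a * u S + b * v S + c * w S = 0) → a = 0 ∧ b = 0 ∧ c = 0 := by
  rw [Fintype.linearIndependent_iff]
  constructor
  · intro h a b c habc
    have := h ![a, b, c] (by
      rw [Fin.sum_univ_three]
      funext S
      simpa using habc S)
    exact ⟨this 0, this 1, this 2⟩
  · intro h g hg
    rw [Fin.sum_univ_three] at hg
    obtain ⟨h0, h1, h2⟩ := h (g 0) (g 1) (g 2) fun S => by simpa using congrFun hg S
    intro i
    fin_cases i
    · exact h0
    · exact h1
    · exact h2

/-- Three distinct labels with linearly dependent evaluations differ in one coordinate only. -/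
theorem GoodSizes.agree_of_relation (hQ : GoodSizes Q) {p q z : Label K} (hpq : p ≠ q)
    (hpz : p ≠ z) (hqz : q ≠ z) {a b d : ℂ}
    (h : ∀ S, a * (ev Q p S).toComplex + b * (ev Q q S).toComplex + d * (ev Q z S).toComplex = 0)
    (hne : ¬ (a = 0 ∧ b = 0 ∧ d = 0)) : ∃ k, ∀ m, m ≠ k → p m = q m ∧ p m = z m := by
  simp only [toComplex_ev] at h
  obtain ⟨k, hk⟩ := mon_relation_three (fun h => hpq (hQ.eq_of_corner h))
    (fun h => hpz (hQ.eq_of_corner h)) (fun h => hqz (hQ.eq_of_corner h)) h hne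
  exact ⟨k, fun m hm => ⟨hQ.corner_inj (hk m hm).1, hQ.corner_inj (hk m hm).2⟩⟩

theorem GoodSizes.eq_zero_of_relation (hQ : GoodSizes Q) {p q : Label K} (hpq : p ≠ q) {a b : ℂ}
    (h : ∀ S, a * (ev Q p S).toComplex + b * (ev Q q S).toComplex = 0) : a = 0 ∧ b = 0 := by
  simp only [toComplex_ev] at h
  exact mon_relation_two (fun h => hpq (hQ.eq_of_corner h)) h

/-- A right angle between three points of the configuration only occurs inside a family. -/
theorem Generic.agree_of_right (h : Generic Q c) {p q z : Label K} (hqp : q ≠ p) (hzp : z ≠ p)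
    (hqz : q ≠ z)
    (hd : dot ((value Q c q).toComplex - (value Q c p).toComplex)
      ((value Q c z).toComplex - (value Q c p).toComplex) = 0) :
    ∃ k, ∀ m, m ≠ k → p m = q m ∧ p m = z m := by
  obtain ⟨a, ha⟩ := h.right p q z hqp hzp hd
  exact h.sizes.agree_of_relation hqp.symm hzp.symm hqz (a := a - 1) (b := -a) (d := 1)
    (fun S => by linear_combination ha S) (by simp)

theorem isRightRatio_of_rightAt {τ : Fin 3} {n a b κ : ℂ} (hab : a ≠ b)
    (hn : n = (1 - κ) * a + κ * b) (h : RightAt τ n a b) : IsRightRatio κ := by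
  have hne : Complex.normSq (b - a) ≠ 0 := by
    rw [Ne, Complex.normSq_eq_zero]
    exact sub_ne_zero.2 hab.symm
  have key : ∀ u v : ℂ, dot ((b - a) * u) ((b - a) * v) = 0 → u.re * v.re + u.im * v.im = 0 :=
    fun u v h => by
      rw [dot_mul_left, mul_eq_zero] at h
      exact h.resolve_left hne
  fin_cases τ
  · have := key (-κ) (1 - κ) (by
      rw [show (b - a) * -κ = a - n by rw [hn]; ring,
        show (b - a) * (1 - κ) = b - n by rw [hn]; ring]
      exact h)
    simp at this
    right; right; linarith
  · have := key κ 1 (by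
      rw [show (b - a) * κ = n - a by rw [hn]; ring, mul_one]
      exact h)
    simp at this
    left; exact this
  · have := key (κ - 1) (-1) (by
      rw [show (b - a) * (κ - 1) = n - b by rw [hn]; ring,
        show (b - a) * -1 = a - b by ring]
      exact h)
    simp at this
    right; left; linarith

end generic

/-! ### Right triangles with a common vertex outside the configuration -/

/-- The pairs `p, q` and `z, y` differ at the places `l` and `k` respectively, and complete each
other to the value `n` of a further label. -/
def VirtualAt {K : ℕ} (Q : Fin K → ℤ) (c : Finset (Fin K) → GaussianInt) (n : GaussianInt)
    (p q z y : Label K) (k l : Fin K) : Prop :=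
  k ≠ l ∧ p l ≠ q l ∧ (∀ m, m ≠ l → p m = q m) ∧ z k ≠ y k ∧ (∀ m, m ≠ k → z m = y m) ∧
    (∀ m, m ≠ k → m ≠ l → p m = z m) ∧ n = value Q c (Function.update p l (z l))

/-- Four labels in a family. -/
def InFamily {K : ℕ} (p q z y : Label K) (k : Fin K) : Prop :=
  FamAt k p ∧ ∀ m, m ≠ k → p m = q m ∧ p m = z m ∧ p m = y m

theorem rightAt_swap {τ : Fin 3} {n a b : ℂ} (h : RightAt τ n a b) :
    ∃ τ', RightAt τ' n b a := by
  fin_cases τ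
  · exact ⟨0, (dot_comm _ _).trans h⟩
  · exact ⟨2, h⟩
  · exact ⟨1, h⟩

section generic

variable {K : ℕ} {Q : Fin K → ℤ} {c : Finset (Fin K) → GaussianInt}

/-- If three of the four evaluations are independent, the two right triangles come from an affine
relation, and such relations are classified; otherwise all four labels lie in one family. -/
theorem Generic.incidences_aux (h : Generic Q c) {n : GaussianInt}
    (hn : ∀ p, AnyAdm p → n ≠ value Q c p) {p q z y : Label K} (hp : AnyAdm p) (hq : AnyAdm q)
    (hz : AnyAdm z) (hy : AnyAdm y) (hpq : p ≠ q) (hzy : z ≠ y) (hzp : z ≠ p) (hzq : z ≠ q)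
    {τ₁ τ₂ : Fin 3}
    (h1 : RightAt τ₁ n.toComplex (value Q c p).toComplex (value Q c q).toComplex)
    (h2 : RightAt τ₂ n.toComplex (value Q c z).toComplex (value Q c y).toComplex) :
    (∃ k, InFamily p q z y k) ∨ ∃ k l, VirtualAt Q c n p q z y k l := by
  have hnc : ∀ {p}, AnyAdm p → (value Q c p).toComplex - n.toComplex ≠ 0 := fun hp he =>
    hn _ hp (GaussianInt.toComplex_injective (sub_eq_zero.1 he)).symm
  have hvne : ∀ {p q : Label K}, p ≠ q → (value Q c p).toComplex ≠ (value Q c q).toComplex :=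
    fun hpq he => hpq (h.inj (GaussianInt.toComplex_injective he))
  by_cases hli : LinearIndependent ℂ ![fun S => (ev Q p S).toComplex,
      fun S => (ev Q q S).toComplex, fun S => (ev Q z S).toComplex]
  · obtain ⟨β, γ, δ, hrel, hβ⟩ := h.triangles p q z y τ₁ τ₂ n hpq hzy hli h1 h2 (hn y hy)
    have hsum : 1 = β + γ + δ := by simpa [ev] using hrel ∅
    have hβ0 : β ≠ 0 := by
      rintro rfl
      rw [zero_mul] at hβ
      exact hnc hy hβ
    have hβ1 : β ≠ 1 := by
      rintro rfl
      exact hvne hzy (by linear_combination -hβ)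
    have hβ1' : 1 - β ≠ 0 := sub_ne_zero.2 hβ1.symm
    have hG : (value Q c y).toComplex = β * (value Q c z).toComplex +
        γ * (value Q c p).toComplex + δ * (value Q c q).toComplex := by
      simp only [toComplex_value, Finset.mul_sum, ← Finset.sum_add_distrib]
      refine Finset.sum_congr rfl fun S _ => ?_
      rw [hrel S]; ring
    obtain ⟨κ, hκ⟩ : ∃ κ, κ * (1 - β) = δ := ⟨δ / (1 - β), by field_simp⟩
    obtain ⟨μ, hμ⟩ : ∃ μ, μ * (1 - β) = 1 := ⟨1 / (1 - β), by field_simp⟩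
    have hγ : γ = (1 - κ) * (1 - β) := by linear_combination -hsum + hκ
    have hβμ : β = -((1 - μ) * (1 - β)) := by linear_combination -hμ
    have nμ : n.toComplex = (1 - μ) * (value Q c z).toComplex + μ * (value Q c y).toComplex := by
      refine mul_left_cancel₀ hβ1' ?_
      linear_combination -hβ + (-(value Q c y).toComplex + (value Q c z).toComplex) * hμ
    have nκ : n.toComplex = (1 - κ) * (value Q c p).toComplex + κ * (value Q c q).toComplex := by
      refine mul_left_cancel₀ hβ1' ?_
      linear_combination -hβ + hG - (value Q c q).toComplex * hκ + (value Q c p).toComplex * hγ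
    have hκ0 : κ ≠ 0 := by
      rintro rfl
      exact hnc hp (by rw [nκ]; ring)
    have hκ1 : κ ≠ 1 := by
      rintro rfl
      exact hnc hq (by rw [nκ]; ring)
    have hμ0 : μ ≠ 0 := by
      rintro rfl
      exact hnc hz (by rw [nμ]; ring)
    have hμ1 : μ ≠ 1 := by
      rintro rfl
      exact hnc hy (by rw [nμ]; ring)
    have hrel' : ∀ S, (1 - κ) * (ev Q p S).toComplex + κ * (ev Q q S).toComplex =
        (1 - μ) * (ev Q z S).toComplex + μ * (ev Q y S).toComplex := fun S => by
      refine mul_left_cancel₀ hβ1' ?_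
      linear_combination (ev Q q S).toComplex * hκ - (ev Q p S).toComplex * hγ - hrel S -
        ((ev Q y S).toComplex - (ev Q z S).toComplex) * hμ
    rcases h.sizes.affine_relation_cases hpq hzy (isRightRatio_of_rightAt (hvne hpq) nκ h1) hκ0 hκ1
      (isRightRatio_of_rightAt (hvne hzy) nμ h2) hμ0 hμ1 hrel' with
      (⟨rfl, -⟩ | ⟨-, rfl⟩) | ⟨k, hk⟩ | ⟨k, l, hkl, a1, a2, a3, a4, a5, a6⟩
    · exact absurd rfl hzp
    · exact absurd rfl hzq
    · exact Or.inl ⟨k, famAt_of_three hp hq hz hpq hzp.symm hzq.symm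
        fun m hm => ⟨(hk m hm).1, (hk m hm).2.1⟩, hk⟩
    · refine Or.inr ⟨k, l, hkl, a1, a2, a3, a4, a5, GaussianInt.toComplex_injective ?_⟩
      rw [nκ]
      simp only [toComplex_value, Finset.mul_sum, ← Finset.sum_add_distrib]
      refine Finset.sum_congr rfl fun S _ => ?_
      rw [← a6 S]; ring
  · have hli' := hli
    rw [linearIndependent_three_iff] at hli
    push Not at hli
    obtain ⟨a, b, d, hrel, hne⟩ := hli
    obtain ⟨k, hk⟩ := h.sizes.agree_of_relation hpq hzp.symm hzq.symm hrel
      (fun h => hne h.1 h.2.1 h.2.2)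
    have hd : d ≠ 0 := by
      rintro rfl
      have := h.sizes.eq_zero_of_relation hpq (a := a) (b := b)
        fun S => by linear_combination hrel S
      exact hne this.1 this.2 rfl
    have hfam := famAt_of_three hp hq hz hpq hzp.symm hzq.symm hk
    left
    suffices hy' : ∀ m, m ≠ k → p m = y m from
      ⟨k, hfam, fun m hm => ⟨(hk m hm).1, (hk m hm).2, hy' m hm⟩⟩
    by_cases hyp : y = p
    · intro m _; rw [hyp]
    by_cases hyq : y = q
    · intro m hm; rw [hyq]; exact (hk m hm).1
    by_cases hli2 : LinearIndependent ℂ ![fun S => (ev Q p S).toComplex,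
      fun S => (ev Q q S).toComplex, fun S => (ev Q y S).toComplex]
    · exfalso
      obtain ⟨τ', h2'⟩ := rightAt_swap h2
      obtain ⟨β, γ, δ, hr, hβ⟩ := h.triangles p q y z τ₁ τ' n hpq hzy.symm hli2 h1 h2' (hn z hz)
      have hβ0 : β ≠ 0 := by
        rintro rfl
        rw [zero_mul] at hβ
        exact hnc hz hβ
      have := (linearIndependent_three_iff.1 hli2 (a + d * γ) (b + d * δ) (d * β) fun S => by
        linear_combination hrel S - d * hr S).2.2
      exact mul_ne_zero hd hβ0 this
    · rw [linearIndependent_three_iff] at hli2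
      push Not at hli2
      obtain ⟨a, b, d, hrel, hne⟩ := hli2
      obtain ⟨k', hk'⟩ := h.sizes.agree_of_relation hpq (Ne.symm hyp) (Ne.symm hyq) hrel
        (fun h => hne h.1 h.2.1 h.2.2)
      obtain ⟨m, hm⟩ := Function.ne_iff.1 hpq
      have e1 : m = k := by
        by_contra h; exact hm (hk m h).1
      have e2 : m = k' := by
        by_contra h; exact hm (hk' m h).1
      intro m' hm'
      exact (hk' m' (by rw [← e2, e1]; exact hm')).2

/-- Two right triangles with a common vertex outside the configuration, on different pairs of
points of the configuration. -/
theorem Generic.incidences (h : Generic Q c) {n : GaussianInt}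
    (hn : ∀ p, AnyAdm p → n ≠ value Q c p) {p q z y : Label K} (hp : AnyAdm p) (hq : AnyAdm q)
    (hz : AnyAdm z) (hy : AnyAdm y) (hpq : p ≠ q) (hzy : z ≠ y) (hne : ¬ SamePair p q z y)
    {τ₁ τ₂ : Fin 3}
    (h1 : RightAt τ₁ n.toComplex (value Q c p).toComplex (value Q c q).toComplex)
    (h2 : RightAt τ₂ n.toComplex (value Q c z).toComplex (value Q c y).toComplex) :
    (∃ k, InFamily p q z y k) ∨ ∃ k l, VirtualAt Q c n p q z y k l := by
  by_cases hz' : z ≠ p ∧ z ≠ q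
  · exact h.incidences_aux hn hp hq hz hy hpq hzy hz'.1 hz'.2 h1 h2
  have hy' : y ≠ p ∧ y ≠ q := by
    constructor
    · rintro rfl
      refine hne (Or.inr ⟨rfl, ?_⟩)
      by_contra hq
      exact hz' ⟨hzy, Ne.symm hq⟩
    · rintro rfl
      refine hne (Or.inl ⟨?_, rfl⟩)
      by_contra hp
      exact hz' ⟨Ne.symm hp, hzy⟩
  obtain ⟨τ', h2'⟩ := rightAt_swap h2
  rcases h.incidences_aux hn hp hq hy hz hpq hzy.symm hy'.1 hy'.2 h1 h2' with
    ⟨k, hk, hk'⟩ | ⟨k, l, hkl, a1, a2, a3, a4, a5, a6⟩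
  · exact Or.inl ⟨k, hk, fun m hm => ⟨(hk' m hm).1, (hk' m hm).2.2, (hk' m hm).2.1⟩⟩
  · refine Or.inr ⟨k, l, hkl, a1, a2, Ne.symm a3, fun m hm => (a4 m hm).symm, fun m hk hl => ?_, ?_⟩
    · rw [a5 m hk hl, a4 m hk]
    · rw [a6, a4 l hkl.symm]

/-- If the vertex of the two right triangles is not in the configuration, neither pair lies in a
family: otherwise the label completing the pairs would be admissible. -/
theorem VirtualAt.not_famAt {n : GaussianInt} (hn : ∀ p, AnyAdm p → n ≠ value Q c p)
    {p q z y : Label K} {k l : Fin K} (h : VirtualAt Q c n p q z y k l) :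
    ¬ FamAt l p ∧ ¬ FamAt k z := by
  obtain ⟨hkl, -, -, -, -, a5, a6⟩ := h
  constructor
  · intro hf
    exact hn _ (hf.congr fun m hm => by simp [hm]).anyAdm a6
  · intro hf
    refine hn _ (hf.congr fun m hm => ?_).anyAdm a6
    by_cases hml : m = l
    · subst hml; simp
    · simp [hml, a5 m hm hml]

theorem VirtualAt.not_inFamily_left {n : GaussianInt} (hn : ∀ p, AnyAdm p → n ≠ value Q c p)
    {p q z y z' y' : Label K} {k l k' : Fin K} (h : VirtualAt Q c n p q z y k l)
    (h' : InFamily p q z' y' k') : False := by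
  have : k' = l := by
    by_contra hne
    exact h.2.1 (h'.2 l (Ne.symm hne)).1
  subst this
  exact (h.not_famAt hn).1 h'.1

theorem VirtualAt.not_inFamily_right {n : GaussianInt} (hn : ∀ p, AnyAdm p → n ≠ value Q c p)
    {p q z y z' y' : Label K} {k l k' : Fin K} (h : VirtualAt Q c n p q z y k l)
    (h' : InFamily z y z' y' k') : False := by
  have : k' = k := by
    by_contra hne
    exact h.2.2.2.1 (h'.2 k (Ne.symm hne)).1
  subst this
  exact (h.not_famAt hn).2 h'.1

/-- A pair of admissible labels differing at `l`, whose completion `v` is not admissible, is on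
one side of the threshold at `l`, and `v` is on the other one. -/
theorem threshold_of_not_famAt {p q v : Label K} {l : Fin K} (hp : AnyAdm p) (hq : AnyAdm q)
    (hpq : ∀ m, m ≠ l → p m = q m) (hpl : p l ≠ q l) (hvp : v l ≠ p l) (hvq : v l ≠ q l)
    (hf : ¬ FamAt l p) : ((v l).1 = (v l).2 ↔ ¬ (p l).1 = (p l).2) := by
  have key : ∀ a b d : Bool × Bool, a ≠ b → d ≠ a → d ≠ b → (a.1 = a.2 ↔ b.1 = b.2) →
      (d.1 = d.2 ↔ ¬ a.1 = a.2) := by decide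
  refine key _ _ _ hpl hvp hvq ?_
  by_contra hcon
  by_cases h1 : (p l).1 = (p l).2
  · have h2 : ¬ (q l).1 = (q l).2 := fun h => hcon ⟨fun _ => h, fun _ => h1⟩
    exact hf (famAt_of_ne hp hq hpq h1 h2)
  · have h2 : (q l).1 = (q l).2 := by tauto
    exact hf ((famAt_of_ne hq hp (fun m hm => (hpq m hm).symm) h2 h1).congr
      fun m hm => (hpq m hm).symm)

/-- A point outside the configuration is a vertex of at most two right triangles whose other
vertices are in the configuration, on different pairs. -/
theorem Generic.false_of_three (h : Generic Q c) {n : GaussianInt}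
    (hn : ∀ p, AnyAdm p → n ≠ value Q c p) {p q z y s t : Label K} (hp : AnyAdm p) (hq : AnyAdm q)
    (hz : AnyAdm z) (hy : AnyAdm y) (hs : AnyAdm s) (ht : AnyAdm t)
    (hpq : p ≠ q) (hzy : z ≠ y) (hst : s ≠ t) (h12 : ¬ SamePair p q z y)
    (h13 : ¬ SamePair p q s t) (h23 : ¬ SamePair z y s t) {τ₁ τ₂ τ₃ : Fin 3}
    (r1 : RightAt τ₁ n.toComplex (value Q c p).toComplex (value Q c q).toComplex)
    (r2 : RightAt τ₂ n.toComplex (value Q c z).toComplex (value Q c y).toComplex)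
    (r3 : RightAt τ₃ n.toComplex (value Q c s).toComplex (value Q c t).toComplex) : False := by
  rcases h.incidences hn hp hq hz hy hpq hzy h12 r1 r2 with ⟨k, f12⟩ | ⟨k, l, v12⟩
  · rcases h.incidences hn hp hq hs ht hpq hst h13 r1 r3 with ⟨k', f13⟩ | ⟨k', l', v13⟩
    · obtain ⟨m, hm⟩ := Function.ne_iff.1 hpq
      have e1 : m = k := by
        by_contra hne; exact hm (f12.2 m hne).1
      have e2 : m = k' := by
        by_contra hne; exact hm (f13.2 m hne).1
      obtain rfl : k = k' := e1.symm.trans e2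
      clear e1 e2 hm
      have same : ∀ {a b a' b' : Label K}, (∀ m, m ≠ k → a m = p m) → (∀ m, m ≠ k → b m = p m) →
          (∀ m, m ≠ k → a' m = p m) → (∀ m, m ≠ k → b' m = p m) → a ≠ b → a' ≠ b' →
          pairIndex (a k) (b k) = pairIndex (a' k) (b' k) → SamePair a b a' b' := by
        intro a b a' b' ha hb ha' hb' hab hab' hi
        have ext : ∀ {u w : Label K}, (∀ m, m ≠ k → u m = p m) → (∀ m, m ≠ k → w m = p m) →
            u k = w k → u = w := fun hu hw e => funext fun m => by
          by_cases hm : m = k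
          · rw [hm, e]
          · rw [hu m hm, hw m hm]
        rcases eq_or_eq_of_pairIndex (fun e => hab (ext ha hb e)) (fun e => hab' (ext ha' hb' e)) hi
          with ⟨e1, e2⟩ | ⟨e1, e2⟩
        · exact Or.inl ⟨ext ha ha' e1, ext hb hb' e2⟩
        · exact Or.inr ⟨ext ha hb' e1, ext hb ha' e2⟩
      have ext : ∀ {u w : Label K}, (∀ m, m ≠ k → u m = p m) → (∀ m, m ≠ k → w m = p m) →
            u ≠ w → u k ≠ w k := fun hu hw e e' => e (funext fun m => by
          by_cases hm : m = k
          · rw [hm, e']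
          · rw [hu m hm, hw m hm])
      have gp : ∀ m, m ≠ k → p m = p m := fun _ _ => rfl
      have gq : ∀ m, m ≠ k → q m = p m := fun m hm => (f12.2 m hm).1.symm
      have gz : ∀ m, m ≠ k → z m = p m := fun m hm => (f12.2 m hm).2.1.symm
      have gy : ∀ m, m ≠ k → y m = p m := fun m hm => (f12.2 m hm).2.2.symm
      have gs : ∀ m, m ≠ k → s m = p m := fun m hm => (f13.2 m hm).2.1.symm
      have gt : ∀ m, m ≠ k → t m = p m := fun m hm => (f13.2 m hm).2.2.symm
      obtain ⟨m, e, f, he, hval⟩ := h.value_family p k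
      rw [hval p gp, hval q gq] at r1
      rw [hval z gz, hval y gy] at r2
      rw [hval s gs, hval t gt] at r3
      refine false_of_three_rightAt (h.sizes.mod k) (h.sizes.five_le k) he (fun v hv => ?_)
        (ext gp gq hpq) (ext gz gy hzy) (ext gs gt hst)
        (fun hi => h12 (same gp gq gz gy hpq hzy hi)) (fun hi => h13 (same gp gq gs gt hpq hst hi))
        (fun hi => h23 (same gz gy gs gt hzy hst hi)) r1 r2 r3
      have gu : ∀ m, m ≠ k → Function.update p k v m = p m := fun m hm => by simp [hm]
      refine hn (Function.update p k v) (f12.1.congr fun m hm => (gu m hm).symm).anyAdm ?_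
      rw [hv, hval _ gu, Function.update_self]
    · exact v13.not_inFamily_left hn f12
  · rcases h.incidences hn hp hq hs ht hpq hst h13 r1 r3 with ⟨k', f13⟩ | ⟨k', l', v13⟩
    · exact v12.not_inFamily_left hn f13
    rcases h.incidences hn hz hy hs ht hzy hst h23 r2 r3 with ⟨k'', f23⟩ | ⟨k'', l'', v23⟩
    · exact v12.not_inFamily_right hn f23
    -- three completions at the same inadmissible label are impossible: each of the three pairs
    -- would separate its threshold from the two others
    have hl : l' = l := by
      by_contra hne
      exact v12.2.1 (v13.2.2.1 l (Ne.symm hne))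
    subst hl
    have hk'' : k'' = k' := by
      by_contra hne
      exact v13.2.2.2.1 (v23.2.2.2.2.1 k' (Ne.symm hne))
    subst hk''
    have hl'' : l'' = k := by
      by_contra hne
      exact v12.2.2.2.1 (v23.2.2.1 k (Ne.symm hne))
    subst hl''
    obtain ⟨n1l, n1z⟩ := v12.not_famAt hn
    obtain ⟨-, n3s⟩ := v13.not_famAt hn
    obtain ⟨hkl, a1, a2, a3, a4, a5, a6⟩ := v12
    obtain ⟨hkl', b1, b2, b3, b4, b5, b6⟩ := v13
    obtain ⟨hkk, d1, d2, d3, d4, d5, d6⟩ := v23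
    set v := Function.update p l' (z l') with hv
    have hvs : v = Function.update p l' (s l') := h.inj (a6.symm.trans b6)
    have hvl : v l' = z l' := by simp [hv]
    have hvl' : v l' = s l' := by simp [hvs]
    have hvm : ∀ m, m ≠ l' → v m = p m := fun m hm => by simp [hv, hm]
    have hnv : ¬ AnyAdm v := fun hA => hn v hA a6
    have ext : ∀ {w : Label K} {j}, AnyAdm w → (∀ m, m ≠ j → v m = w m) → v j ≠ w j :=
      fun {w j} hw hj e => hnv (by
        have : v = w := funext fun m => by
          by_cases hm : m = j
          · rw [hm, e]
          · exact hj m hm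
        rw [this]; exact hw)
    have hvz : ∀ m, m ≠ l'' → v m = z m := fun m hm => by
      by_cases hml : m = l'
      · rw [hml, hvl]
      · rw [hvm m hml, a5 m hm hml]
    have hvss : ∀ m, m ≠ k'' → v m = s m := fun m hm => by
      by_cases hml : m = l'
      · rw [hml, hvl']
      · rw [hvm m hml, b5 m hm hml]
    have t1 := threshold_of_not_famAt hp hq a2 a1 (ext hp hvm)
      (ext hq fun m hm => (hvm m hm).trans (a2 m hm)) n1l
    have t2 := threshold_of_not_famAt hz hy a4 a3 (ext hz hvz)
      (ext hy fun m hm => (hvz m hm).trans (a4 m hm)) n1z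
    have t3 := threshold_of_not_famAt hs ht b4 b3 (ext hs hvss)
      (ext ht fun m hm => (hvss m hm).trans (b4 m hm)) n3s
    obtain ⟨i₁, -, hi₁⟩ := hp
    obtain ⟨i₂, -, hi₂⟩ := hz
    obtain ⟨i₃, -, hi₃⟩ := hs
    rw [hi₁] at t1
    rw [hi₂] at t2
    rw [hi₃] at t3
    have u1 := hi₂ l'
    have u2 := hi₃ l'
    have u3 := hi₁ l''
    have u4 := hi₃ l''
    have u5 := hi₁ k''
    have u6 := hi₂ k''
    rw [← hvz l' hkl.symm] at u1
    rw [← hvss l' hkl'.symm] at u2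
    rw [← hvm l'' hkl] at u3
    rw [← hvss l'' hkk.symm] at u4
    rw [← hvm k'' hkl'] at u5
    rw [← hvz k'' hkk] at u6
    rw [t1] at u1 u2
    rw [t2] at u3 u4
    rw [t3] at u5 u6
    omega

end generic

/-! ### Rectangles of lattice points -/

/-- The Gaussian integer of coordinates given by a frequency. -/
def ofMode (n : Mode) : GaussianInt := ⟨n 0, n 1⟩

/-- The frequency whose coordinates are the real and imaginary parts. -/
def toMode (z : GaussianInt) : Mode := ![z.re, z.im]

@[simp] theorem ofMode_toMode (z : GaussianInt) : ofMode (toMode z) = z := rfl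

@[simp] theorem toMode_ofMode (n : Mode) : toMode (ofMode n) = n := by
  funext i; fin_cases i <;> rfl

theorem ofMode_injective : Function.Injective ofMode := fun a b h => by
  rw [← toMode_ofMode a, h, toMode_ofMode]

theorem toMode_injective : Function.Injective toMode := fun a b h => by
  rw [← ofMode_toMode a, h, ofMode_toMode]

theorem modeNorm_eq (n : Mode) : modeNorm n = ‖(ofMode n).toComplex‖ := by
  rw [modeNorm, Complex.norm_def, Complex.normSq_apply, ← GaussianInt.intCast_re,
    ← GaussianInt.intCast_im]
  congr 1
  simp only [ofMode]
  ring

/-- Consecutive vertices of a nondegenerate rectangle. -/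
def IsRect (a b c d : GaussianInt) : Prop :=
  a - b + c = d ∧ a ≠ d ∧ c ≠ d ∧ dot (a.toComplex - b.toComplex) (c.toComplex - b.toComplex) = 0

theorem modeNorm_sq (n : Mode) :
    modeNorm n ^ 2 = dot (ofMode n).toComplex (ofMode n).toComplex := by
  rw [modeNorm_eq, ← Complex.normSq_eq_norm_sq, Complex.normSq_apply, dot]

theorem modeNorm_sq_parallelogram {a b c d : Mode} (h : a - b + c = d) :
    modeNorm a ^ 2 - modeNorm b ^ 2 + modeNorm c ^ 2 - modeNorm d ^ 2 =
      -2 * dot ((ofMode a).toComplex - (ofMode b).toComplex)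
        ((ofMode c).toComplex - (ofMode b).toComplex) := by
  subst h
  have : (ofMode (a - b + c)).toComplex =
      (ofMode a).toComplex - (ofMode b).toComplex + (ofMode c).toComplex := by
    rw [← map_sub, ← map_add]; rfl
  simp only [modeNorm_sq, this]
  simp only [dot, Complex.add_re, Complex.add_im, Complex.sub_re, Complex.sub_im]
  ring

theorem mem_tuples₁_iff {κ₀ : ℝ} {t : Fin 4 → Mode} :
    t ∈ tuples₁ κ₀ ↔ IsRect (ofMode (t 0)) (ofMode (t 1)) (ofMode (t 2)) (ofMode (t 3)) ∧
      ∀ i, t i ∉ lowModes κ₀ := by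
  have e : ofMode (t 0) - ofMode (t 1) + ofMode (t 2) = ofMode (t 3) ↔ t 0 - t 1 + t 2 = t 3 :=
    ⟨fun h => ofMode_injective h, fun h => by rw [← h]; rfl⟩
  simp only [tuples₁, resonant₁, Set.mem_ofPred_eq, IsRect, Fin.forall_fin_succ, e,
    ofMode_injective.ne_iff]
  constructor
  · rintro ⟨h3, h, a, b, h0, h1, h2, hn⟩
    rw [modeNorm_sq_parallelogram h] at hn
    exact ⟨⟨h, a, b, by linarith⟩, h0, h1, h2, h3, fun i => i.elim0⟩
  · rintro ⟨⟨h, a, b, hn⟩, h0, h1, h2, h3, -⟩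
    exact ⟨h3, h, a, b, h0, h1, h2, by rw [modeNorm_sq_parallelogram h, hn]; simp⟩

theorem eq_of_dot_sub_self {a b : GaussianInt}
    (h : dot (a.toComplex - b.toComplex) (a.toComplex - b.toComplex) = 0) : a = b := by
  rw [dot, ← Complex.normSq_apply, Complex.normSq_eq_zero] at h
  exact GaussianInt.toComplex_injective (sub_eq_zero.1 h)

theorem IsRect.ne {a b c d : GaussianInt} (h : IsRect a b c d) : a ≠ b ∧ c ≠ b ∧ a ≠ c ∧ b ≠ d := by
  obtain ⟨h1, h2, h3, h4⟩ := h
  have hab : a ≠ b := by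
    rintro rfl
    exact h3 (by rw [← h1]; ring)
  have hac : a ≠ c := by
    rintro rfl
    exact hab (eq_of_dot_sub_self h4)
  refine ⟨hab, ?_, hac, ?_⟩
  · rintro rfl
    exact h2 (by rw [← h1]; ring)
  · rintro rfl
    have e : c.toComplex - b.toComplex = -(a.toComplex - b.toComplex) := by
      have := congrArg GaussianInt.toComplex h1
      simp only [map_sub, map_add] at this
      linear_combination this
    rw [e] at h4
    refine hab (eq_of_dot_sub_self ?_)
    simp only [dot, Complex.neg_re, Complex.neg_im] at h4 ⊢
    linarith

theorem IsRect.rotate {a b c d : GaussianInt} (h : IsRect a b c d) : IsRect b c d a := by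
  have hne := h.ne
  obtain ⟨h1, h2, h3, h4⟩ := h
  refine ⟨by rw [← h1]; ring, hne.1.symm, h2.symm, ?_⟩
  have e : d.toComplex - c.toComplex = a.toComplex - b.toComplex := by
    rw [← h1, map_add, map_sub]; ring
  rw [e]
  simp only [dot, Complex.sub_re, Complex.sub_im] at h4 ⊢
  linarith

/-! ### The opposite vertex -/

/-- The opposite vertex of a rectangle. -/
def opp (v : Bool × Bool) : Bool × Bool := (!v.1, !v.2)

theorem vtx_opp (Q : ℤ) (v : Bool × Bool) : vtx Q (opp v) = -vtx Q v := by
  rcases v with ⟨_ | _, _ | _⟩ <;> simp [vtx, opp, bsign, Zsqrtd.ext_iff]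

@[simp] theorem opp_opp (v : Bool × Bool) : opp (opp v) = v := by simp [opp]

theorem opp_ne (v : Bool × Bool) : opp v ≠ v := by revert v; decide

@[simp] theorem opp_fst_eq_snd (v : Bool × Bool) : (opp v).1 = (opp v).2 ↔ v.1 = v.2 := by
  revert v; decide

theorem eq_or_eq_opp {v w : Bool × Bool} (h : v.1 = v.2 ↔ w.1 = w.2) : w = v ∨ w = opp v := by
  revert v w; decide

theorem eq_opp_of_dot_eq_zero {Q : ℤ} (hQ : 5 ≤ Q) {a b d : Bool × Bool} (hab : a ≠ b)
    (hdb : d ≠ b)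
    (h : dot ((vtx Q a).toComplex - (vtx Q b).toComplex)
      ((vtx Q d).toComplex - (vtx Q b).toComplex) = 0) :
    d = opp a ∧ ¬ (a.1 = a.2 ↔ b.1 = b.2) := by
  have hQ' : (5 : ℝ) ≤ Q := by exact_mod_cast hQ
  rcases a with ⟨_ | _, _ | _⟩ <;> rcases b with ⟨_ | _, _ | _⟩ <;>
    rcases d with ⟨_ | _, _ | _⟩ <;>
    first
    | exact absurd rfl hab
    | exact absurd rfl hdb
    | (constructor <;> decide)
    | (exfalso
       simp only [dot, Complex.sub_re, Complex.sub_im, toComplex_vtx_re, toComplex_vtx_im, bsign,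
        Bool.false_eq_true, if_true, if_false, Int.cast_one, Int.cast_neg, one_mul, neg_mul] at h
       nlinarith)

section generic

variable {K : ℕ} {Q : Fin K → ℤ} {c : Finset (Fin K) → GaussianInt}

/-- Three vertices in the configuration of a rectangle belong to a family, which contains the
fourth vertex. -/
theorem Generic.family_of_isRect (h : Generic Q c) {p q z : Label K} {d : GaussianInt}
    (hp : AnyAdm p) (hq : AnyAdm q) (hz : AnyAdm z)
    (hr : IsRect (value Q c p) (value Q c q) (value Q c z) d) :
    ∃ k, FamAt k p ∧ ¬ ((p k).1 = (p k).2 ↔ (q k).1 = (q k).2) ∧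
      q = Function.update p k (q k) ∧ z = Function.update p k (opp (p k)) ∧
      d = value Q c (Function.update p k (opp (q k))) := by
  obtain ⟨n1, n2, n3, -⟩ := hr.ne
  have hpq : p ≠ q := fun e => n1 (by rw [e])
  have hzq : z ≠ q := fun e => n2 (by rw [e])
  have hpz : p ≠ z := fun e => n3 (by rw [e])
  obtain ⟨k, hk⟩ := h.agree_of_right hpq hzq hpz hr.2.2.2
  have gq : ∀ m, m ≠ k → q m = p m := fun m hm => (hk m hm).1
  have gz : ∀ m, m ≠ k → z m = p m := fun m hm => (hk m hm).2.symm.trans (hk m hm).1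
  have hfam := famAt_of_three hp hq hz hpq hpz hzq.symm fun m hm =>
    ⟨(hk m hm).1.symm, (gz m hm).symm⟩
  have upd : ∀ {u : Label K}, (∀ m, m ≠ k → u m = p m) → u = Function.update p k (u k) :=
    fun {u} hu => funext fun m => by
      by_cases hm : m = k
      · subst hm; simp
      · simp [hm, hu m hm]
  have ne : ∀ {u w : Label K}, (∀ m, m ≠ k → u m = p m) → (∀ m, m ≠ k → w m = p m) →
      u ≠ w → u k ≠ w k := fun hu hw hne e => hne (by rw [upd hu, upd hw, e])
  obtain ⟨m, e, f, he, hval⟩ := h.value_family p k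
  have he0 : e.toComplex ≠ 0 := by
    rw [Ne, GaussianInt.toComplex_eq_zero]
    rintro rfl
    have := congrArg Zsqrtd.re he
    simp at this
    omega
  have h4 := hr.2.2.2
  have key := eq_opp_of_dot_eq_zero (h.sizes.five_le k) (ne (fun _ _ => rfl) gq hpq)
    (ne gz gq hzq) (by
      have := (rightAt_affine (m := m.toComplex) (n := (vtx (Q k) (q k)).toComplex)
        (a := (vtx (Q k) (p k)).toComplex) (b := (vtx (Q k) (z k)).toComplex) he0 0).1 (by
          show dot _ _ = 0
          rw [hval p fun _ _ => rfl, hval q gq, hval z gz] at h4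
          simpa only [map_add, map_mul] using h4)
      exact this)
  refine ⟨k, hfam, key.2, upd gq, ?_, ?_⟩
  · rw [← key.1]; exact upd gz
  · rw [← hr.1, hval p fun _ _ => rfl, hval q gq, hval z gz, hval _ fun m hm => by simp [hm], key.1,
      Function.update_self, vtx_opp, vtx_opp]
    ring

theorem Generic.isRect_family (h : Generic Q c) {p : Label K} {k : Fin K} {u : Bool × Bool}
    (hu : ¬ ((p k).1 = (p k).2 ↔ u.1 = u.2)) :
    IsRect (value Q c p) (value Q c (Function.update p k u))
      (value Q c (Function.update p k (opp (p k)))) (value Q c (Function.update p k (opp u))) := by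
  obtain ⟨m, e, f, he, hval⟩ := h.value_family p k
  have hv : ∀ v, value Q c (Function.update p k v) = m + e * vtx (Q k) v := fun v => by
    rw [hval _ fun m hm => by simp [hm], Function.update_self]
  have hp := hval p fun _ _ => rfl
  have inj : ∀ {v w : Bool × Bool}, v ≠ w →
      value Q c (Function.update p k v) ≠ value Q c (Function.update p k w) :=
    fun hvw hh => hvw (by simpa using congrFun (h.inj hh) k)
  have hp' : value Q c p = value Q c (Function.update p k (p k)) := by simp
  refine ⟨?_, ?_, ?_, ?_⟩
  · rw [hp, hv, hv, hv, vtx_opp, vtx_opp]; ring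
  · rw [hp']
    refine inj fun e => hu ?_
    rw [e]; simp
  · refine inj fun e => hu ?_
    rw [← opp_fst_eq_snd (p k), e]; simp
  · rw [hp, hv, hv, vtx_opp]
    simp only [map_add, map_mul]
    rw [show m.toComplex + e.toComplex * (vtx (Q k) (p k)).toComplex -
        (m.toComplex + e.toComplex * (vtx (Q k) u).toComplex) = e.toComplex *
        ((vtx (Q k) (p k)).toComplex - (vtx (Q k) u).toComplex) by ring,
      show m.toComplex + e.toComplex * (-vtx (Q k) (p k)).toComplex -
        (m.toComplex + e.toComplex * (vtx (Q k) u).toComplex) = e.toComplex *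
        (-(vtx (Q k) (p k)).toComplex - (vtx (Q k) u).toComplex) by rw [map_neg]; ring, dot_mul_left]
    refine mul_eq_zero_of_right _ ?_
    generalize p k = v at hu ⊢
    simp only [dot, Complex.sub_re, Complex.sub_im, Complex.neg_re, Complex.neg_im,
      toComplex_vtx_re, toComplex_vtx_im]
    rcases v with ⟨_ | _, _ | _⟩ <;> rcases u with ⟨_ | _, _ | _⟩ <;> simp [bsign] at hu ⊢

end generic

/-! ### The generations and their families -/

section generations

variable {K : ℕ} {Q : Fin K → ℤ} {c : Finset (Fin K) → GaussianInt}

/-- The generation `j`, formed by the values at the labels admissible for the index `j - 1`. -/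
noncomputable def generation {K : ℕ} (Q : Fin K → ℤ) (c : Finset (Fin K) → GaussianInt) (j : ℕ) :
    Finset Mode :=
  open Classical in
  (Finset.univ.filter fun p : Label K => Adm (j - 1) p).image fun p => toMode (value Q c p)

theorem mem_generation {j : ℕ} {n : Mode} :
    n ∈ generation Q c j ↔ ∃ p, Adm (j - 1) p ∧ toMode (value Q c p) = n := by
  simp [generation]

theorem mem_unionGen_generation {n : Mode} :
    n ∈ unionGen (K + 1) (generation Q c) ↔ ∃ p, AnyAdm p ∧ toMode (value Q c p) = n := by
  simp only [unionGen, Finset.mem_biUnion, Finset.mem_Icc, mem_generation]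
  constructor
  · rintro ⟨j, hj, p, hp, rfl⟩
    exact ⟨p, ⟨j - 1, by omega, hp⟩, rfl⟩
  · rintro ⟨p, ⟨i, hi, hp⟩, rfl⟩
    exact ⟨i + 1, by omega, p, hp, rfl⟩

theorem Adm.unique {i j : ℕ} {p : Label K} (hi : i ≤ K) (hj : j ≤ K) (h : Adm i p)
    (h' : Adm j p) : i = j := by
  by_contra hne
  rcases lt_or_gt_of_ne hne with hlt | hlt
  · have h1 := h ⟨i, by omega⟩
    have h2 := h' ⟨i, by omega⟩
    simp only at h1 h2
    rw [h1] at h2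
    omega
  · have h1 := h ⟨j, by omega⟩
    have h2 := h' ⟨j, by omega⟩
    simp only at h1 h2
    rw [h1] at h2
    omega

theorem Generic.toMode_value_injective (h : Generic Q c) :
    Function.Injective fun p => toMode (value Q c p) := toMode_injective.comp h.inj

theorem Generic.disjoint_generation (h : Generic Q c) {i j : ℕ} (hi : i ∈ Finset.Icc 1 (K + 1))
    (hj : j ∈ Finset.Icc 1 (K + 1)) (hij : i ≠ j) :
    Disjoint (generation Q c i) (generation Q c j) := by
  rw [Finset.mem_Icc] at hi hj
  rw [Finset.disjoint_left]
  intro n hn hn'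
  obtain ⟨p, hp, rfl⟩ := mem_generation.1 hn
  obtain ⟨q, hq, hpq⟩ := mem_generation.1 hn'
  obtain rfl := h.toMode_value_injective hpq
  have := Adm.unique (by omega) (by omega) hp hq
  omega

theorem card_filter_adm (i : ℕ) :
    (open Classical in Finset.univ.filter fun p : Label K => Adm i p).card = 2 ^ K := by
  classical
  have : (Finset.univ.filter fun p : Label K => Adm i p) = Fintype.piFinset fun k : Fin K =>
      Finset.univ.filter fun v : Bool × Bool => (v.1 = v.2 ↔ k.val < i) := by
    ext p
    rw [Finset.mem_filter, Fintype.mem_piFinset]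
    simp [Adm]
  rw [this, Fintype.card_piFinset]
  have h2 : ∀ k : Fin K,
      (Finset.univ.filter fun v : Bool × Bool => (v.1 = v.2 ↔ k.val < i)).card = 2 := fun k => by
    by_cases hk : k.val < i <;> simp only [hk, iff_true, iff_false] <;> decide
  simp [h2]

theorem Generic.card_generation (h : Generic Q c) (j : ℕ) : (generation Q c j).card = 2 ^ K := by
  rw [generation, Finset.card_image_of_injective _ h.toMode_value_injective, card_filter_adm]

/-- The nuclear family obtained by varying the label `p` at `k`, where `p k` is one of the parents
and `u` one of the children. -/
noncomputable def famTuple (Q : Fin K → ℤ) (c : Finset (Fin K) → GaussianInt) (k : Fin K)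
    (p : Label K) (u : Bool × Bool) : Fin 4 → Mode :=
  ![toMode (value Q c p), toMode (value Q c (Function.update p k u)),
    toMode (value Q c (Function.update p k (opp (p k)))),
    toMode (value Q c (Function.update p k (opp u)))]

variable {κ₀ : ℝ}

theorem FamAt.update {k : Fin K} {p : Label K} (h : FamAt k p) (v : Bool × Bool) :
    FamAt k (Function.update p k v) := h.congr fun m hm => by simp [hm]

theorem Generic.isNuclearFamily_famTuple (h : Generic Q c)
    (high : ∀ p, toMode (value Q c p) ∉ lowModes κ₀) {k : Fin K} {p : Label K} {u : Bool × Bool}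
    (hp : FamAt k p) (hpk : (p k).1 ≠ (p k).2) (hu : u.1 = u.2) :
    IsNuclearFamily κ₀ (K + 1) (generation Q c) (famTuple Q c k p u) := by
  refine ⟨mem_tuples₁_iff.2 ⟨h.isRect_family (by tauto), fun i => ?_⟩, k.val + 1, by omega,
    by omega, mem_generation.2 ⟨p, ?_, rfl⟩,
    mem_generation.2 ⟨Function.update p k (opp (p k)), ?_, rfl⟩,
    mem_generation.2 ⟨Function.update p k u, ?_, rfl⟩,
    mem_generation.2 ⟨Function.update p k (opp u), ?_, rfl⟩⟩
  · fin_cases i <;> exact high _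
  · exact hp.adm hpk
  · exact (hp.update _).adm (by simpa using hpk)
  · exact (hp.update _).adm_succ (by simpa using hu)
  · exact (hp.update _).adm_succ (by simpa using hu)

/-- Every rectangle in the configuration is a family, up to a cyclic permutation. -/
theorem Generic.rect_eq_famTuple (h : Generic Q c) {t : Fin 4 → Mode} (ht : t ∈ tuples₁ κ₀)
    {p q z : Label K} (hp : AnyAdm p) (hq : AnyAdm q) (hz : AnyAdm z)
    (h0 : t 0 = toMode (value Q c p)) (h1 : t 1 = toMode (value Q c q))
    (h2 : t 2 = toMode (value Q c z)) :
    ∃ k, FamAt k p ∧ ¬ ((p k).1 = (p k).2 ↔ (q k).1 = (q k).2) ∧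
      q = Function.update p k (q k) ∧ t = famTuple Q c k p (q k) := by
  have hr := (mem_tuples₁_iff.1 ht).1
  rw [h0, h1, h2] at hr
  obtain ⟨k, hk, hne, hqk, hzk, hd⟩ := h.family_of_isRect hp hq hz hr
  refine ⟨k, hk, hne, hqk, funext fun i => ?_⟩
  fin_cases i
  · exact h0
  · rw [famTuple, ← hqk]; exact h1
  · rw [famTuple, ← hzk]; exact h2
  · show t 3 = toMode _
    rw [← hd, toMode_ofMode]

theorem Generic.isNuclearFamily_iff (h : Generic Q c)
    (high : ∀ p, toMode (value Q c p) ∉ lowModes κ₀) {t : Fin 4 → Mode} :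
    IsNuclearFamily κ₀ (K + 1) (generation Q c) t ↔ ∃ k p u, FamAt k p ∧ (p k).1 ≠ (p k).2 ∧
      u.1 = u.2 ∧ t = famTuple Q c k p u := by
  constructor
  · rintro ⟨ht, j, hj1, hj, h0, h2, h1, h3⟩
    obtain ⟨p, hp, e0⟩ := mem_generation.1 h0
    obtain ⟨q, hq, e1⟩ := mem_generation.1 h1
    obtain ⟨z, hz, e2⟩ := mem_generation.1 h2
    obtain ⟨k, hk, hne, hqk, htk⟩ := h.rect_eq_famTuple ht ⟨_, by omega, hp⟩ ⟨_, by omega, hq⟩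
      ⟨_, by omega, hz⟩ e0.symm e1.symm e2.symm
    -- the parents and the children are not in the same generation
    have h1 := hp k
    have h2 := hq k
    refine ⟨k, p, q k, hk, ?_, ?_, htk⟩
    · intro e
      exact hne (by rw [h1, h2]; rw [h1] at e; omega)
    · by_contra e
      exact hne (by rw [h1, h2]; rw [h2] at e; omega)
  · rintro ⟨k, p, u, hp, hpk, hu, rfl⟩
    exact h.isNuclearFamily_famTuple high hp hpk hu

theorem isTrivialPerm_famTuple {k : Fin K} {p p' : Label K} {u u' : Bool × Bool}
    (hpk : (p k).1 ≠ (p k).2) (hpk' : (p' k).1 ≠ (p' k).2) (hu : u.1 = u.2) (hu' : u'.1 = u'.2)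
    (hpp : ∀ m, m ≠ k → p' m = p m) :
    IsTrivialPerm (famTuple Q c k p u) (famTuple Q c k p' u') := by
  have hp' : p' = Function.update p k (p' k) := funext fun m => by
    by_cases hm : m = k
    · subst hm; simp
    · simp [hm, hpp m hm]
  rcases eq_or_eq_opp (v := p k) (w := p' k) (by tauto) with e | e <;>
    rcases eq_or_eq_opp (v := u) (w := u') (by tauto) with e' | e' <;>
    rw [e] at hp' <;> subst e' <;> subst hp'
  · left; simp [famTuple]
  · right; left; simp [famTuple]
  · right; right; left; simp [famTuple]
  · right; right; right; simp [famTuple]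

theorem Generic.closure (h : Generic Q c) :
    Closure κ₀ (K + 1) (generation Q c) := by
  intro n₁ h₁ n₂ h₂ n₃ h₃ n hn
  obtain ⟨p, hp, rfl⟩ := mem_unionGen_generation.1 h₁
  obtain ⟨q, hq, rfl⟩ := mem_unionGen_generation.1 h₂
  obtain ⟨z, hz, rfl⟩ := mem_unionGen_generation.1 h₃
  obtain ⟨k, hk, -, -, ht⟩ := h.rect_eq_famTuple (κ₀ := κ₀)
    (t := ![toMode (value Q c p), toMode (value Q c q), toMode (value Q c z), n]) hn hp hq hz
    rfl rfl rfl
  have := congrFun ht 3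
  exact mem_unionGen_generation.2 ⟨_, (hk.update _).anyAdm, this.symm⟩

theorem Generic.faithfulness (h : Generic Q c)
    (high : ∀ p, toMode (value Q c p) ∉ lowModes κ₀) :
    Faithfulness κ₀ (K + 1) (generation Q c) := by
  intro t ht hΛ
  obtain ⟨p, hp, e0⟩ := mem_unionGen_generation.1 (hΛ 0)
  obtain ⟨q, hq, e1⟩ := mem_unionGen_generation.1 (hΛ 1)
  obtain ⟨z, hz, e2⟩ := mem_unionGen_generation.1 (hΛ 2)
  obtain ⟨k, hk, hne, -, rfl⟩ := h.rect_eq_famTuple ht hp hq hz e0.symm e1.symm e2.symm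
  by_cases hpk : (p k).1 = (p k).2
  · have hqk : (q k).1 ≠ (q k).2 := by tauto
    refine ⟨finRotate 4, (h.isNuclearFamily_iff high).2 ⟨k, Function.update p k (q k), opp (p k),
      hk.update _, by simpa using hqk, by simpa using hpk, funext fun i => ?_⟩⟩
    fin_cases i
    · rfl
    · show toMode (value Q c (Function.update p k (opp (p k)))) = toMode (value Q c
        (Function.update (Function.update p k (q k)) k (opp (p k))))
      rw [Function.update_idem]
    · show toMode (value Q c (Function.update p k (opp (q k)))) = toMode (value Q c
        (Function.update (Function.update p k (q k)) k
          (opp (Function.update p k (q k) k))))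
      rw [Function.update_idem, Function.update_self]
    · show toMode (value Q c p) = toMode (value Q c
        (Function.update (Function.update p k (q k)) k (opp (opp (p k)))))
      rw [Function.update_idem, opp_opp, Function.update_eq_self]
  · exact ⟨1, h.isNuclearFamily_famTuple high hk hpk (by tauto)⟩

theorem Generic.uniqueSpouseChildren (h : Generic Q c)
    (high : ∀ p, toMode (value Q c p) ∉ lowModes κ₀) :
    UniqueSpouseChildren κ₀ (K + 1) (generation Q c) := by
  intro j hj1 hj n hn
  obtain ⟨p, hp, rfl⟩ := mem_generation.1 hn
  set k : Fin K := ⟨j - 1, by omega⟩ with hk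
  have hfam : FamAt k p := fun m _ => hp m
  have hpk : (p k).1 ≠ (p k).2 := fun e => by
    have := (hp k).1 e
    rw [hk] at this
    exact lt_irrefl _ this
  refine ⟨famTuple Q c k p (true, true),
    ⟨h.isNuclearFamily_famTuple high hfam hpk rfl, Or.inl rfl⟩, ?_⟩
  rintro t' ⟨ht', he⟩
  obtain ⟨k', p', u', hf', hpk', hu', rfl⟩ := (h.isNuclearFamily_iff high).1 ht'
  obtain ⟨v, hv, e⟩ : ∃ v : Bool × Bool, v.1 ≠ v.2 ∧ Function.update p' k' v = p := by
    rcases he with he | he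
    · exact ⟨p' k', hpk', by simpa using h.toMode_value_injective he⟩
    · exact ⟨opp (p' k'), by simpa using hpk', h.toMode_value_injective he⟩
  have hA : Adm k'.val p := by
    rw [← e]; exact (hf'.update v).adm (by simpa using hv)
  obtain rfl : k' = k := Fin.ext (Adm.unique k'.2.le (by omega) hA hp)
  exact isTrivialPerm_famTuple hpk hpk' rfl hu' fun m hm => by rw [← e]; simp [hm]

theorem Generic.uniqueSiblingParents (h : Generic Q c)
    (high : ∀ p, toMode (value Q c p) ∉ lowModes κ₀) :
    UniqueSiblingParents κ₀ (K + 1) (generation Q c) := by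
  intro j hj1 hj n hn
  obtain ⟨p, hp, rfl⟩ := mem_generation.1 hn
  set k : Fin K := ⟨j - 1, by omega⟩ with hk
  have hkj : k.val + 1 = j := by rw [hk]; simp only; omega
  have hp' : Adm (k.val + 1) p := by
    rw [hkj]; exact hp
  have hfam : FamAt k p := fun m hm => by
    rw [hp' m]
    have : m.val ≠ k.val := fun h => hm (Fin.ext h)
    omega
  have hpk : (p k).1 = (p k).2 := (hp' k).2 (by omega)
  have hnuc := h.isNuclearFamily_famTuple high (u := p k) (hfam.update (true, false))
    (by simp) hpk
  refine ⟨_, ⟨hnuc, Or.inl (by simp [famTuple])⟩, ?_⟩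
  rintro t' ⟨ht', he⟩
  obtain ⟨k', p', u', hf', hpk', hu', rfl⟩ := (h.isNuclearFamily_iff high).1 ht'
  obtain ⟨v, hv, e⟩ : ∃ v : Bool × Bool, v.1 = v.2 ∧ Function.update p' k' v = p := by
    rcases he with he | he
    · exact ⟨u', hu', h.toMode_value_injective he⟩
    · exact ⟨opp u', by simpa using hu', h.toMode_value_injective he⟩
  have hA : Adm (k'.val + 1) p := by
    rw [← e]; exact (hf'.update v).adm_succ (by simpa using hv)
  obtain rfl : k' = k := Fin.ext (by
    have := Adm.unique k'.2 (by omega) hA hp'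
    omega)
  exact isTrivialPerm_famTuple (by simp) hpk' hpk hu' fun m hm => by rw [← e]; simp [hm]

theorem Generic.nondegeneracy (h : Generic Q c)
    (high : ∀ p, toMode (value Q c p) ∉ lowModes κ₀) :
    Nondegeneracy κ₀ (K + 1) (generation Q c) := by
  rintro n - m m' ⟨t, ht, hs⟩ ⟨t', ht', hs'⟩ rfl
  obtain ⟨k, p, u, -, hpk, hu, rfl⟩ := (h.isNuclearFamily_iff high).1 ht
  obtain ⟨k', p', u', -, hpk', hu', rfl⟩ := (h.isNuclearFamily_iff high).1 ht'
  obtain ⟨v, hv, e1, e2⟩ : ∃ v : Bool × Bool, v.1 = v.2 ∧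
      toMode (value Q c (Function.update p k v)) = n ∧
      toMode (value Q c (Function.update p k (opp v))) = m := by
    rcases hs with ⟨a, b⟩ | ⟨a, b⟩
    · exact ⟨u, hu, a, b⟩
    · exact ⟨opp u, by simpa using hu, a, by rw [opp_opp]; exact b⟩
  obtain ⟨v', hv', e1', e2'⟩ : ∃ v : Bool × Bool, v.1 ≠ v.2 ∧
      toMode (value Q c (Function.update p' k' v)) = n ∧
      toMode (value Q c (Function.update p' k' (opp v))) = m := by
    rcases hs' with ⟨a, b⟩ | ⟨a, b⟩
    · exact ⟨p' k', hpk', by rw [Function.update_eq_self]; exact a, b⟩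
    · exact ⟨opp (p' k'), by simpa using hpk', a, by
        rw [opp_opp, Function.update_eq_self]; exact b⟩
  have h1 := h.toMode_value_injective (e1.trans e1'.symm)
  have h2 := h.toMode_value_injective (e2.trans e2'.symm)
  have a1 := congrFun h1 k
  have a2 := congrFun h2 k
  simp only [Function.update_self] at a1 a2
  by_cases hkk : k = k'
  · subst hkk
    simp only [Function.update_self] at a1
    exact hv' (a1 ▸ hv)
  · rw [Function.update_of_ne hkk] at a1 a2
    exact opp_ne v (a2.trans a1.symm)

end generations

/-! ### Interactions with frequencies outside the configuration -/

section outside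

variable {K : ℕ} {Q : Fin K → ℤ} {c : Finset (Fin K) → GaussianInt} {κ₀ : ℝ}

/-- The rectangle of vertex set `R` contains `n` and the points of labels `p` and `q`, and its
right triangle on these three vertices has its right angle at `n`, or at the point of label `p`. -/
def Incidence (Q : Fin K → ℤ) (c : Finset (Fin K) → GaussianInt) (n : GaussianInt) (p q : Label K)
    (R : Finset Mode) : Prop :=
  AnyAdm p ∧ AnyAdm q ∧ p ≠ q ∧
    ((RightAt 0 n.toComplex (value Q c p).toComplex (value Q c q).toComplex ∧
      R = {toMode n, toMode (value Q c p), toMode (value Q c q),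
        toMode (value Q c p + value Q c q - n)}) ∨
    (RightAt 1 n.toComplex (value Q c p).toComplex (value Q c q).toComplex ∧
      R = {toMode n, toMode (value Q c p), toMode (value Q c q),
        toMode (n + value Q c q - value Q c p)}))

theorem image_univ_fin_four {α : Type*} [DecidableEq α] (t : Fin 4 → α) :
    Finset.univ.image t = {t 0, t 1, t 2, t 3} := by
  ext x
  simp [Fin.exists_fin_succ, eq_comm]

theorem insert_four_rotate {α : Type*} [DecidableEq α] (a b d e : α) :
    ({a, b, d, e} : Finset α) = {b, d, e, a} := by
  ext; simp; tauto

theorem insert_four_swap {α : Type*} [DecidableEq α] (a b d e : α) :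
    ({a, b, d, e} : Finset α) = {a, d, b, e} := by
  rw [Finset.insert_comm b]

theorem insert_four_swap' {α : Type*} [DecidableEq α] (a b d e : α) :
    ({a, b, d, e} : Finset α) = {a, b, e, d} := by
  rw [Finset.pair_comm]

theorem tuples₁_rotate {t : Fin 4 → Mode} (ht : t ∈ tuples₁ κ₀) :
    ![t 1, t 2, t 3, t 0] ∈ tuples₁ κ₀ := by
  rw [mem_tuples₁_iff] at *
  refine ⟨ht.1.rotate, fun i => ?_⟩
  fin_cases i
  · exact ht.2 1
  · exact ht.2 2
  · exact ht.2 3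
  · exact ht.2 0

theorem exists_tuples₁_last {t : Fin 4 → Mode} (ht : t ∈ tuples₁ κ₀) (j : Fin 4) :
    ∃ s ∈ tuples₁ κ₀, s 3 = t j ∧ Finset.univ.image s = Finset.univ.image t := by
  have h1 := tuples₁_rotate ht
  have h2 := tuples₁_rotate h1
  have h3 := tuples₁_rotate h2
  fin_cases j
  · exact ⟨_, h1, rfl, by simp only [image_univ_fin_four]; ext; simp; tauto⟩
  · exact ⟨_, h2, rfl, by simp only [image_univ_fin_four]; ext; simp; tauto⟩
  · exact ⟨_, h3, rfl, by simp only [image_univ_fin_four]; ext; simp; tauto⟩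
  · exact ⟨t, ht, rfl, rfl⟩

/-- Labelling the vertices of a rectangle so that the point `n` comes last, two of its vertices in
the configuration form a right triangle with `n`. -/
theorem exists_incidence {n : Mode} (hn : n ∉ unionGen (K + 1) (generation Q c))
    {R : Finset Mode} (hR : ∃ t ∈ tuples₁ κ₀, R = Finset.univ.image t ∧ n ∈ R ∧
      2 ≤ (R ∩ unionGen (K + 1) (generation Q c)).card) :
    ∃ p q, Incidence Q c (ofMode n) p q R := by
  obtain ⟨t, ht, rfl, hnR, hcard⟩ := hR
  obtain ⟨j, -, hj⟩ := Finset.mem_image.1 hnR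
  obtain ⟨s, hs, hsj, hst⟩ := exists_tuples₁_last ht j
  rw [← hst] at hcard ⊢
  rw [hj] at hsj
  obtain ⟨x, hx, y, hy, hxy⟩ := Finset.one_lt_card.1 hcard
  rw [Finset.mem_inter] at hx hy
  obtain ⟨a, -, rfl⟩ := Finset.mem_image.1 hx.1
  obtain ⟨b, -, rfl⟩ := Finset.mem_image.1 hy.1
  replace hx := hx.2
  replace hy := hy.2
  have hr := (mem_tuples₁_iff.1 hs).1
  have hne := hr.ne
  have hr1 := hr.rotate
  have hr2 := hr1.rotate
  have hr3 := hr2.rotate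
  have key : ∀ u v : Fin 4, ofMode (s u) ≠ ofMode (s v) →
      s u ∈ unionGen (K + 1) (generation Q c) → s v ∈ unionGen (K + 1) (generation Q c) →
      ∃ p q, AnyAdm p ∧ AnyAdm q ∧ p ≠ q ∧ ofMode (s u) = value Q c p ∧
        ofMode (s v) = value Q c q := by
    intro u v huv hu hv
    obtain ⟨p, hp, e⟩ := mem_unionGen_generation.1 hu
    obtain ⟨q, hq, e'⟩ := mem_unionGen_generation.1 hv
    rw [← e, ← e'] at huv ⊢
    exact ⟨p, q, hp, hq, fun h => huv (by rw [h]), rfl, rfl⟩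
  have c02 : s 0 ∈ unionGen (K + 1) (generation Q c) → s 2 ∈ unionGen (K + 1) (generation Q c) →
      ∃ p q, Incidence Q c (ofMode n) p q (Finset.univ.image s) := by
    intro h0 h2
    obtain ⟨p, q, hp, hq, hpq, e, e'⟩ := key 0 2 hne.2.2.1 h0 h2
    refine ⟨p, q, hp, hq, hpq, Or.inl ⟨?_, ?_⟩⟩
    · rw [← hsj, ← e, ← e']
      exact (dot_comm _ _).trans hr2.2.2.2
    · rw [← hsj, ← e, ← e', ← hr.1, image_univ_fin_four]
      rw [show ∀ a b d : GaussianInt, a + b - (a - d + b) = d from fun a b d => by ring, hr.1,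
        toMode_ofMode, toMode_ofMode, toMode_ofMode, toMode_ofMode, insert_four_rotate (s 3),
        insert_four_swap (s 0), insert_four_swap' (s 0)]
  have c12 : s 1 ∈ unionGen (K + 1) (generation Q c) → s 2 ∈ unionGen (K + 1) (generation Q c) →
      ∃ p q, Incidence Q c (ofMode n) p q (Finset.univ.image s) := by
    intro h1 h2
    obtain ⟨p, q, hp, hq, hpq, e, e'⟩ := key 2 1 hne.2.1 h2 h1
    refine ⟨p, q, hp, hq, hpq, Or.inr ⟨?_, ?_⟩⟩
    · rw [← hsj, ← e, ← e']
      exact (dot_comm _ _).trans hr1.2.2.2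
    · rw [← hsj, ← e, ← e', image_univ_fin_four, show ofMode (s 3) + ofMode (s 1) - ofMode (s 2) =
        ofMode (s 0) by rw [← hr.1]; ring]
      rw [toMode_ofMode, toMode_ofMode, toMode_ofMode, toMode_ofMode, insert_four_rotate (s 3),
        insert_four_swap (s 2), insert_four_rotate (s 2), insert_four_swap' (s 0) (s 1) (s 2)]
  have c01 : s 0 ∈ unionGen (K + 1) (generation Q c) → s 1 ∈ unionGen (K + 1) (generation Q c) →
      ∃ p q, Incidence Q c (ofMode n) p q (Finset.univ.image s) := by
    intro h0 h1
    obtain ⟨p, q, hp, hq, hpq, e, e'⟩ := key 0 1 hne.1 h0 h1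
    refine ⟨p, q, hp, hq, hpq, Or.inr ⟨?_, ?_⟩⟩
    · rw [← hsj, ← e, ← e']
      exact hr3.2.2.2
    · rw [← hsj, ← e, ← e', image_univ_fin_four, show ofMode (s 3) + ofMode (s 1) - ofMode (s 0) =
        ofMode (s 2) by rw [← hr.1]; ring]
      rw [toMode_ofMode, toMode_ofMode, toMode_ofMode, toMode_ofMode, insert_four_rotate (s 3)]
  have hs3 : s 3 ∉ unionGen (K + 1) (generation Q c) := by rw [hsj]; exact hn
  fin_cases a <;> fin_cases b <;> first
    | exact absurd rfl hxy
    | exact absurd hx hs3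
    | exact absurd hy hs3
    | exact c02 hx hy
    | exact c02 hy hx
    | exact c12 hx hy
    | exact c12 hy hx
    | exact c01 hx hy
    | exact c01 hy hx

/-- A rectangle is determined by its incidence with a pair of points. -/
theorem Incidence.eq_of_samePair {n : GaussianInt} (hn : ∀ p, AnyAdm p → n ≠ value Q c p)
    (hinj : Function.Injective (value Q c))
    {p q z y : Label K} {R R' : Finset Mode} (h : Incidence Q c n p q R)
    (h' : Incidence Q c n z y R') (hs : SamePair p q z y) : R = R' := by
  obtain ⟨hp, hq, hpq, h⟩ := h
  obtain ⟨hz, hy, hzy, h'⟩ := h'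
  have no01 : ∀ {a b : Label K}, AnyAdm a →
      RightAt 0 n.toComplex (value Q c a).toComplex (value Q c b).toComplex →
      RightAt 1 n.toComplex (value Q c a).toComplex (value Q c b).toComplex → False := by
    intro a b ha h0 h1
    refine hn a ha (eq_of_dot_sub_self ?_).symm
    simp only [RightAt, dot, Complex.sub_re, Complex.sub_im] at h0 h1 ⊢
    linarith
  have no11 : ∀ {a b : Label K}, a ≠ b →
      RightAt 1 n.toComplex (value Q c a).toComplex (value Q c b).toComplex →
      RightAt 1 n.toComplex (value Q c b).toComplex (value Q c a).toComplex → False := by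
    intro a b hab h0 h1
    refine hab (hinj (eq_of_dot_sub_self ?_))
    simp only [RightAt, dot, Complex.sub_re, Complex.sub_im] at h0 h1 ⊢
    linarith
  have sw : ∀ {a b : Label K},
      RightAt 0 n.toComplex (value Q c a).toComplex (value Q c b).toComplex →
      RightAt 0 n.toComplex (value Q c b).toComplex (value Q c a).toComplex :=
    fun h => (dot_comm _ _).trans h
  rcases hs with ⟨rfl, rfl⟩ | ⟨rfl, rfl⟩ <;> rcases h with ⟨h, rfl⟩ | ⟨h, rfl⟩ <;>
    rcases h' with ⟨h', rfl⟩ | ⟨h', rfl⟩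
  · rfl
  · exact (no01 hp h h').elim
  · exact (no01 hp h' h).elim
  · rfl
  · rw [add_comm (value Q c p)]
    rw [insert_four_swap]
  · exact (no01 hq (sw h) h').elim
  · exact (no01 hp (sw h') h).elim
  · exact (no11 hpq h h').elim

/-- Three rectangles would give three right triangles with vertex `n` on different pairs of
admissible labels, which the arithmetic of the sizes excludes. -/
theorem Generic.noSpreadingHigh (h : Generic Q c) :
    NoSpreadingHigh κ₀ (K + 1) (generation Q c) := by
  intro n hn
  by_contra hcon
  have h3 : (3 : ℕ∞) ≤ Set.encard {R : Finset Mode | ∃ t ∈ tuples₁ κ₀,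
      R = Finset.univ.image t ∧ n ∈ R ∧ 2 ≤ (R ∩ unionGen (K + 1) (generation Q c)).card} :=
    Order.add_one_le_of_lt (not_le.1 hcon)
  obtain ⟨T, hT, hT3⟩ := Set.exists_subset_encard_eq h3
  obtain ⟨R₁, R₂, R₃, h12, h13, h23, rfl⟩ := Set.encard_eq_three.1 hT3
  obtain ⟨p, q, i1⟩ := exists_incidence hn (hT (by simp : R₁ ∈ _))
  obtain ⟨z, y, i2⟩ := exists_incidence hn (hT (by simp : R₂ ∈ _))
  obtain ⟨s, t, i3⟩ := exists_incidence hn (hT (by simp : R₃ ∈ _))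
  have hn' : ∀ p, AnyAdm p → ofMode n ≠ value Q c p := fun p hp e =>
    hn (mem_unionGen_generation.2 ⟨p, hp, by rw [← e, toMode_ofMode]⟩)
  have right : ∀ {p q R}, Incidence Q c (ofMode n) p q R → ∃ τ, RightAt τ (ofMode n).toComplex
      (value Q c p).toComplex (value Q c q).toComplex := fun i => by
    rcases i.2.2.2 with h | h
    · exact ⟨0, h.1⟩
    · exact ⟨1, h.1⟩
  obtain ⟨τ₁, r1⟩ := right i1
  obtain ⟨τ₂, r2⟩ := right i2
  obtain ⟨τ₃, r3⟩ := right i3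
  exact h.false_of_three hn' i1.1 i1.2.1 i2.1 i2.2.1 i3.1 i3.2.1 i1.2.2.1 i2.2.2.1 i3.2.2.1
    (fun e => h12 (i1.eq_of_samePair hn' h.inj i2 e))
    (fun e => h13 (i1.eq_of_samePair hn' h.inj i3 e))
    (fun e => h23 (i2.eq_of_samePair hn' h.inj i3 e)) r1 r2 r3

/-- The points of the configuration are so far from orthogonality that no near-resonant tuple
contains two of them and a low mode. -/
theorem not_mem_tuples₀ {v : Mode → ℝ} {η C : ℝ} (hv : ∀ n, |v n| ≤ C)
    (high : ∀ p, toMode (value Q c p) ∉ lowModes κ₀)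
    (far : ∀ p q m, m ∈ lowModes κ₀ → η + 4 * C <
      2 * |dot ((value Q c p).toComplex - (ofMode m).toComplex)
        ((value Q c q).toComplex - (ofMode m).toComplex)|)
    (far' : ∀ p q m, m ∈ lowModes κ₀ → p ≠ q → η + 4 * C <
      2 * |dot ((value Q c p).toComplex - (value Q c q).toComplex)
        ((ofMode m).toComplex - (value Q c q).toComplex)|)
    {t : Fin 4 → Mode} (ht : t ∈ tuples₀ v κ₀ η) {i j : Fin 4} (hij : i ≠ j)
    (hi : t i ∈ unionGen (K + 1) (generation Q c)) (hj : t j ∈ unionGen (K + 1) (generation Q c)) :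
    False := by
  obtain ⟨hsum, h03, h23, hρ, hlow⟩ := ht
  simp only at hsum h03 h23 hρ hlow
  obtain ⟨l, hl⟩ : ∃ l, t l ∈ lowModes κ₀ := by
    rcases hlow with h | h | h | h
    exacts [⟨3, h⟩, ⟨0, h⟩, ⟨1, h⟩, ⟨2, h⟩]
  obtain ⟨p, -, hp⟩ := mem_unionGen_generation.1 hi
  obtain ⟨q, -, hq⟩ := mem_unionGen_generation.1 hj
  have hil : i ≠ l := by
    rintro rfl
    exact high p (by rw [hp]; exact hl)
  have hjl : j ≠ l := by
    rintro rfl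
    exact high q (by rw [hq]; exact hl)
  have hd : modeNorm (t 0) ^ 2 - modeNorm (t 1) ^ 2 + modeNorm (t 2) ^ 2 - modeNorm (t 3) ^ 2 =
      -2 * dot ((ofMode (t 0)).toComplex - (ofMode (t 1)).toComplex)
        ((ofMode (t 2)).toComplex - (ofMode (t 1)).toComplex) := modeNorm_sq_parallelogram hsum
  have h01 : t 0 ≠ t 1 := fun e => h23 (by rw [← hsum, e]; simp)
  have h21 : t 2 ≠ t 1 := fun e => h03 (by rw [← hsum, e]; simp)
  -- the divisor is, up to the potential, twice the scalar product at any of the four vertices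
  have hb : ∀ x, |x| = |dot ((ofMode (t 0)).toComplex - (ofMode (t 1)).toComplex)
        ((ofMode (t 2)).toComplex - (ofMode (t 1)).toComplex)| → ¬ η + 4 * C < 2 * |x| := by
    intro x hx hlt
    rw [hx] at hlt
    simp only [smallDivisor] at hρ
    have a0 := abs_le.1 (hv (t 0))
    have a1 := abs_le.1 (hv (t 1))
    have a2 := abs_le.1 (hv (t 2))
    have a3 := abs_le.1 (hv (t 3))
    have a4 := abs_le.1 hρ
    rcases abs_cases (dot ((ofMode (t 0)).toComplex - (ofMode (t 1)).toComplex)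
        ((ofMode (t 2)).toComplex - (ofMode (t 1)).toComplex)) with ⟨e, -⟩ | ⟨e, -⟩ <;>
      rw [e] at hlt <;> linarith [a0.1, a0.2, a1.1, a1.2, a2.1, a2.2, a3.1, a3.2, a4.1, a4.2]
  have h3 : (ofMode (t 3)).toComplex = (ofMode (t 0)).toComplex - (ofMode (t 1)).toComplex +
      (ofMode (t 2)).toComplex := by
    rw [← hsum, ← map_sub, ← map_add]; rfl
  have hpi : value Q c p = ofMode (t i) := by rw [← hp, ofMode_toMode]
  have hqj : value Q c q = ofMode (t j) := by rw [← hq, ofMode_toMode]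
  have f1 := far p q _ hl
  have f2 : t i ≠ t j → _ := fun hne => far' p q _ hl fun e => hne (by rw [← hp, ← hq, e])
  have f3 : t j ≠ t i → _ := fun hne => far' q p _ hl fun e => hne (by rw [← hp, ← hq, e])
  rw [hpi, hqj] at f1 f2 f3
  have g1 : ∀ a b d : Fin 4, (a = i ∧ b = l ∧ d = j ∨ (a = i ∧ b = j ∧ d = l ∧ t a ≠ t b) ∨
      (a = j ∧ b = i ∧ d = l ∧ t a ≠ t b)) →
      |dot ((ofMode (t a)).toComplex - (ofMode (t b)).toComplex)
        ((ofMode (t d)).toComplex - (ofMode (t b)).toComplex)| =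
      |dot ((ofMode (t 0)).toComplex - (ofMode (t 1)).toComplex)
        ((ofMode (t 2)).toComplex - (ofMode (t 1)).toComplex)| → False := by
    rintro a b d (⟨rfl, rfl, rfl⟩ | ⟨rfl, rfl, rfl, hne⟩ | ⟨rfl, rfl, rfl, hne⟩) he
    · exact hb _ he f1
    · exact hb _ he (f2 hne)
    · exact hb _ he (f3 hne)
  have E1 := fun x => g1 0 1 2 x rfl
  have E1' := fun x => g1 2 1 0 x (by rw [dot_comm])
  have E2 := fun x => g1 1 2 3 x (by
    rw [h3, ← abs_neg]; congr 1
    simp only [dot, Complex.sub_re, Complex.sub_im, Complex.add_re, Complex.add_im]; ring)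
  have E2' := fun x => g1 3 2 1 x (by
    rw [h3, ← abs_neg]; congr 1
    simp only [dot, Complex.sub_re, Complex.sub_im, Complex.add_re, Complex.add_im]; ring)
  have E3 := fun x => g1 2 3 0 x (by
    rw [h3]; congr 1
    simp only [dot, Complex.sub_re, Complex.sub_im, Complex.add_re, Complex.add_im]; ring)
  have E3' := fun x => g1 0 3 2 x (by
    rw [h3]; congr 1
    simp only [dot, Complex.sub_re, Complex.sub_im, Complex.add_re, Complex.add_im]; ring)
  have E0 := fun x => g1 3 0 1 x (by
    rw [h3, ← abs_neg]; congr 1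
    simp only [dot, Complex.sub_re, Complex.sub_im, Complex.add_re, Complex.add_im]; ring)
  have E0' := fun x => g1 1 0 3 x (by
    rw [h3, ← abs_neg]; congr 1
    simp only [dot, Complex.sub_re, Complex.sub_im, Complex.add_re, Complex.add_im]; ring)
  clear g1 hb f1 f2 f3
  have h03' := h03.symm
  have h23' := h23.symm
  have h01' := h01.symm
  have h21' := h21.symm
  clear hd hρ hlow hsum hpi hqj hi hj hp hq hl
  revert E0 E1 E2 E3 E0' E1' E2' E3' hij hil hjl
  revert i j l
  simp only [ne_eq] at h03 h23 h01 h21 h03' h23' h01' h21'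
  intro i j l
  fin_cases i <;> fin_cases j <;> fin_cases l <;> simp [h03, h23, h01, h21, h03', h23', h01', h21']

end outside

/-! ### From generic choices to generic configurations -/

theorem abs_dot_le (u v : ℂ) : |dot u v| ≤ ‖u‖ * ‖v‖ := by
  have : dot u v = (u * (starRingEnd ℂ) v).re := by simp [dot]
  rw [this]
  refine (Complex.abs_re_le_norm _).trans ?_
  rw [norm_mul, Complex.norm_conj]

theorem dot_add_mul (X : ℝ) (u v du dv : ℂ) : dot (X * u + du) (X * v + dv) =
    X ^ 2 * dot u v + X * dot u dv + X * dot du v + dot du dv := by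
  simp only [dot, Complex.add_re, Complex.add_im, Complex.re_ofReal_mul, Complex.im_ofReal_mul]
  ring

/-- A scalar product at least `1` in absolute value dominates small perturbations after a
dilation. -/
theorem le_abs_dot_of_perturbation {X R D : ℝ} {u v du dv : ℂ} (hR : 1 ≤ R) (hD : 0 ≤ D)
    (hX : 8 * R * D ≤ X) (h : 1 ≤ |dot u v|) (hu : ‖u‖ ≤ R) (hv : ‖v‖ ≤ R) (hdu : ‖du‖ ≤ D)
    (hdv : ‖dv‖ ≤ D) : X ^ 2 / 2 ≤ |dot (X * u + du) (X * v + dv)| := by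
  have hX0 : 0 ≤ X := le_trans (by positivity) hX
  have hR0 : 0 ≤ R := by linarith
  have b1 : |dot u dv| ≤ R * D := (abs_dot_le _ _).trans
    (mul_le_mul hu hdv (norm_nonneg _) hR0)
  have b2 : |dot du v| ≤ D * R := (abs_dot_le _ _).trans
    (mul_le_mul hdu hv (norm_nonneg _) hD)
  have b3 : |dot du dv| ≤ D * D := (abs_dot_le _ _).trans
    (mul_le_mul hdu hdv (norm_nonneg _) hD)
  have hDX : 8 * D ≤ X := by nlinarith
  have c1 : X * |dot u dv| ≤ X * X / 8 := by nlinarith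
  have c2 : X * |dot du v| ≤ X * X / 8 := by nlinarith
  have c3 : |dot du dv| ≤ X * X / 64 := by nlinarith
  have c4 : X ^ 2 ≤ X ^ 2 * |dot u v| := by nlinarith [sq_nonneg X]
  rw [dot_add_mul]
  have e1 : |X ^ 2 * dot u v| = X ^ 2 * |dot u v| := by rw [abs_mul, abs_of_nonneg (sq_nonneg X)]
  have e2 : |X * dot u dv| = X * |dot u dv| := by rw [abs_mul, abs_of_nonneg hX0]
  have e3 : |X * dot du v| = X * |dot du v| := by rw [abs_mul, abs_of_nonneg hX0]
  have t1 := abs_sub_abs_le_abs_sub (X ^ 2 * dot u v) (-(X * dot u dv + X * dot du v + dot du dv))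
  rw [sub_neg_eq_add, abs_neg, ← add_assoc, ← add_assoc] at t1
  have t2 := abs_add_three (X * dot u dv) (X * dot du v) (dot du dv)
  nlinarith

theorem norm_le_of_right_angle {a b n : ℂ} {r : ℝ} (ha : ‖a‖ ≤ r) (hb : ‖b‖ ≤ r)
    (h : dot (a - n) (b - n) = 0) : ‖n‖ ≤ 3 * r := by
  have hr : 0 ≤ r := (norm_nonneg _).trans ha
  have e : ‖n‖ ^ 2 = dot n a + dot n b - dot a b := by
    rw [← Complex.normSq_eq_norm_sq, Complex.normSq_apply]
    simp only [dot, Complex.sub_re, Complex.sub_im] at h ⊢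
    linarith
  have h1 := (le_abs_self _).trans (abs_dot_le n a)
  have h2 := (le_abs_self _).trans (abs_dot_le n b)
  have h3 := (neg_le_abs _).trans (abs_dot_le a b)
  have hn := norm_nonneg n
  have h1' : ‖n‖ * ‖a‖ ≤ ‖n‖ * r := mul_le_mul_of_nonneg_left ha hn
  have h2' : ‖n‖ * ‖b‖ ≤ ‖n‖ * r := mul_le_mul_of_nonneg_left hb hn
  have h3' : ‖a‖ * ‖b‖ ≤ r * r := mul_le_mul ha hb (norm_nonneg _) hr
  by_contra hcon
  push Not at hcon
  nlinarith

/-- The intersection point of two lines which are far from parallel is not far away. -/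
theorem abs_re_im_le_of_lines {n a b lam mu : ℂ} {r s t : ℝ} (hs : 0 < s)
    (h1 : dot (n - a) lam = 0) (h2 : dot (n - b) mu = 0)
    (hw : s ≤ |lam.re * mu.im - lam.im * mu.re|) (hab : ‖b - a‖ ≤ r) (hl : ‖lam‖ ≤ r)
    (hm : ‖mu‖ ≤ r) (ht : r ^ 3 ≤ s * t) : |(n - a).re| ≤ t ∧ |(n - a).im| ≤ t := by
  have hr : 0 ≤ r := (norm_nonneg _).trans hab
  have h3 : dot (n - a) mu = dot (b - a) mu := by
    simp only [dot, Complex.sub_re, Complex.sub_im] at h2 ⊢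
    linarith
  have h4 : |dot (n - a) mu| ≤ r * r := by
    rw [h3]
    exact (abs_dot_le _ _).trans (mul_le_mul hab hm (norm_nonneg _) hr)
  have e1 : (n - a).re * (lam.re * mu.im - lam.im * mu.re) = -(dot (n - a) mu * lam.im) := by
    simp only [dot] at h1 ⊢
    linear_combination mu.im * h1
  have e2 : (n - a).im * (lam.re * mu.im - lam.im * mu.re) = dot (n - a) mu * lam.re := by
    simp only [dot] at h1 ⊢
    linear_combination -mu.re * h1
  have key : ∀ x y : ℝ, |y| ≤ r → |x * (lam.re * mu.im - lam.im * mu.re)| =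
      |dot (n - a) mu * y| → |x| ≤ t := by
    intro x y hy hxy
    rw [abs_mul, abs_mul] at hxy
    have h5 : |dot (n - a) mu| * |y| ≤ r * r * r := mul_le_mul h4 hy (abs_nonneg _) (by positivity)
    have h6 : |x| * s ≤ |x| * |lam.re * mu.im - lam.im * mu.re| :=
      mul_le_mul_of_nonneg_left hw (abs_nonneg _)
    have h7 : |x| * s ≤ t * s := by nlinarith
    exact le_of_mul_le_mul_right h7 hs
  exact ⟨key _ _ ((Complex.abs_im_le_norm _).trans hl) (by rw [e1, abs_neg]),
    key _ _ ((Complex.abs_re_le_norm _).trans hl) (by rw [e2])⟩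

theorem norm_le_of_mem_gaussBox {R : ℕ} {z : GaussianInt} (h : z ∈ gaussBox R) :
    ‖z.toComplex‖ ≤ 2 * R := by
  rw [mem_gaussBox] at h
  refine (Complex.norm_le_abs_re_add_abs_im _).trans ?_
  rw [← GaussianInt.intCast_re, ← GaussianInt.intCast_im]
  have h1 : |(z.re : ℝ)| ≤ R := by
    rw [abs_le]; exact ⟨by exact_mod_cast h.1.1, by exact_mod_cast h.1.2⟩
  have h2 : |(z.im : ℝ)| ≤ R := by
    rw [abs_le]; exact ⟨by exact_mod_cast h.2.1, by exact_mod_cast h.2.2⟩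
  linarith

theorem mem_gaussBox_of_abs_le {R : ℕ} {z : GaussianInt} (h1 : |z.toComplex.re| ≤ R)
    (h2 : |z.toComplex.im| ≤ R) : z ∈ gaussBox R := by
  rw [← GaussianInt.intCast_re, abs_le] at h1
  rw [← GaussianInt.intCast_im, abs_le] at h2
  rw [mem_gaussBox]
  exact ⟨⟨by exact_mod_cast h1.1, by exact_mod_cast h1.2⟩, by exact_mod_cast h2.1,
    by exact_mod_cast h2.2⟩

theorem mem_gaussBox_of_norm_le {R : ℕ} {z : GaussianInt} (h : ‖z.toComplex‖ ≤ R) :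
    z ∈ gaussBox R :=
  mem_gaussBox_of_abs_le ((Complex.abs_re_le_norm _).trans h) ((Complex.abs_im_le_norm _).trans h)

/-- The index set of the functionals: the evaluations, and the differences of two evaluations. -/
abbrev FunctionalIndex (K : ℕ) := Label K ⊕ {pq : Label K × Label K // pq.1 ≠ pq.2}

/-- Evaluations, and differences of two evaluations. -/
def functional {K : ℕ} (Q : Fin K → ℤ) : FunctionalIndex K → Finset (Fin K) → GaussianInt
  | .inl p => ev Q p
  | .inr pq => fun S => ev Q pq.1.1 S - ev Q pq.1.2 S

section functionals

variable {K : ℕ} {Q : Fin K → ℤ}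

@[simp] theorem ev_empty (p : Label K) : ev Q p ∅ = 1 := by simp [ev]

theorem GoodSizes.functional_ne_zero (hQ : GoodSizes Q) (e : FunctionalIndex K) :
    functional Q e ≠ 0 := by
  intro h
  rcases e with p | ⟨⟨p, q⟩, hpq⟩
  · have := congrFun h ∅
    simp [functional] at this
  · have h1 := (hQ.eq_zero_of_relation hpq (a := 1) (b := -1) fun S => by
      have := congrArg GaussianInt.toComplex (congrFun h S)
      simp only [functional, map_sub, Pi.zero_apply, map_zero] at this
      linear_combination this).1
    exact one_ne_zero h1

theorem card_functionalIndex_le : Fintype.card (FunctionalIndex K) ≤ 2 * 16 ^ K := by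
  rw [Fintype.card_sum]
  have h1 : Fintype.card (Label K) = 4 ^ K := by simp
  have h2 := Fintype.card_subtype_le fun pq : Label K × Label K => pq.1 ≠ pq.2
  rw [Fintype.card_prod, h1, ← mul_pow] at h2
  have h3 : 4 ^ K ≤ 16 ^ K := Nat.pow_le_pow_left (by norm_num) K
  rw [show 4 * 4 = 16 from rfl] at h2
  omega

theorem functional_sum_bound {V : ℝ} (hV : ∀ p : Label K, 2 * ∑ S, ‖(ev Q p S).toComplex‖ ≤ V)
    {r : ℝ} (hr : 0 ≤ r) (e : FunctionalIndex K) (a : Finset (Fin K) → GaussianInt)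
    (ha : ∀ S, ‖(a S).toComplex‖ ≤ r) :
    ‖(∑ S, functional Q e S * a S).toComplex‖ ≤ V * r := by
  have h1 : ‖(∑ S, functional Q e S * a S).toComplex‖ ≤
      (∑ S, ‖(functional Q e S).toComplex‖) * r := by
    rw [map_sum, Finset.sum_mul]
    refine (norm_sum_le _ _).trans (Finset.sum_le_sum fun S _ => ?_)
    rw [map_mul, norm_mul]
    exact mul_le_mul_of_nonneg_left (ha S) (norm_nonneg _)
  refine h1.trans (mul_le_mul_of_nonneg_right ?_ hr)
  have pos : ∀ p : Label K, 0 ≤ ∑ S, ‖(ev Q p S).toComplex‖ := fun p =>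
    Finset.sum_nonneg fun S _ => norm_nonneg _
  rcases e with p | ⟨⟨p, q⟩, hpq⟩
  · have := hV p
    have := pos p
    simp only [functional]
    linarith
  · have h2 : ∑ S, ‖(functional Q (.inr ⟨(p, q), hpq⟩) S).toComplex‖ ≤
        ∑ S, ‖(ev Q p S).toComplex‖ + ∑ S, ‖(ev Q q S).toComplex‖ := by
      rw [← Finset.sum_add_distrib]
      refine Finset.sum_le_sum fun S _ => ?_
      simp only [functional, map_sub]
      exact norm_sub_le _ _
    have := hV p
    have := hV q
    linarith

end functionals

section construction

variable {K : ℕ} {Q : Fin K → ℤ}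

theorem norm_turn (k : Bool) : ‖(turn k).toComplex‖ = 1 := by
  cases k <;> simp [turn, GaussianInt.toComplex_def]

/-- The scalar product of two functionals, one of them possibly rotated by a right angle, is
large unless it vanishes identically. -/
def Gap (Q : Fin K → ℤ) (c : Finset (Fin K) → GaussianInt) (X : ℝ) : Prop :=
  ∀ (e e' : FunctionalIndex K) (k : Bool),
    (∃ a : ℂ, (∀ S, (functional Q e' S).toComplex = a * (functional Q e S).toComplex) ∧
      dot (turn k).toComplex a = 0) ∨
    X ^ 2 / 2 ≤ |dot (turn k * ∑ S, functional Q e S * c S).toComplex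
      (∑ S, functional Q e' S * c S).toComplex|

variable {c : Finset (Fin K) → GaussianInt} {X : ℝ}

theorem functional_inr_value {p q : Label K} (h : p ≠ q) :
    ∑ S, functional Q (.inr ⟨(p, q), h⟩) S * c S = value Q c p - value Q c q := by
  simp only [functional, value, ← Finset.sum_sub_distrib]
  exact Finset.sum_congr rfl fun S _ => by ring

theorem Gap.inj (hQ : GoodSizes Q) (hX : 0 < X) (h : Gap Q c X) :
    Function.Injective (value Q c) := by
  intro p q hpq
  by_contra hne
  rcases h (.inr ⟨(p, q), hne⟩) (.inr ⟨(p, q), hne⟩) true with ⟨a, ha, ha'⟩ | hd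
  · obtain ⟨S, hS⟩ := Function.ne_iff.1 (hQ.functional_ne_zero (.inr ⟨(p, q), hne⟩))
    have hS' : (functional Q (.inr ⟨(p, q), hne⟩) S).toComplex ≠ 0 := fun h0 =>
      hS (GaussianInt.toComplex_eq_zero.1 h0)
    have : a = 1 := mul_right_cancel₀ hS' (by rw [one_mul]; exact (ha S).symm)
    rw [this] at ha'
    simp [turn, dot] at ha'
  · rw [functional_inr_value hne, hpq, sub_self, mul_zero] at hd
    simp [dot] at hd
    nlinarith

theorem Gap.right (hX : 0 < X) (h : Gap Q c X) {p q z : Label K} (hq : q ≠ p) (hz : z ≠ p)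
    (hd : dot ((value Q c q).toComplex - (value Q c p).toComplex)
      ((value Q c z).toComplex - (value Q c p).toComplex) = 0) :
    ∃ a : ℂ, ∀ S, (ev Q z S).toComplex - (ev Q p S).toComplex =
      a * ((ev Q q S).toComplex - (ev Q p S).toComplex) := by
  rcases h (.inr ⟨(q, p), hq⟩) (.inr ⟨(z, p), hz⟩) true with ⟨a, ha, -⟩ | hd'
  · exact ⟨a, fun S => by simpa [functional] using ha S⟩
  · rw [functional_inr_value hq, functional_inr_value hz, turn, if_pos rfl, one_mul, map_sub,
      map_sub, hd, abs_zero] at hd'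
    nlinarith

theorem Gap.le_abs_dot (h : Gap Q c X) (p q : Label K) :
    X ^ 2 / 2 ≤ |dot (value Q c p).toComplex (value Q c q).toComplex| := by
  rcases h (.inl p) (.inl q) true with ⟨a, ha, ha'⟩ | hd
  · have := ha ∅
    simp [functional] at this
    rw [← this] at ha'
    simp [turn, dot] at ha'
  · simpa [functional, turn, value] using hd

theorem Gap.le_abs_dot_sub (h : Gap Q c X) {p q : Label K} (hpq : p ≠ q) :
    X ^ 2 / 2 ≤ |dot ((value Q c p).toComplex - (value Q c q).toComplex)
      (value Q c q).toComplex| := by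
  rcases h (.inr ⟨(p, q), hpq⟩) (.inl q) true with ⟨a, ha, -⟩ | hd
  · have := ha ∅
    simp [functional] at this
  · rw [functional_inr_value hpq, turn, if_pos rfl, one_mul, map_sub] at hd
    exact hd

theorem dot_eq_zero_of_parallel {n a b l r : ℂ} (hr : r.im = 0) (hr0 : r.re ≠ 0)
    (h1 : dot (n - a) l = 0) (h2 : dot (n - b) (r * l) = 0) : dot (b - a) l = 0 := by
  refine mul_left_cancel₀ hr0 ?_
  simp only [dot, Complex.sub_re, Complex.sub_im, Complex.mul_re, Complex.mul_im, hr] at h1 h2 ⊢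
  linear_combination r.re * h1 - h2

/-- Two lines which are perpendicular to segments with end points in the configuration, one end
point being on the line, are not parallel, except in the presence of a linear relation. -/
theorem Gap.lines (hX : 0 < X) (h : Gap Q c X) {p q z y : Label K}
    (hpq : p ≠ q) (hzy : z ≠ y) (hli : LinearIndependent ℂ ![fun S => (ev Q p S).toComplex,
      fun S => (ev Q q S).toComplex, fun S => (ev Q z S).toComplex]) {n : ℂ} {a a' b : Label K}
    (ha : (a = p ∧ a' = q) ∨ (a = q ∧ a' = p)) (hb : b = z ∨ b = y)
    (h1 : dot (n - (value Q c a).toComplex)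
      ((value Q c q).toComplex - (value Q c p).toComplex) = 0)
    (h2 : dot (n - (value Q c b).toComplex)
      ((value Q c y).toComplex - (value Q c z).toComplex) = 0) :
    X ^ 2 / 2 ≤ |((value Q c q).toComplex - (value Q c p).toComplex).re *
      ((value Q c y).toComplex - (value Q c z).toComplex).im -
      ((value Q c q).toComplex - (value Q c p).toComplex).im *
      ((value Q c y).toComplex - (value Q c z).toComplex).re| := by
  rw [linearIndependent_three_iff] at hli
  rcases h (.inr ⟨(q, p), hpq.symm⟩) (.inr ⟨(y, z), hzy.symm⟩) false with ⟨r, hr, hr'⟩ | hd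
  · exfalso
    have hrel : ∀ S, (ev Q y S).toComplex - (ev Q z S).toComplex =
        r * ((ev Q q S).toComplex - (ev Q p S).toComplex) := fun S => by
      simpa [functional] using hr S
    have hrim : r.im = 0 := by
      simpa [turn, dot, GaussianInt.toComplex_def] using hr'
    have hG : (value Q c y).toComplex - (value Q c z).toComplex =
        r * ((value Q c q).toComplex - (value Q c p).toComplex) := by
      simp only [toComplex_value, ← Finset.sum_sub_distrib, Finset.mul_sum]
      refine Finset.sum_congr rfl fun S _ => ?_
      rw [← sub_mul, hrel S]; ring
    have hr0 : r.re ≠ 0 := by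
      intro h0
      have hr00 : r = 0 := Complex.ext h0 hrim
      rcases h (.inr ⟨(y, z), hzy.symm⟩) (.inl z) true with ⟨a, ha, -⟩ | hd
      · have := ha ∅
        simp [functional] at this
      · rw [functional_inr_value, turn, if_pos rfl, one_mul, map_sub, hG, hr00, zero_mul] at hd
        simp [dot] at hd
        nlinarith
    have h3 : dot ((value Q c b).toComplex - (value Q c a).toComplex)
        ((value Q c q).toComplex - (value Q c p).toComplex) = 0 := by
      rw [hG] at h2
      exact dot_eq_zero_of_parallel hrim hr0 h1 h2
    obtain ⟨s, t, hst⟩ : ∃ s t : ℂ, ∀ S, (ev Q b S).toComplex = s * (ev Q p S).toComplex +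
        t * (ev Q q S).toComplex := by
      by_cases hbp : b = p
      · exact ⟨1, 0, fun S => by rw [hbp]; ring⟩
      by_cases hbq : b = q
      · exact ⟨0, 1, fun S => by rw [hbq]; ring⟩
      rcases ha with ⟨rfl, rfl⟩ | ⟨rfl, rfl⟩
      · obtain ⟨u, hu⟩ := h.right hX hpq.symm hbp ((dot_comm _ _).trans h3)
        exact ⟨1 - u, u, fun S => by linear_combination hu S⟩
      · obtain ⟨u, hu⟩ := h.right hX hpq hbq (z := b) (by
          rw [dot_comm]
          simp only [dot, Complex.sub_re, Complex.sub_im] at h3 ⊢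
          linarith)
        exact ⟨u, 1 - u, fun S => by linear_combination hu S⟩
    rcases hb with rfl | rfl
    · exact one_ne_zero (hli (-s) (-t) 1 fun S => by linear_combination hst S).2.2
    · exact one_ne_zero (hli (-s - r) (-t + r) 1 fun S => by
        linear_combination hst S - hrel S).2.2
  · rw [functional_inr_value hpq.symm, functional_inr_value hzy.symm] at hd
    have hi : (turn false).toComplex = Complex.I := by simp [turn, GaussianInt.toComplex_def]
    have hI : ∀ u v : ℂ, dot (Complex.I * u) v = u.re * v.im - u.im * v.re := fun u v => by
      simp only [dot, Complex.I_mul_re, Complex.I_mul_im]; ring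
    rwa [map_mul, map_sub, map_sub, hi, hI] at hd

/-- A lattice point which is a common vertex of two right triangles lies in a fixed box. -/
theorem Gap.mem_gaussBox (hX : 0 < X) (h : Gap Q c X) {ρ : ℝ} (hρ : 1 ≤ ρ) {R : ℕ}
    (hR : 20 * X * ρ ^ 3 ≤ R)
    (hval : ∀ e, ‖(∑ S, functional Q e S * c S).toComplex‖ ≤ 2 * X * ρ)
    {p q z y : Label K} {τ₁ τ₂ : Fin 3} {n : GaussianInt} (hpq : p ≠ q) (hzy : z ≠ y)
    (hli : LinearIndependent ℂ ![fun S => (ev Q p S).toComplex,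
      fun S => (ev Q q S).toComplex, fun S => (ev Q z S).toComplex])
    (h1 : RightAt τ₁ n.toComplex (value Q c p).toComplex (value Q c q).toComplex)
    (h2 : RightAt τ₂ n.toComplex (value Q c z).toComplex (value Q c y).toComplex) :
    n ∈ gaussBox R := by
  have hv : ∀ p : Label K, ‖(value Q c p).toComplex‖ ≤ 2 * X * ρ := fun p => hval (.inl p)
  have hd : ∀ {p q : Label K}, ‖(value Q c p).toComplex - (value Q c q).toComplex‖ ≤
      2 * X * ρ := fun {p q} => by
    by_cases hpq : p = q
    · rw [hpq, sub_self, norm_zero]; positivity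
    · have := hval (.inr ⟨(p, q), hpq⟩)
      rwa [functional_inr_value, map_sub] at this
  have hρ3 : X * ρ ≤ X * ρ ^ 3 := by
    refine mul_le_mul_of_nonneg_left ?_ hX.le
    nlinarith [sq_nonneg (ρ - 1)]
  have right : ∀ {p q : Label K}, dot ((value Q c p).toComplex - n.toComplex)
      ((value Q c q).toComplex - n.toComplex) = 0 → n ∈ gaussBox R := fun h =>
    mem_gaussBox_of_norm_le ((norm_le_of_right_angle (hv _) (hv _) h).trans (by
      have : 0 ≤ X * ρ := by positivity
      nlinarith))
  have lines : ∀ a a' b, ((a = p ∧ a' = q) ∨ (a = q ∧ a' = p)) → (b = z ∨ b = y) →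
      dot (n.toComplex - (value Q c a).toComplex)
        ((value Q c q).toComplex - (value Q c p).toComplex) = 0 →
      dot (n.toComplex - (value Q c b).toComplex)
        ((value Q c y).toComplex - (value Q c z).toComplex) = 0 → n ∈ gaussBox R := by
    intro a a' b ha hb h1 h2
    have hw := h.lines hX hpq hzy hli ha hb h1 h2
    obtain ⟨k1, k2⟩ := abs_re_im_le_of_lines (r := 2 * X * ρ) (t := 16 * X * ρ ^ 3)
      (by positivity) h1 h2 hw hd hd hd (by nlinarith)
    have hre := (Complex.abs_re_le_norm _).trans (hv a)
    have him := (Complex.abs_im_le_norm _).trans (hv a)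
    have hXρ : 0 ≤ X * ρ := by positivity
    refine mem_gaussBox_of_abs_le ?_ ?_
    · have := abs_add_le (n.toComplex - (value Q c a).toComplex).re (value Q c a).toComplex.re
      rw [Complex.sub_re, sub_add_cancel] at this
      rw [Complex.sub_re] at k1
      nlinarith
    · have := abs_add_le (n.toComplex - (value Q c a).toComplex).im (value Q c a).toComplex.im
      rw [Complex.sub_im, sub_add_cancel] at this
      rw [Complex.sub_im] at k2
      nlinarith
  have neg : ∀ u v w : ℂ, dot u (v - w) = 0 → dot u (w - v) = 0 := fun u v w h => by
    simp only [dot, Complex.sub_re, Complex.sub_im] at h ⊢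
    linarith
  fin_cases τ₁
  · exact right h1
  · fin_cases τ₂
    · exact right h2
    · exact lines p q z (Or.inl ⟨rfl, rfl⟩) (Or.inl rfl) h1 h2
    · exact lines p q y (Or.inl ⟨rfl, rfl⟩) (Or.inr rfl) h1 (neg _ _ _ h2)
  · fin_cases τ₂
    · exact right h2
    · exact lines q p z (Or.inr ⟨rfl, rfl⟩) (Or.inl rfl) (neg _ _ _ h1) h2
    · exact lines q p y (Or.inr ⟨rfl, rfl⟩) (Or.inr rfl) (neg _ _ _ h1) (neg _ _ _ h2)

end construction

section construction

variable {K : ℕ} {Q : Fin K → ℤ}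

theorem Gap.generic (hQ : GoodSizes Q) {c : Finset (Fin K) → GaussianInt} {X : ℝ} (hX : 0 < X)
    (h : Gap Q c X) (hc : ∀ S, ∃ f, c S = (if S.card = 1 then 1 else 0) + 15 * f)
    {ρ : ℝ} (hρ : 1 ≤ ρ) {R : ℕ} (hR : 20 * X * ρ ^ 3 ≤ R)
    (hval : ∀ e, ‖(∑ S, functional Q e S * c S).toComplex‖ ≤ 2 * X * ρ)
    (htri : ∀ (p q z y : Label K) (τ₁ τ₂ : Fin 3), ∀ n ∈ gaussBox R,
      LinearIndependent ℂ ![fun S => (ev Q p S).toComplex, fun S => (ev Q q S).toComplex,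
        fun S => (ev Q z S).toComplex] →
      RightAt τ₁ n.toComplex (value Q c p).toComplex (value Q c q).toComplex →
      RightAt τ₂ n.toComplex (value Q c z).toComplex (value Q c y).toComplex →
      n ≠ value Q c y →
      ∃ β γ δ : ℂ, (∀ S, (ev Q y S).toComplex = β * (ev Q z S).toComplex +
          γ * (ev Q p S).toComplex + δ * (ev Q q S).toComplex) ∧
        (value Q c y).toComplex - n.toComplex = β * ((value Q c z).toComplex - n.toComplex)) :
    Generic Q c where
  sizes := hQ
  coeff := hc
  inj := h.inj hQ hX
  right _ _ _ hq hz hd := h.right hX hq hz hd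
  triangles p q z y τ₁ τ₂ n hpq hzy hli h1 h2 hne :=
    htri p q z y τ₁ τ₂ n (h.mem_gaussBox hX hρ hR hval hpq hzy hli h1 h2) hli h1 h2 hne

/-- Generic coefficients exist close to a dilate by `X = 15 X'` of any prescribed coefficients
`b`: a perturbation of size `B` before the dilation provides the gap, a perturbation of size `M`
after the dilation excludes the accidental right triangles. -/
theorem exists_generic (hQ : GoodSizes Q) (V β B ρ M X' R : ℕ)
    (b : Finset (Fin K) → GaussianInt)
    (hV : ∀ p : Label K, 2 * ∑ S, ‖(ev Q p S).toComplex‖ ≤ V)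
    (hb : ∀ S, ‖(b S).toComplex‖ ≤ β) (hρ1 : 1 ≤ ρ) (hρ : V * (β + 2 * B) ≤ ρ)
    (h1 : 2 * (2 * 16 ^ K) ^ 2 + 1 ≤ (2 * B + 1) ^ 2)
    (h2 : (120 * ρ ^ 2 * (1 + Real.log ρ)) * (2 * (2 * 16 ^ K) ^ 2 + 1 : ℕ) ≤
      ((2 * B + 1 : ℕ) : ℝ) ^ 4)
    (hM : 1 ≤ M) (hV1 : 1 ≤ V) (hX : 8 * ρ * (31 * V * M) ≤ 15 * X')
    (hR : 20 * (15 * X') * ρ ^ 3 ≤ R)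
    (hcount : ((2 * R + 1) ^ 2 * (480 * R ^ 2 * (1 + Real.log (2 * R)))) *
      (2 * (2 * R + 1) * (2 * R + 1) ^ 2 * (9 * (4 ^ K) ^ 4 + 1) : ℕ) ≤
      ((2 * M + 1 : ℕ) : ℝ) ^ 8) :
    ∃ c : Finset (Fin K) → GaussianInt, Generic Q c ∧ Gap Q c (15 * X') ∧
      (∀ p, ‖(value Q c p).toComplex‖ ≤ 2 * (15 * X') * ρ) ∧
      ∀ p, ‖(value Q c p).toComplex - (15 * X') * (∑ S, ev Q p S * b S).toComplex‖ ≤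
        (15 * X') * (V * (2 * B)) + 31 * V * M := by
  have hXpos : (0 : ℝ) < 15 * X' := by
    have : 0 < 8 * ρ * (31 * V * M) := by positivity
    have : 0 < 15 * X' := by omega
    exact_mod_cast this
  have hX' : (8 : ℝ) * ρ * (31 * V * M) ≤ 15 * X' := by exact_mod_cast hX
  have hρ1' : (1 : ℝ) ≤ ρ := by exact_mod_cast hρ1
  have hV1' : (1 : ℝ) ≤ V := by exact_mod_cast hV1
  have hM1' : (1 : ℝ) ≤ M := by exact_mod_cast hM
  have hρ' : (V : ℝ) * (β + 2 * B) ≤ ρ := by exact_mod_cast hρ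
  have hR' : (20 : ℝ) * (15 * X') * ρ ^ 3 ≤ R := by exact_mod_cast hR
  have hcard := card_functionalIndex_le (K := K)
  have hcard2 : 2 * Fintype.card (FunctionalIndex K) ^ 2 + 1 ≤ 2 * (2 * 16 ^ K) ^ 2 + 1 := by
    gcongr
  have hbox : ∀ {B' : ℕ} {h : Finset (Fin K) → GaussianInt},
      (h ∈ Fintype.piFinset fun _ : Finset (Fin K) => gaussBox B') →
      ∀ S, ‖(h S).toComplex‖ ≤ 2 * B' := fun hh S =>
    norm_le_of_mem_gaussBox (Fintype.mem_piFinset.1 hh S)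
  have hA : ∀ e, ∀ h ∈ Fintype.piFinset fun _ : Finset (Fin K) => gaussBox B,
      ‖(∑ S, functional Q e S * (b S + h S)).toComplex‖ ≤ ρ := by
    intro e h hh
    refine (functional_sum_bound hV (r := β + 2 * B) (by positivity) e _ fun S => ?_).trans hρ'
    rw [map_add]
    exact (norm_add_le _ _).trans (add_le_add (hb S) (hbox hh S))
  obtain ⟨h, hh, hgen⟩ := exists_generic_directions (functional Q) hQ.functional_ne_zero b B ρ hρ1
    (fun e h hh => mem_gaussBox_of_norm_le (hA e h hh)) (hcard2.trans h1)
    (le_trans (mul_le_mul_of_nonneg_left (Nat.cast_le.2 hcard2) (by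
      have := Real.log_nonneg hρ1'
      positivity)) h2)
  set a : Finset (Fin K) → GaussianInt := fun S =>
    (15 * X' : ℕ) * (b S + h S) + (if S.card = 1 then 1 else 0) with ha
  have hsplit : ∀ e (g : Finset (Fin K) → GaussianInt),
      (∑ S, functional Q e S * (a S + 15 * g S)).toComplex =
      ((15 * X' : ℝ) : ℂ) * (∑ S, functional Q e S * (b S + h S)).toComplex +
        (∑ S, functional Q e S * ((if S.card = 1 then 1 else 0) + 15 * g S)).toComplex := by
    intro e g
    have : ∑ S, functional Q e S * (a S + 15 * g S) =
        (15 * X' : ℕ) * (∑ S, functional Q e S * (b S + h S)) +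
        ∑ S, functional Q e S * ((if S.card = 1 then 1 else 0) + 15 * g S) := by
      rw [Finset.mul_sum, ← Finset.sum_add_distrib]
      refine Finset.sum_congr rfl fun S _ => ?_
      rw [ha]; ring
    rw [this, map_add, map_mul, map_natCast]
    push_cast
    ring
  have hD : ∀ e, ∀ g ∈ Fintype.piFinset fun _ : Finset (Fin K) => gaussBox M,
      ‖(∑ S, functional Q e S * ((if S.card = 1 then 1 else 0) + 15 * g S)).toComplex‖ ≤
        31 * V * M := by
    intro e g hg
    refine (functional_sum_bound hV (r := 31 * M) (by positivity) e _ fun S => ?_).trans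
      (le_of_eq (by ring))
    rw [map_add, map_mul]
    refine (norm_add_le _ _).trans ?_
    have e1 : ‖((if S.card = 1 then 1 else 0 : GaussianInt)).toComplex‖ ≤ 1 := by
      split_ifs <;> simp
    have e2 : ‖(15 : GaussianInt).toComplex * (g S).toComplex‖ ≤ 15 * (2 * M) := by
      rw [norm_mul, map_ofNat]
      have : ‖(OfNat.ofNat 15 : ℂ)‖ = 15 := by simp
      rw [this]
      exact mul_le_mul_of_nonneg_left (hbox hg S) (by norm_num)
    linarith
  have hVM : (31 : ℝ) * V * M ≤ 15 * X' := by
    have : 0 ≤ (31 : ℝ) * V * M := by positivity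
    nlinarith
  have hval : ∀ e, ∀ g ∈ Fintype.piFinset fun _ : Finset (Fin K) => gaussBox M,
      ‖(∑ S, functional Q e S * (a S + 15 * g S)).toComplex‖ ≤ 2 * (15 * X') * ρ := by
    intro e g hg
    rw [hsplit]
    refine (norm_add_le _ _).trans ?_
    rw [norm_mul, Complex.norm_real, Real.norm_of_nonneg hXpos.le]
    have t1 := mul_le_mul_of_nonneg_left (hA e h hh) hXpos.le
    have t2 := hD e g hg
    have t3 : 15 * (X' : ℝ) ≤ 15 * X' * ρ := le_mul_of_one_le_right hXpos.le hρ1'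
    linarith
  have hMR : 2 * (15 * (X' : ℝ)) * ρ ≤ R := by
    refine le_trans ?_ hR'
    have t1 : (15 * (X' : ℝ)) * ρ ≤ 15 * X' * ρ ^ 3 := by
      refine mul_le_mul_of_nonneg_left ?_ hXpos.le
      nlinarith [sq_nonneg ((ρ : ℝ) - 1)]
    have t2 : 0 ≤ (15 * (X' : ℝ)) * ρ := by positivity
    linarith
  have hMR' : M ≤ R := by
    have : (M : ℝ) ≤ R := by
      refine le_trans ?_ hMR
      nlinarith
    exact_mod_cast this
  obtain ⟨g, hg, htri⟩ := exists_generic_right_angles (ev Q) a M R (hM.trans hMR') hMR'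
    (fun p g hg => mem_gaussBox_of_norm_le ((hval (.inl p) g hg).trans hMR))
    (by simpa using hcount)
  refine ⟨fun S => a S + 15 * g S, ?_⟩
  have hgap : Gap Q (fun S => a S + 15 * g S) (15 * X') := by
    intro e e' k
    rcases hgen e e' k with hdeg | hne
    · exact Or.inl hdeg
    · refine Or.inr ?_
      rw [map_mul, hsplit, hsplit, mul_add, mul_left_comm]
      refine le_abs_dot_of_perturbation hρ1' (by positivity) hX' ?_ ?_ (hA e' h hh) ?_ (hD e' g hg)
      · rw [← map_mul]
        rw [dot_toComplex] at hne ⊢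
        rw [← Int.cast_abs]
        have := Int.one_le_abs (Int.cast_ne_zero.1 hne)
        exact_mod_cast this
      · rw [norm_mul, norm_turn, one_mul]; exact hA e h hh
      · rw [norm_mul, norm_turn, one_mul]; exact hD e g hg
  refine ⟨hgap.generic hQ hXpos (fun S => ⟨X' * (b S + h S) + g S, ?_⟩) hρ1' hR'
    (fun e => hval e g hg) htri, hgap, fun p => hval (.inl p) g hg, fun p => ?_⟩
  · simp only [ha]
    push_cast
    ring
  · have h3 : (∑ S, functional Q (.inl p) S * (b S + h S)).toComplex =
        (∑ S, ev Q p S * b S).toComplex + (∑ S, functional Q (.inl p) S * h S).toComplex := by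
      rw [← map_add, ← Finset.sum_add_distrib]
      congr 1
      exact Finset.sum_congr rfl fun S _ => by simp only [functional]; ring
    have h4 := functional_sum_bound hV (r := 2 * B) (by positivity) (.inl p) h (hbox hh)
    have h5 : (value Q (fun S => a S + 15 * g S) p).toComplex = _ := hsplit (.inl p) g
    rw [h5, h3]
    push_cast
    rw [show ∀ x y z w : ℂ, x * (y + z) + w - x * y = x * z + w from fun x y z w => by ring]
    refine (norm_add_le _ _).trans (add_le_add ?_ (hD _ g hg))
    rw [norm_mul]
    refine mul_le_mul (le_of_eq ?_) h4 (norm_nonneg _) hXpos.le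
    have : (15 * (X' : ℂ)) = ((15 * X' : ℝ) : ℂ) := by push_cast; rfl
    rw [this, Complex.norm_real, Real.norm_of_nonneg hXpos.le]

end construction

section parameters

variable {K : ℕ} {Q : Fin K → ℤ}

/-- The label selecting the vertex `Q + i (Q + 1)` everywhere. -/
def topLabel (K : ℕ) : Label K := fun _ => (true, true)

/-- The prototype of the configuration: a product of factors, one for each rectangle, which
vanish at the vertex `-Q - i (Q + 1)` and are largest at the opposite vertex. -/
def proto (Q : Fin K → ℤ) (p : Label K) : GaussianInt :=
  ∏ k, (corner Q p k + corner Q (topLabel K) k)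

theorem proto_eq_sum (p : Label K) : proto Q p = ∑ S, ev Q p S * ev Q (topLabel K) Sᶜ := by
  rw [proto, Finset.prod_add, Finset.powerset_univ]
  refine Finset.sum_congr rfl fun S _ => ?_
  rw [ev, ev, mon, mon, ← Finset.compl_eq_univ_sdiff]

theorem norm_corner_le {L : ℕ} (hQ : GoodSizes Q) (hL : ∀ k, Q k + 1 ≤ L) (p : Label K)
    (k : Fin K) : ‖(corner Q p k).toComplex‖ ≤ 2 * L := by
  refine norm_le_of_mem_gaussBox ?_
  have h1 := hL k
  have h2 := hQ.five_le k
  rw [mem_gaussBox]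
  generalize p k = v at *
  rw [corner, vtx]
  rcases p k with ⟨_ | _, _ | _⟩ <;> simp [bsign] <;> omega

theorem norm_ev_le {L : ℕ} (hL1 : 1 ≤ L) (hQ : GoodSizes Q) (hL : ∀ k, Q k + 1 ≤ L) (p : Label K)
    (S : Finset (Fin K)) : ‖(ev Q p S).toComplex‖ ≤ (2 * L) ^ K := by
  rw [toComplex_ev, mon, norm_prod]
  have hL1' : (1 : ℝ) ≤ 2 * L := by
    have : (1 : ℝ) ≤ L := by exact_mod_cast hL1
    linarith
  calc ∏ k ∈ S, ‖(corner Q p k).toComplex‖ ≤ ∏ _k ∈ S, (2 * L : ℝ) :=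
        Finset.prod_le_prod (fun _ _ => norm_nonneg _) fun k _ => norm_corner_le hQ hL p k
    _ = (2 * L : ℝ) ^ S.card := by rw [Finset.prod_const]
    _ ≤ (2 * L : ℝ) ^ K := pow_le_pow_right₀ hL1' (by simpa using Finset.card_le_univ S)

set_option maxHeartbeats 1000000 in
/-- Generic configurations exist close to dilates of the prototype, with all parameters bounded
by a power of `H` times the prescribed scale `M₀`. -/
theorem exists_generic_near_proto (hQ : GoodSizes Q) {L N M₀ H : ℕ} (hL : ∀ k, Q k + 1 ≤ L)
    (hL1 : 1 ≤ L) (hN : 1 ≤ N) (hM₀ : 1 ≤ M₀) (hH : 2 * (16 * L) ^ K ≤ H) (hNH : N ≤ H)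
    (hH100 : 100 ≤ H) :
    ∃ (c : Finset (Fin K) → GaussianInt) (X Y ρ : ℝ), 1 ≤ ρ ∧ 0 < Y ∧ 3720 * ρ * M₀ ≤ X ∧
      Generic Q c ∧ Gap Q c X ∧ (∀ p, ‖(value Q c p).toComplex‖ ≤ 2 * X * ρ) ∧
      2 * X * ρ ≤ (H : ℝ) ^ 1710 * M₀ ^ 2 ∧
      ∀ p, ‖(value Q c p).toComplex - X * Y * (proto Q p).toComplex‖ ≤ X * Y / N := by
  have hH1 : 1 ≤ H := by omega
  have h16 : 16 ^ K ≤ H := by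
    refine le_trans ?_ hH
    have : 16 ^ K ≤ (16 * L) ^ K := Nat.pow_le_pow_left (by omega) K
    omega
  -- `B` is the size of the perturbation that removes right angles and `ρ` bounds the values it
  -- yields; `m ^ 2` is the size of the second perturbation, after the dilation, and `Γ m ^ 2` bounds
  -- the final values; `Y` dilates the prototype so that the perturbations are relatively small
  set J := 5 * H ^ 3 * N with hJ
  set B := 1080 * J ^ 3 * H ^ 2 with hB
  set ρ := J * B with hρ
  set Γ := 74400 * ρ ^ 4 * H with hΓ
  set m := 36450 * Γ ^ 8 * H ^ 2 * M₀ with hm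
  set Y := 3 * H * N * B with hY
  clear_value Y m Γ ρ B J
  have hJ1 : 1 ≤ J := by rw [hJ]; exact Nat.one_le_iff_ne_zero.2 (by positivity)
  have hB1 : 1 ≤ B := by rw [hB]; exact Nat.one_le_iff_ne_zero.2 (by positivity)
  have hρ1 : 1 ≤ ρ := by rw [hρ]; exact Nat.one_le_iff_ne_zero.2 (by positivity)
  have hΓ1 : 1 ≤ Γ := by rw [hΓ]; exact Nat.one_le_iff_ne_zero.2 (by positivity)
  have hm1 : 1 ≤ m := by rw [hm]; exact Nat.one_le_iff_ne_zero.2 (by positivity)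
  have cH1 : (1 : ℝ) ≤ H := by exact_mod_cast hH1
  have cN : (1 : ℝ) ≤ N := by exact_mod_cast hN
  have cB1 : (1 : ℝ) ≤ B := by exact_mod_cast hB1
  have cρ1 : (1 : ℝ) ≤ ρ := by exact_mod_cast hρ1
  have cΓ1 : (1 : ℝ) ≤ Γ := by exact_mod_cast hΓ1
  have cm1 : (1 : ℝ) ≤ m := by exact_mod_cast hm1
  have cM₀ : (1 : ℝ) ≤ M₀ := by exact_mod_cast hM₀
  have hU : ∀ (p : Label K) S, ‖(ev Q p S).toComplex‖ ≤ (2 * L) ^ K := norm_ev_le hL1 hQ hL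
  have hH' : (2 : ℝ) * (16 * L) ^ K ≤ H := by exact_mod_cast hH
  have hUH : (2 * L : ℝ) ^ K ≤ H := by
    have : (2 * L : ℝ) ^ K ≤ (16 * L) ^ K := by gcongr; norm_num
    have h0 : (0 : ℝ) ≤ (16 * L) ^ K := by positivity
    linarith
  -- the parameter `V` of the construction is `H`
  have hV : ∀ p : Label K, 2 * ∑ S, ‖(ev Q p S).toComplex‖ ≤ (H : ℕ) := fun p => by
    have h1 : ∑ S, ‖(ev Q p S).toComplex‖ ≤ ∑ _S : Finset (Fin K), (2 * L : ℝ) ^ K :=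
      Finset.sum_le_sum fun S _ => hU p S
    rw [Finset.sum_const, Finset.card_univ, Fintype.card_finset, Fintype.card_fin, nsmul_eq_mul,
      Nat.cast_pow, ← mul_pow] at h1
    have : (((2 : ℕ) : ℝ) * (2 * L)) ^ K ≤ (16 * L) ^ K := by
      refine pow_le_pow_left₀ (by positivity) ?_ K
      push_cast
      have : (0 : ℝ) ≤ L := by positivity
      linarith
    linarith
  have hY' : Y * H + 2 * B ≤ 5 * H ^ 2 * N * B := by
    have : 2 * B ≤ 2 * (H ^ 2 * N * B) := by
      have : 1 ≤ H ^ 2 * N := Nat.one_le_iff_ne_zero.2 (by positivity)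
      nlinarith
    have h2 : Y * H = 3 * (H ^ 2 * N * B) := by rw [hY]; ring
    have h3 : 5 * H ^ 2 * N * B = 5 * (H ^ 2 * N * B) := by ring
    omega
  have hlogρ : 1 + Real.log ρ ≤ ρ := by
    have := Real.log_le_sub_one_of_pos (x := (ρ : ℝ)) (by linarith)
    linarith
  have hcard : 2 * (2 * 16 ^ K) ^ 2 + 1 ≤ 9 * H ^ 2 := by
    have h1 : (2 * 16 ^ K) ^ 2 ≤ (2 * H) ^ 2 := Nat.pow_le_pow_left (by omega) 2
    have h2 : (2 * H) ^ 2 = 4 * H ^ 2 := by ring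
    have h3 : 1 ≤ H ^ 2 := Nat.one_le_pow _ _ hH1
    omega
  have hBH : 1080 * H ^ 2 ≤ B := by
    rw [hB]
    have : 1 ≤ J ^ 3 := Nat.one_le_pow _ _ hJ1
    nlinarith [Nat.zero_le (H ^ 2)]
  have key := exists_generic hQ H (Y * H) B ρ (m ^ 2) (8 * ρ * 31 * H * m ^ 2) (Γ * m ^ 2)
    (fun S => (Y : GaussianInt) * ev Q (topLabel K) Sᶜ) hV
  replace key := key (by
    intro S
    rw [map_mul, norm_mul, map_natCast, Complex.norm_natCast]
    push_cast
    exact mul_le_mul_of_nonneg_left ((hU _ _).trans hUH) (Nat.cast_nonneg _)) hρ1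
  replace key := key (by
    refine (Nat.mul_le_mul_left H hY').trans (le_of_eq ?_)
    rw [hρ, hJ]; ring)
  replace key := key (by
    have h1 : 9 * H ^ 2 ≤ B := by omega
    nlinarith)
  replace key := key (by
    have h1 : ((2 * (2 * 16 ^ K) ^ 2 + 1 : ℕ) : ℝ) ≤ 9 * H ^ 2 := by exact_mod_cast hcard
    have e1 : (B : ℝ) = 1080 * J ^ 3 * H ^ 2 := by rw [hB]; push_cast; ring
    have e2 : (ρ : ℝ) = J * B := by rw [hρ]; push_cast; ring
    have h0 := Real.log_nonneg cρ1
    calc (120 * (ρ : ℝ) ^ 2 * (1 + Real.log ρ)) * (2 * (2 * 16 ^ K) ^ 2 + 1 : ℕ)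
        ≤ (120 * (ρ : ℝ) ^ 2 * ρ) * (9 * H ^ 2) := by gcongr
      _ = (1080 * J ^ 3 * H ^ 2) * (B : ℝ) ^ 3 := by rw [e2]; ring
      _ = (B : ℝ) ^ 4 := by rw [← e1]; ring
      _ ≤ _ := by
        push_cast
        gcongr
        linarith)
  replace key := key (by
    exact Nat.one_le_pow _ _ hm1) hH1
  replace key := key (by
    have : 8 * ρ * (31 * H * m ^ 2) = 8 * ρ * 31 * H * m ^ 2 := by ring
    omega)
  replace key := key (by
    rw [hΓ]
    exact le_of_eq (by ring))
  replace key := key (by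
    have hR1 : (1 : ℝ) ≤ Γ * m ^ 2 := by nlinarith [one_le_pow₀ cm1 (n := 2)]
    have hlog : 1 + Real.log (2 * (Γ * m ^ 2)) ≤ 4 * Γ * m := by
      rw [show (2 : ℝ) * (Γ * m ^ 2) = (2 * Γ) * m ^ 2 by ring, Real.log_mul (by positivity)
        (by positivity), Real.log_pow]
      have l1 := Real.log_le_sub_one_of_pos (x := 2 * (Γ : ℝ)) (by positivity)
      have l2 := Real.log_le_sub_one_of_pos (x := (m : ℝ)) (by positivity)
      push_cast
      nlinarith
    have h4 : 9 * (4 ^ K) ^ 4 + 1 ≤ 10 * H ^ 2 := by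
      have e : (4 ^ K) ^ 4 = (16 ^ K) ^ 2 := by
        rw [← pow_mul, ← pow_mul, show 16 = 4 ^ 2 from rfl, ← pow_mul]; congr 1; ring
      have : (16 ^ K) ^ 2 ≤ H ^ 2 := Nat.pow_le_pow_left h16 2
      have h3 : 1 ≤ H ^ 2 := Nat.one_le_pow _ _ hH1
      omega
    have h4' : (9 * ((4 : ℝ) ^ K) ^ 4 + 1) ≤ 10 * H ^ 2 := by exact_mod_cast h4
    have em : (36450 : ℝ) * Γ ^ 8 * H ^ 2 ≤ m := by
      rw [hm]
      push_cast
      exact le_mul_of_one_le_right (by positivity) cM₀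
    push_cast
    set R : ℝ := Γ * (m : ℝ) ^ 2 with hR
    clear_value R
    have hlog0 : 0 ≤ 1 + Real.log (2 * R) := by
      have := Real.log_nonneg (x := 2 * R) (by linarith)
      linarith
    have h3R : 2 * R + 1 ≤ 3 * R := by linarith
    calc (2 * R + 1) ^ 2 * (480 * R ^ 2 * (1 + Real.log (2 * R))) *
          (2 * (2 * R + 1) * (2 * R + 1) ^ 2 * (9 * ((4 : ℝ) ^ K) ^ 4 + 1))
        ≤ (3 * R) ^ 2 * (480 * R ^ 2 * (4 * Γ * m)) * (2 * (3 * R) * (3 * R) ^ 2 * (10 * H ^ 2)) := by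
          gcongr
      _ = 256 * (m : ℝ) ^ 15 * (36450 * Γ ^ 8 * H ^ 2) := by rw [hR]; ring
      _ ≤ 256 * (m : ℝ) ^ 15 * m := by gcongr
      _ = (2 * (m : ℝ) ^ 2) ^ 8 := by ring
      _ ≤ _ := by gcongr; linarith)
  obtain ⟨c, hc, hgap, hval, hnear⟩ := key
  have e1 : (15 * ((8 * ρ * 31 * H * m ^ 2 : ℕ) : ℝ)) = 3720 * ρ * H * (m : ℝ) ^ 2 := by
    push_cast; ring
  have e1c : (15 * ((8 * ρ * 31 * H * m ^ 2 : ℕ) : ℂ)) = ((3720 * ρ * H * (m : ℝ) ^ 2 : ℝ) : ℂ) := by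
    push_cast; ring
  rw [e1] at hgap hval
  simp only [e1, e1c] at hnear
  set X : ℝ := 3720 * ρ * H * (m : ℝ) ^ 2 with hX
  clear_value X
  have hmM : (M₀ : ℝ) ≤ m := by
    have : M₀ ≤ m := by
      rw [hm]
      exact Nat.le_mul_of_pos_left _ (by positivity)
    exact_mod_cast this
  have hm2 : (m : ℝ) ≤ (m : ℝ) ^ 2 := le_self_pow₀ cm1 two_ne_zero
  have hX0 : 0 < X := by rw [hX]; positivity
  refine ⟨c, X, Y, ρ, cρ1, ?_, ?_, hc, hgap, hval, ?_, fun p => ?_⟩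
  · rw [hY]; positivity
  · rw [hX]
    have : (M₀ : ℝ) ≤ H * (m : ℝ) ^ 2 :=
      (hmM.trans hm2).trans (le_mul_of_one_le_left (by positivity) cH1)
    calc 3720 * (ρ : ℝ) * M₀ ≤ 3720 * ρ * (H * (m : ℝ) ^ 2) := by gcongr
      _ = _ := by ring
  · -- every parameter is bounded by a power of `H`
    have n100 : ∀ {a j : ℕ}, a ≤ 100 ^ j → a ≤ H ^ j := fun h =>
      h.trans (Nat.pow_le_pow_left hH100 _)
    have bJ : J ≤ H ^ 5 := by
      calc J ≤ H ^ 1 * H ^ 3 * H := by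
            rw [hJ]; gcongr; exact n100 (by norm_num)
        _ = H ^ 5 := by ring
    have bB : B ≤ H ^ 19 := by
      calc B ≤ H ^ 2 * (H ^ 5) ^ 3 * H ^ 2 := by
            rw [hB]; gcongr; exact n100 (by norm_num)
        _ = H ^ 19 := by ring
    have bρ : ρ ≤ H ^ 24 := by
      calc ρ ≤ H ^ 5 * H ^ 19 := by rw [hρ]; gcongr
        _ = H ^ 24 := by ring
    have bΓ : Γ ≤ H ^ 100 := by
      calc Γ ≤ H ^ 3 * (H ^ 24) ^ 4 * H := by
            rw [hΓ]; gcongr; exact n100 (by norm_num)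
        _ = H ^ 100 := by ring
    have bm : m ≤ H ^ 805 * M₀ := by
      calc m ≤ H ^ 3 * (H ^ 100) ^ 8 * H ^ 2 * M₀ := by
            rw [hm]; gcongr; exact n100 (by norm_num)
        _ = H ^ 805 * M₀ := by ring
    have bR : Γ * m ^ 2 ≤ H ^ 1710 * M₀ ^ 2 := by
      calc Γ * m ^ 2 ≤ H ^ 100 * (H ^ 805 * M₀) ^ 2 := by gcongr
        _ = H ^ 1710 * M₀ ^ 2 := by ring
    have bX : 2 * X * ρ ≤ Γ * (m : ℝ) ^ 2 := by
      rw [hX, hΓ]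
      push_cast
      have : (ρ : ℝ) ^ 2 ≤ (ρ : ℝ) ^ 4 := pow_le_pow_right₀ cρ1 (by norm_num)
      have h0 : (0 : ℝ) ≤ H * (m : ℝ) ^ 2 := by positivity
      calc 2 * (3720 * (ρ : ℝ) * H * m ^ 2) * ρ = 7440 * (ρ : ℝ) ^ 2 * (H * (m : ℝ) ^ 2) := by ring
        _ ≤ 74400 * (ρ : ℝ) ^ 4 * (H * (m : ℝ) ^ 2) := by
          gcongr
          norm_num
        _ = _ := by ring
    refine bX.trans ?_
    exact_mod_cast bR
  · have h1 : (∑ S, ev Q p S * ((Y : GaussianInt) * ev Q (topLabel K) Sᶜ)).toComplex =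
        (Y : ℂ) * (proto Q p).toComplex := by
      rw [proto_eq_sum, ← map_natCast GaussianInt.toComplex, ← map_mul, Finset.mul_sum]
      congr 1
      exact Finset.sum_congr rfl fun S _ => by ring
    have h2 := hnear p
    rw [h1, ← mul_assoc] at h2
    push_cast at h2 ⊢
    refine h2.trans ?_
    have eY : (Y : ℝ) / N = 3 * H * B := by
      rw [hY]; push_cast; field_simp
    rw [mul_div_assoc, eY]
    have h3 : 31 * H * (m : ℝ) ^ 2 ≤ X := by
      rw [hX]
      have : 0 ≤ H * (m : ℝ) ^ 2 := by positivity
      nlinarith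
    have h4 : X ≤ X * (H * B) := le_mul_of_one_le_right hX0.le (by nlinarith)
    linarith
end parameters

/-! ### Separation from the low modes -/

section separation

variable {K : ℕ} {Q : Fin K → ℤ} {c : Finset (Fin K) → GaussianInt} {X ρ M κ₀ : ℝ}

theorem Gap.le_norm_value (h : Gap Q c X) (p : Label K) : X / 2 ≤ ‖(value Q c p).toComplex‖ := by
  have h1 := (h.le_abs_dot p p).trans (abs_dot_le _ _)
  nlinarith [norm_nonneg (value Q c p).toComplex]

theorem norm_ofMode_le {m : Mode} (hm : m ∈ lowModes κ₀) (hκ : κ₀ ≤ M) :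
    ‖(ofMode m).toComplex‖ ≤ M := by
  rw [← modeNorm_eq]
  exact le_of_lt (lt_of_lt_of_le hm hκ)

theorem Gap.toMode_value_not_mem_lowModes (h : Gap Q c X) (hM : 1 ≤ M) (hρ : 1 ≤ ρ) (hκ : κ₀ ≤ M)
    (hX : 3720 * ρ * M ≤ X) (p : Label K) : toMode (value Q c p) ∉ lowModes κ₀ := by
  intro hp
  have h1 := norm_ofMode_le hp hκ
  have h2 := h.le_norm_value p
  rw [ofMode_toMode] at h1
  nlinarith

theorem Gap.far (h : Gap Q c X) (hM : 1 ≤ M) (hρ : 1 ≤ ρ) (hκ : κ₀ ≤ M)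
    (hX : 3720 * ρ * M ≤ X) (hval : ∀ p, ‖(value Q c p).toComplex‖ ≤ 2 * X * ρ) (p q : Label K)
    {m : Mode} (hm : m ∈ lowModes κ₀) :
    M < 2 * |dot ((value Q c p).toComplex - (ofMode m).toComplex)
      ((value Q c q).toComplex - (ofMode m).toComplex)| := by
  have h0 := norm_ofMode_le hm hκ
  have h1 := h.le_abs_dot p q
  have hp := hval p
  have hq := hval q
  set u := (value Q c p).toComplex
  set w := (value Q c q).toComplex
  set z := (ofMode m).toComplex
  have e : dot u w = dot (u - z) (w - z) + dot u z + dot z w - dot z z := by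
    simp only [dot, Complex.sub_re, Complex.sub_im]; ring
  have a1 := (abs_dot_le u z).trans (mul_le_mul hp h0 (norm_nonneg _) ((norm_nonneg _).trans hp))
  have a2 := (abs_dot_le z w).trans
    (mul_le_mul h0 hq (norm_nonneg _) ((norm_nonneg _).trans h0))
  have a3 := (abs_dot_le z z).trans
    (mul_le_mul h0 h0 (norm_nonneg _) ((norm_nonneg _).trans h0))
  have b1 := abs_sub (dot (u - z) (w - z) + dot u z + dot z w) (dot z z)
  have b2 := abs_add_le (dot (u - z) (w - z) + dot u z) (dot z w)
  have b3 := abs_add_le (dot (u - z) (w - z)) (dot u z)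
  rw [e] at h1
  have hρM : M ≤ ρ * M := le_mul_of_one_le_left (by linarith) hρ
  have hXM : 3720 * M ≤ X := by linarith
  have c1 : 3720 * (X * ρ * M) ≤ X ^ 2 := by nlinarith
  have c2 : 3720 * (M * M) ≤ X * M := by nlinarith
  have c3 : 3720 * (X * M) ≤ X ^ 2 := by nlinarith
  nlinarith

theorem Gap.far_sub (h : Gap Q c X) (hM : 1 ≤ M) (hρ : 1 ≤ ρ) (hκ : κ₀ ≤ M)
    (hX : 3720 * ρ * M ≤ X) (hval : ∀ p, ‖(value Q c p).toComplex‖ ≤ 2 * X * ρ) {p q : Label K}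
    {m : Mode} (hm : m ∈ lowModes κ₀) (hpq : p ≠ q) :
    M < 2 * |dot ((value Q c p).toComplex - (value Q c q).toComplex)
      ((ofMode m).toComplex - (value Q c q).toComplex)| := by
  have h0 := norm_ofMode_le hm hκ
  have h1 := h.le_abs_dot_sub hpq
  have hp := hval p
  have hq := hval q
  set u := (value Q c p).toComplex
  set w := (value Q c q).toComplex
  set z := (ofMode m).toComplex
  have e : dot (u - w) w = dot (u - w) z - dot (u - w) (z - w) := by
    simp only [dot, Complex.sub_re, Complex.sub_im]; ring
  have hpq := (norm_sub_le u w).trans (add_le_add hp hq)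
  have a1 := (abs_dot_le (u - w) z).trans
    (mul_le_mul hpq h0 (norm_nonneg _) ((norm_nonneg _).trans hpq))
  have b1 := abs_sub (dot (u - w) z) (dot (u - w) (z - w))
  rw [e] at h1
  have hρM : M ≤ ρ * M := le_mul_of_one_le_left (by linarith) hρ
  have hXM : 3720 * M ≤ X := by linarith
  have c1 : 3720 * (X * ρ * M) ≤ X ^ 2 := by nlinarith
  have c3 : 3720 * (X * M) ≤ X ^ 2 := by nlinarith
  nlinarith

/-- The Fourier coefficients of a function in a Sobolev space are bounded. -/
theorem MemSobolev.exists_abs_potCoeff_le {s₀ : ℝ} (hs₀ : 0 < s₀) {V : UnitAddTorus (Fin 2) → ℂ}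
    (hV : MemSobolev s₀ V) : ∃ C, ∀ n, |potCoeff V n| ≤ C := by
  refine ⟨1 + ∑' n : Mode, Real.sqrt (1 + modeNorm n ^ 2) ^ (2 * s₀) *
    ‖UnitAddTorus.mFourierCoeff V n‖ ^ 2, fun n => ?_⟩
  have h1 := hV.2.le_tsum n fun m _ => by positivity
  have h2 : 1 ≤ Real.sqrt (1 + modeNorm n ^ 2) ^ (2 * s₀) := by
    refine Real.one_le_rpow (Real.one_le_sqrt.2 ?_) (by positivity)
    nlinarith [sq_nonneg (modeNorm n)]
  have h3 : |potCoeff V n| ≤ ‖UnitAddTorus.mFourierCoeff V n‖ := Complex.abs_re_le_norm _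
  nlinarith [sq_nonneg (‖UnitAddTorus.mFourierCoeff V n‖ - 1),
    sq_nonneg (‖UnitAddTorus.mFourierCoeff V n‖)]

end separation

section low

variable {K : ℕ} {Q : Fin K → ℤ} {c : Finset (Fin K) → GaussianInt} {X ρ M κ₀ η C : ℝ}

theorem Gap.not_mem_tuples₀ (h : Gap Q c X) (hM : 1 ≤ M) (hρ : 1 ≤ ρ) (hκ : κ₀ ≤ M)
    (hX : 3720 * ρ * M ≤ X) (hval : ∀ p, ‖(value Q c p).toComplex‖ ≤ 2 * X * ρ)
    {v : Mode → ℝ} (hv : ∀ n, |v n| ≤ C) (hC : η + 4 * C ≤ M)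
    {t : Fin 4 → Mode} (ht : t ∈ tuples₀ v κ₀ η) {i j : Fin 4} (hij : i ≠ j)
    (hi : t i ∈ unionGen (K + 1) (generation Q c)) (hj : t j ∈ unionGen (K + 1) (generation Q c)) :
    False :=
  _root_.not_mem_tuples₀ hv (h.toMode_value_not_mem_lowModes hM hρ hκ hX)
    (fun p q _ hm => hC.trans_lt (h.far hM hρ hκ hX hval p q hm))
    (fun _ _ _ hm hpq => hC.trans_lt (h.far_sub hM hρ hκ hX hval hm hpq)) ht hij hi hj

theorem Gap.noLowInteraction (h : Gap Q c X) (hM : 1 ≤ M) (hρ : 1 ≤ ρ) (hκ : κ₀ ≤ M)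
    (hX : 3720 * ρ * M ≤ X) (hval : ∀ p, ‖(value Q c p).toComplex‖ ≤ 2 * X * ρ)
    {v : Mode → ℝ} (hv : ∀ n, |v n| ≤ C) (hC : η + 4 * C ≤ M) :
    NoLowInteraction v κ₀ η (K + 1) (generation Q c) := by
  intro n₁ h₁ n₂ h₂ n₃ _ n _ σ ht
  refine h.not_mem_tuples₀ hM hρ hκ hX hval hv hC ht (i := σ.symm 0) (j := σ.symm 1)
    (σ.symm.injective.ne (by decide)) ?_ ?_
  · simpa using h₁
  · simpa using h₂

theorem Gap.noSpreadingLow (h : Gap Q c X) (hM : 1 ≤ M) (hρ : 1 ≤ ρ) (hκ : κ₀ ≤ M)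
    (hX : 3720 * ρ * M ≤ X) (hval : ∀ p, ‖(value Q c p).toComplex‖ ≤ 2 * X * ρ)
    {v : Mode → ℝ} (hv : ∀ n, |v n| ≤ C) (hC : η + 4 * C ≤ M) :
    NoSpreadingLow v κ₀ η (K + 1) (generation Q c) := by
  rintro n - ⟨t, ht, -, i, j, hij, hi, hj⟩
  exact h.not_mem_tuples₀ hM hρ hκ hX hval hv hC ht hij hi hj

end low

/-! ### Growth of the prototype -/

section prototype

variable {m : ℕ} {Q : Fin (m + 3) → ℤ}

theorem norm_proto {K : ℕ} {Q : Fin K → ℤ} (p : Label K) : ‖(proto Q p).toComplex‖ =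
    ∏ k, ‖(vtx (Q k) (p k) + vtx (Q k) (true, true)).toComplex‖ := by
  rw [proto, map_prod, norm_prod]
  rfl

theorem vtx_false_add_vtx_true (Q : ℤ) : vtx Q (false, false) + vtx Q (true, true) = 0 := by
  ext <;> simp [vtx, bsign]

theorem norm_vtx_add_vtx_of_ne {Q : ℤ} (hQ : 0 ≤ Q) {v : Bool × Bool} (hv : v.1 ≠ v.2) :
    2 * (Q : ℝ) ≤ ‖(vtx Q v + vtx Q (true, true)).toComplex‖ ∧
      ‖(vtx Q v + vtx Q (true, true)).toComplex‖ ≤ 2 * (Q + 1) := by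
  have hQ' : (0 : ℝ) ≤ Q := by exact_mod_cast hQ
  have key : ∀ x : ℝ, 0 ≤ x → Real.sqrt (x * x) = x := fun x hx => Real.sqrt_mul_self hx
  obtain ⟨_ | _, _ | _⟩ := v
  · simp at hv
  · have : vtx Q (false, true) + vtx Q (true, true) = ⟨0, 2 * (Q + 1)⟩ := by
      ext <;> simp [vtx, bsign]; ring
    rw [this, Complex.norm_def, Complex.normSq_apply, ← GaussianInt.intCast_re,
      ← GaussianInt.intCast_im]
    push_cast
    rw [zero_mul, zero_add, key _ (by positivity)]
    constructor <;> linarith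
  · have : vtx Q (true, false) + vtx Q (true, true) = ⟨2 * Q, 0⟩ := by
      ext <;> simp [vtx, bsign]; ring
    rw [this, Complex.norm_def, Complex.normSq_apply, ← GaussianInt.intCast_re,
      ← GaussianInt.intCast_im]
    push_cast
    rw [zero_mul, add_zero, key _ (by positivity)]
    constructor <;> linarith
  · simp at hv

theorem sqrt_two_mul_le_norm_vtx_add_vtx {Q : ℤ} (hQ : 0 ≤ Q) :
    Real.sqrt 2 * (2 * (Q : ℝ)) ≤ ‖(vtx Q (true, true) + vtx Q (true, true)).toComplex‖ := by
  have hQ' : (0 : ℝ) ≤ Q := by exact_mod_cast hQ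
  have : vtx Q (true, true) + vtx Q (true, true) = ⟨2 * Q, 2 * (Q + 1)⟩ := by
    ext <;> simp [vtx, bsign] <;> ring
  rw [this, Complex.norm_def, Complex.normSq_apply, ← GaussianInt.intCast_re,
    ← GaussianInt.intCast_im]
  push_cast
  refine Real.le_sqrt_of_sq_le ?_
  rw [mul_pow, Real.sq_sqrt zero_le_two]
  nlinarith

/-- An upper bound for the factors of the prototype at the labels of the third generation. -/
noncomputable def factorBound (Q : Fin (m + 3) → ℤ) (k : Fin (m + 3)) : ℝ :=
  if k.val < 2 then ‖(vtx (Q k) (true, true) + vtx (Q k) (true, true)).toComplex‖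
  else 2 * ((Q k : ℝ) + 1)

theorem one_le_factorBound (hQ : GoodSizes Q) (k : Fin (m + 3)) : 1 ≤ factorBound Q k := by
  have h5 : (5 : ℝ) ≤ Q k := by exact_mod_cast hQ.five_le k
  have h2 : (1 : ℝ) ≤ Real.sqrt 2 := Real.one_le_sqrt.2 one_le_two
  rw [factorBound]
  split_ifs
  · have := sqrt_two_mul_le_norm_vtx_add_vtx (by linarith [hQ.five_le k] : 0 ≤ Q k)
    nlinarith
  · linarith

theorem one_le_prod_factorBound (hQ : GoodSizes Q) : 1 ≤ ∏ k, factorBound Q k :=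
  Finset.one_le_prod fun k _ => one_le_factorBound hQ k

/-- In the third generation, the prototype vanishes except at the labels `(+,+)` in the first two
rectangles. -/
theorem norm_proto_le_of_adm_two (hQ : GoodSizes Q) {p : Label (m + 3)} (hp : Adm 2 p) :
    ‖(proto Q p).toComplex‖ ≤
      if p 0 = (true, true) ∧ p 1 = (true, true) then ∏ k, factorBound Q k else 0 := by
  rw [norm_proto]
  split_ifs with h
  · refine Finset.prod_le_prod (fun _ _ => norm_nonneg _) fun k _ => ?_
    rw [factorBound]
    split_ifs with hk
    · have : p k = (true, true) := by
        rcases (show k.val = 0 ∨ k.val = 1 by omega) with h' | h'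
        · rw [show k = 0 from Fin.ext h']; exact h.1
        · rw [show k = 1 from Fin.ext h']; exact h.2
      rw [this]
    · exact (norm_vtx_add_vtx_of_ne (by linarith [hQ.five_le k]) (mt (hp k).1 hk)).2
  · have key : ∀ k : Fin (m + 3), k.val < 2 → p k ≠ (true, true) →
        ‖(vtx (Q k) (p k) + vtx (Q k) (true, true)).toComplex‖ = 0 := fun k hk hne => by
      have e := (hp k).2 hk
      have : p k = (false, false) := by
        generalize p k = v at e hne
        obtain ⟨_ | _, _ | _⟩ := v <;> simp at e hne ⊢
      rw [this, vtx_false_add_vtx_true, map_zero, norm_zero]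
    rw [not_and_or] at h
    rcases h with h | h
    · rw [Finset.prod_eq_zero (Finset.mem_univ 0) (key 0 (by simp) h)]
    · rw [Finset.prod_eq_zero (Finset.mem_univ 1) (key 1 (by simp) h)]

theorem card_filter_adm_two (m : ℕ) :
    (open Classical in Finset.univ.filter fun p : Label (m + 3) =>
      Adm 2 p ∧ p 0 = (true, true) ∧ p 1 = (true, true)).card = 2 ^ (m + 1) := by
  classical
  have : (Finset.univ.filter fun p : Label (m + 3) =>
      Adm 2 p ∧ p 0 = (true, true) ∧ p 1 = (true, true)) =
      Fintype.piFinset fun k : Fin (m + 3) =>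
        if k.val < 2 then {(true, true)} else Finset.univ.filter fun v : Bool × Bool => v.1 ≠ v.2 := by
    ext p
    rw [Finset.mem_filter, Fintype.mem_piFinset]
    constructor
    · rintro ⟨-, hp, h0, h1⟩ k
      split_ifs with hk
      · rcases (show k.val = 0 ∨ k.val = 1 by omega) with h' | h'
        · rw [show k = 0 from Fin.ext h', h0]; simp
        · rw [show k = 1 from Fin.ext h', h1]; simp
      · simpa using mt (hp k).1 hk
    · intro h
      refine ⟨Finset.mem_univ _, fun k => ?_, by simpa using h 0, by simpa using h 1⟩
      have := h k
      split_ifs at this with hk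
      · simp [Finset.mem_singleton.1 this, hk]
      · simpa [hk] using this
  rw [this, Fintype.card_piFinset, Fin.prod_univ_succ, Fin.prod_univ_succ]
  have h2 : (Finset.univ.filter fun v : Bool × Bool => v.1 ≠ v.2).card = 2 := by decide
  simp [h2]

/-- The label equal to `(+,+)`, except for the last rectangle, where it is `v`. -/
def lastLabel (m : ℕ) (v : Bool × Bool) : Label (m + 3) :=
  Function.update (topLabel (m + 3)) (Fin.last (m + 2)) v

theorem adm_lastLabel {v : Bool × Bool} (hv : v.1 ≠ v.2) : Adm (m + 2) (lastLabel m v) := by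
  intro k
  rcases Fin.eq_castSucc_or_eq_last k with ⟨j, rfl⟩ | rfl
  · simp [lastLabel, topLabel]
  · simp [lastLabel, hv]

/-- The prototype grows by a factor close to `√2` from a generation to the next one. -/
theorem le_norm_proto_lastLabel (hQ : GoodSizes Q) {t : ℝ} (ht0 : 0 ≤ t) (ht1 : t ≤ 1)
    (ht : ∀ k, t * ((Q k : ℝ) + 1) ≤ Q k) {v : Bool × Bool} (hv : v.1 ≠ v.2) :
    Real.sqrt 2 ^ m * t ^ (m + 3) * ∏ k, factorBound Q k ≤
      ‖(proto Q (lastLabel m v)).toComplex‖ := by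
  have hw : Real.sqrt 2 ^ m =
      ∏ k : Fin (m + 3), if 2 ≤ k.val ∧ k.val < m + 2 then Real.sqrt 2 else 1 := by
    rw [Fin.prod_univ_succ, Fin.prod_univ_succ, Fin.prod_univ_castSucc]
    simp
  have ht' : t ^ (m + 3) = ∏ _k : Fin (m + 3), t := by simp
  rw [norm_proto, hw, ht', ← Finset.prod_mul_distrib, ← Finset.prod_mul_distrib]
  have hs : (0 : ℝ) ≤ Real.sqrt 2 := Real.sqrt_nonneg 2
  refine Finset.prod_le_prod (fun k _ => ?_) fun k _ => ?_
  · have := one_le_factorBound hQ k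
    split_ifs <;> positivity
  have h5 : (5 : ℤ) ≤ Q k := hQ.five_le k
  rcases Fin.eq_castSucc_or_eq_last k with ⟨j, rfl⟩ | rfl
  · have hj : lastLabel m v j.castSucc = (true, true) := by
      simp [lastLabel, topLabel]
    rw [hj, factorBound]
    have hlt : j.castSucc.val < m + 2 := by simp
    by_cases h2 : j.castSucc.val < 2
    · rw [if_pos h2, if_neg (by omega), one_mul]
      exact mul_le_of_le_one_left (norm_nonneg _) ht1
    · rw [if_neg h2, if_pos ⟨by omega, hlt⟩]
      refine le_trans ?_ (sqrt_two_mul_le_norm_vtx_add_vtx (by omega))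
      rw [mul_assoc]
      refine mul_le_mul_of_nonneg_left ?_ hs
      linarith [ht j.castSucc]
  · have hl : lastLabel m v (Fin.last (m + 2)) = v := by simp [lastLabel]
    rw [hl, factorBound]
    simp only [Fin.val_last, lt_self_iff_false, and_false, if_false, one_mul]
    rw [if_neg (by omega)]
    refine le_trans ?_ (norm_vtx_add_vtx_of_ne (by omega) hv).1
    linarith [ht (Fin.last (m + 2))]

theorem one_le_norm_proto_lastLabel (hQ : GoodSizes Q) {v : Bool × Bool} (hv : v.1 ≠ v.2) :
    1 ≤ ‖(proto Q (lastLabel m v)).toComplex‖ := by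
  rw [norm_proto]
  refine Finset.one_le_prod fun k _ => ?_
  have h5 : (5 : ℤ) ≤ Q k := hQ.five_le k
  have h5' : (5 : ℝ) ≤ Q k := by exact_mod_cast h5
  have h2 : (1 : ℝ) ≤ Real.sqrt 2 := Real.one_le_sqrt.2 one_le_two
  by_cases hk : k = Fin.last (m + 2)
  · have hl : lastLabel m v k = v := by simp [lastLabel, hk]
    rw [hl]
    have := (norm_vtx_add_vtx_of_ne (Q := Q k) (by omega) hv).1
    linarith
  · have hl : lastLabel m v k = (true, true) := by simp [lastLabel, hk, topLabel]
    rw [hl]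
    have := sqrt_two_mul_le_norm_vtx_add_vtx (Q := Q k) (by omega)
    nlinarith

end prototype

/-! ### Growth of the Sobolev norms -/

section growth

theorem sum_generation {K : ℕ} {Q : Fin K → ℤ} {c : Finset (Fin K) → GaussianInt}
    (h : Generic Q c) (j : ℕ) (r : ℝ) :
    ∑ n ∈ generation Q c j, modeNorm n ^ r =
      ∑ p ∈ (open Classical in Finset.univ.filter fun p : Label K => Adm (j - 1) p),
        ‖(value Q c p).toComplex‖ ^ r := by
  classical
  rw [generation, Finset.sum_image (h.toMode_value_injective.injOn)]
  simp [modeNorm_eq]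

variable {m : ℕ} {Q : Fin (m + 3) → ℤ} {c : Finset (Fin (m + 3)) → GaussianInt} {N Z r : ℝ}

/-- In the third generation, only the `2 ^ (m + 1)` labels equal to `(+,+)` in the first two
rectangles have a nonzero prototype; the values at the others are perturbations of `0`. -/
theorem sum_generation_three_le (hQ : GoodSizes Q) (h : Generic Q c) (hN : 1 ≤ N) (hZ : 0 < Z)
    (hr : 0 < r)
    (hnear : ∀ p, ‖(value Q c p).toComplex - Z * (proto Q p).toComplex‖ ≤ Z / N) :
    ∑ n ∈ generation Q c 3, modeNorm n ^ r ≤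
      2 ^ (m + 1) * (Z * ∏ k, factorBound Q k) ^ r * ((1 + 1 / N) ^ r + 4 * (1 / N) ^ r) := by
  classical
  have hD := one_le_prod_factorBound hQ
  set D := ∏ k, factorBound Q k
  have hN' : 0 ≤ 1 / N := by positivity
  have hZN : Z / N ≤ Z * D * (1 / N) := by
    rw [mul_one_div]
    gcongr
    exact le_mul_of_one_le_right hZ.le hD
  have hval : ∀ p, ‖(value Q c p).toComplex‖ ≤ Z * ‖(proto Q p).toComplex‖ + Z / N := fun p => by
    have h1 := norm_add_le ((value Q c p).toComplex - Z * (proto Q p).toComplex)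
      (Z * (proto Q p).toComplex)
    rw [sub_add_cancel, norm_mul, Complex.norm_real, Real.norm_of_nonneg hZ.le] at h1
    linarith [hnear p]
  rw [sum_generation h]
  have hle : ∀ p : Label (m + 3), Adm 2 p → ‖(value Q c p).toComplex‖ ^ r ≤
      (if p 0 = (true, true) ∧ p 1 = (true, true) then (Z * D * (1 + 1 / N)) ^ r else 0) +
        (Z * D * (1 / N)) ^ r := fun p hp => by
    have h1 := norm_proto_le_of_adm_two hQ hp
    have h2 := hval p
    split_ifs at h1 ⊢
    · refine le_trans (Real.rpow_le_rpow (norm_nonneg _) ?_ hr.le)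
        (le_add_of_nonneg_right (by positivity))
      nlinarith
    · rw [zero_add]
      refine Real.rpow_le_rpow (norm_nonneg _) ?_ hr.le
      nlinarith
  refine (Finset.sum_le_sum fun p hp => hle p (Finset.mem_filter.1 hp).2).trans ?_
  have hc1 := card_filter_adm_two m
  have hc2 := card_filter_adm (K := m + 3) 2
  rw [Finset.sum_add_distrib, ← Finset.sum_filter, Finset.filter_filter, Finset.sum_const,
    Finset.sum_const, nsmul_eq_mul, nsmul_eq_mul]
  have hZD : 0 ≤ Z * D := by positivity
  rw [Real.mul_rpow hZD (by positivity), Real.mul_rpow hZD hN']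
  have e1 : ((Finset.univ.filter fun p : Label (m + 3) =>
      Adm (3 - 1) p ∧ p 0 = (true, true) ∧ p 1 = (true, true)).card : ℝ) = 2 ^ (m + 1) := by
    exact_mod_cast hc1
  have e2 : ((Finset.univ.filter fun p : Label (m + 3) => Adm (3 - 1) p).card : ℝ) =
      2 ^ (m + 1) * 4 := by
    rw [show (2 : ℝ) ^ (m + 1) * 4 = 2 ^ (m + 3) by ring]
    exact_mod_cast hc2
  rw [e1, e2]
  exact le_of_eq (by ring)

/-- In the penultimate generation, the two labels equal to `(+,+)` in all rectangles but the last
carry the lower bound; they gain a factor `√2` in `m` rectangles compared to the third generation. -/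
theorem le_sum_generation_penultimate (hQ : GoodSizes Q) (h : Generic Q c) (hN : 1 ≤ N)
    (hZ : 0 < Z) (hr : 0 < r) {t : ℝ} (ht0 : 0 ≤ t) (ht1 : t ≤ 1)
    (ht : ∀ k, t * ((Q k : ℝ) + 1) ≤ Q k)
    (hnear : ∀ p, ‖(value Q c p).toComplex - Z * (proto Q p).toComplex‖ ≤ Z / N) :
    2 * (Z * (∏ k, factorBound Q k) * Real.sqrt 2 ^ m * (t ^ (m + 3) * (1 - 1 / N))) ^ r ≤
      ∑ n ∈ generation Q c (m + 3), modeNorm n ^ r := by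
  classical
  have hD := one_le_prod_factorBound hQ
  have hN1 : 1 / N ≤ 1 := by
    rw [div_le_one (by linarith)]; exact hN
  rw [sum_generation h]
  have hval : ∀ v : Bool × Bool, v.1 ≠ v.2 →
      (Z * (∏ k, factorBound Q k) * Real.sqrt 2 ^ m * (t ^ (m + 3) * (1 - 1 / N))) ^ r ≤
        ‖(value Q c (lastLabel m v)).toComplex‖ ^ r := fun v hv => by
    refine Real.rpow_le_rpow ?_ ?_ hr.le
    · have : 0 ≤ 1 - 1 / N := by linarith
      have h0 : 0 ≤ ∏ k, factorBound Q k := by linarith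
      positivity
    have h1 := norm_sub_norm_le (Z * (proto Q (lastLabel m v)).toComplex : ℂ)
      (Z * (proto Q (lastLabel m v)).toComplex - (value Q c (lastLabel m v)).toComplex)
    rw [sub_sub_cancel, norm_sub_rev, norm_mul, Complex.norm_real, Real.norm_of_nonneg hZ.le] at h1
    have h2 := hnear (lastLabel m v)
    have h3 := one_le_norm_proto_lastLabel hQ hv
    have h4 := le_norm_proto_lastLabel hQ ht0 ht1 ht hv
    have h5 := mul_le_mul_of_nonneg_left h4
      (mul_nonneg hZ.le (show 0 ≤ 1 - 1 / N by linarith))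
    have h6 : Z / N ≤ Z * (1 / N) * ‖(proto Q (lastLabel m v)).toComplex‖ := by
      rw [mul_one_div]
      exact le_mul_of_one_le_right (by positivity) h3
    linarith
  have hne : lastLabel m (true, false) ≠ lastLabel m (false, true) := fun he => by
    have := congrFun he (Fin.last (m + 2))
    simp [lastLabel] at this
  calc _ ≤ ‖(value Q c (lastLabel m (true, false))).toComplex‖ ^ r +
        ‖(value Q c (lastLabel m (false, true))).toComplex‖ ^ r := by
        linarith [hval (true, false) (by simp), hval (false, true) (by simp)]
    _ = ∑ p ∈ {lastLabel m (true, false), lastLabel m (false, true)},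
          ‖(value Q c p).toComplex‖ ^ r := 
        (Finset.sum_pair (f := fun p => ‖(value Q c p).toComplex‖ ^ r) hne).symm
    _ ≤ _ := by
        refine Finset.sum_le_sum_of_subset_of_nonneg ?_ fun _ _ _ => by positivity
        intro p hp
        rw [Finset.mem_filter]
        rcases Finset.mem_insert.1 hp with rfl | hp
        · exact ⟨Finset.mem_univ _, adm_lastLabel (by simp)⟩
        · rw [Finset.mem_singleton.1 hp]
          exact ⟨Finset.mem_univ _, adm_lastLabel (by simp)⟩

/-- The ratio of the Sobolev norms of the penultimate generation and of the third one. -/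
theorem growth_of_near_proto {s : ℝ} (hs : 1 < s) (hQ : GoodSizes Q) (h : Generic Q c)
    (hN : (m : ℝ) + 3 ≤ N) (hQN : ∀ k, N ^ 2 ≤ Q k + 1) (hZ : 0 < Z)
    (hnear : ∀ p, ‖(value Q c p).toComplex - Z * (proto Q p).toComplex‖ ≤ Z / N)
    (hne : ∀ p, 0 < ‖(value Q c p).toComplex‖)
    (hsmall : 1 / 2 * ((1 + 1 / N) ^ (2 * s) + 4 * (1 / N) ^ (2 * s)) ≤
      ((1 - 1 / N) ^ 2) ^ (2 * s)) :
    1 / 2 * 2 ^ ((s - 1) * m) ≤ (∑ n ∈ generation Q c (m + 3), modeNorm n ^ (2 * s)) /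
      ∑ n ∈ generation Q c 3, modeNorm n ^ (2 * s) := by
  have hm : (0 : ℝ) ≤ m := Nat.cast_nonneg m
  have hN1 : 1 ≤ N := by linarith
  have hr : 0 < 2 * s := by linarith
  have hD := one_le_prod_factorBound hQ
  set t : ℝ := 1 - 1 / N ^ 2 with ht
  have hNN : 1 / N ^ 2 ≤ 1 := by
    rw [div_le_one (by positivity)]
    exact one_le_pow₀ hN1
  have hNN0 : 0 < 1 / N ^ 2 := by positivity
  have ht' : ∀ k, t * ((Q k : ℝ) + 1) ≤ Q k := fun k => by
    have : 1 ≤ 1 / N ^ 2 * ((Q k : ℝ) + 1) := by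
      rw [one_div_mul_eq_div, one_le_div (by positivity)]
      exact hQN k
    rw [ht]
    linarith
  have hpow : 1 - 1 / N ≤ t ^ (m + 3) := by
    have h1 := one_add_mul_le_pow (a := -(1 / N ^ 2)) (by linarith) (m + 3)
    have h2 : ((m + 3 : ℕ) : ℝ) * (1 / N ^ 2) ≤ 1 / N := by
      rw [mul_one_div, div_le_div_iff₀ (by positivity) (by positivity)]
      push_cast
      nlinarith
    rw [ht, sub_eq_add_neg 1 (1 / N ^ 2)]
    linarith
  have hu := sum_generation_three_le hQ h hN1 hZ hr hnear
  have hl := le_sum_generation_penultimate hQ h hN1 hZ hr (t := t) (by linarith) (by linarith) ht'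
    hnear
  have hpos : 0 < ∑ n ∈ generation Q c 3, modeNorm n ^ (2 * s) := by
    refine Finset.sum_pos (fun n hn => ?_) (Finset.card_pos.1 ?_)
    · obtain ⟨p, -, rfl⟩ := mem_generation.1 hn
      rw [modeNorm_eq, ofMode_toMode]
      exact Real.rpow_pos_of_pos (hne p) _
    · rw [h.card_generation]
      positivity
  rw [le_div_iff₀ hpos]
  refine le_trans ?_ hl
  have hZD : 0 < Z * ∏ k, factorBound Q k := by positivity
  have h1N : 0 ≤ 1 - 1 / N := by
    have : 1 / N ≤ 1 := by rw [div_le_one (by linarith)]; exact hN1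
    linarith
  have e2 : (Real.sqrt 2 ^ m) ^ (2 * s) = 2 ^ (s * m) := by
    rw [← Real.rpow_natCast, ← Real.rpow_mul (Real.sqrt_nonneg 2), Real.sqrt_eq_rpow,
      ← Real.rpow_mul zero_le_two]
    congr 1; ring
  have e3 : (2 : ℝ) ^ ((s - 1) * m) * 2 ^ (m + 1) = 2 * 2 ^ (s * m) := by
    rw [← Real.rpow_natCast 2 (m + 1), ← Real.rpow_add zero_lt_two,
      show (s - 1) * (m : ℝ) + ((m + 1 : ℕ) : ℝ) = 1 + s * m by push_cast; ring,
      Real.rpow_add zero_lt_two, Real.rpow_one]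
  have h3 : ((1 - 1 / N) ^ 2) ^ (2 * s) ≤ (t ^ (m + 3) * (1 - 1 / N)) ^ (2 * s) := by
    refine Real.rpow_le_rpow (by positivity) ?_ hr.le
    rw [sq]
    exact mul_le_mul_of_nonneg_right hpow h1N
  have ht0 : 0 ≤ t ^ (m + 3) * (1 - 1 / N) := mul_nonneg (h1N.trans hpow) h1N
  rw [Real.mul_rpow (by positivity) ht0, Real.mul_rpow hZD.le (by positivity), e2]
  calc _ ≤ 1 / 2 * 2 ^ ((s - 1) * m) * (2 ^ (m + 1) * (Z * ∏ k, factorBound Q k) ^ (2 * s) *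
        ((1 + 1 / N) ^ (2 * s) + 4 * (1 / N) ^ (2 * s))) := by gcongr
    _ = (2 ^ ((s - 1) * m) * 2 ^ (m + 1)) * (Z * ∏ k, factorBound Q k) ^ (2 * s) *
        (1 / 2 * ((1 + 1 / N) ^ (2 * s) + 4 * (1 / N) ^ (2 * s))) := by ring
    _ ≤ (2 ^ ((s - 1) * m) * 2 ^ (m + 1)) * (Z * ∏ k, factorBound Q k) ^ (2 * s) *
        (t ^ (m + 3) * (1 - 1 / N)) ^ (2 * s) := by
        gcongr
        exact hsmall.trans h3
    _ = _ := by rw [e3]; ring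

theorem eventually_le_of_pos {r : ℝ} (hr : 0 < r) : ∀ᶠ N : ℕ in Filter.atTop,
    1 / 2 * ((1 + 1 / (N : ℝ)) ^ r + 4 * (1 / (N : ℝ)) ^ r) ≤ ((1 - 1 / (N : ℝ)) ^ 2) ^ r := by
  have hf : ContinuousAt (fun x : ℝ => 1 / 2 * ((1 + x) ^ r + 4 * x ^ r)) 0 := by
    have h1 : ContinuousAt (fun x : ℝ => (1 + x) ^ r) 0 :=
      ContinuousAt.rpow_const (by fun_prop) (Or.inr hr.le)
    have h2 : ContinuousAt (fun x : ℝ => x ^ r) 0 :=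
      ContinuousAt.rpow_const (by fun_prop) (Or.inr hr.le)
    fun_prop
  have hg : ContinuousAt (fun x : ℝ => ((1 - x) ^ 2) ^ r) 0 :=
    ContinuousAt.rpow_const (by fun_prop) (Or.inr hr.le)
  have hlt : 1 / 2 * ((1 + (0 : ℝ)) ^ r + 4 * (0 : ℝ) ^ r) < ((1 - (0 : ℝ)) ^ 2) ^ r := by
    simp [Real.zero_rpow hr.ne']
    norm_num
  exact (tendsto_one_div_atTop_nhds_zero_nat.eventually (hf.eventually_lt hg hlt)).mono
    fun _ h => h.le

end growth

/-! ### Choice of the sizes -/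

section sizes

/-- Sizes of the rectangles, of the order of `N ^ 2`. -/
def sizes (N K : ℕ) (k : Fin K) : ℤ := 15 * ((N : ℤ) ^ 2 + k.val) + 5

theorem goodSizes_sizes (N K : ℕ) : GoodSizes (sizes N K) where
  mod k := by rw [sizes]; omega
  five_le k := by
    have : 0 ≤ (N : ℤ) ^ 2 := by positivity
    rw [sizes]
    omega
  inj k l h := by
    rw [sizes, sizes] at h
    exact Fin.ext (by omega)

theorem sizes_add_one_le {N K : ℕ} (hK : K < N) (k : Fin K) :
    sizes N K k + 1 ≤ ((36 * N ^ 2 : ℕ) : ℤ) := by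
  have hk : ((k.val : ℕ) : ℤ) + 1 ≤ N := by have := k.2; omega
  have hN : (1 : ℤ) ≤ N := by omega
  rw [sizes]
  push_cast
  nlinarith

theorem sq_le_sizes_add_one (N K : ℕ) (k : Fin K) : (N : ℝ) ^ 2 ≤ (sizes N K k : ℝ) + 1 := by
  rw [sizes]
  push_cast
  have : (0 : ℝ) ≤ (k.val : ℝ) := Nat.cast_nonneg _
  nlinarith [sq_nonneg (N : ℝ)]

/-- The parameter that controls the constants of the construction is of the order of
`exp (O(N ^ 2))`. -/
theorem scale_le_exp {N K : ℕ} (hK : K + 1 = N) :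
    ((2 * (16 * (36 * N ^ 2)) ^ K : ℕ) : ℝ) ≤ Real.exp (48 * (N : ℝ) ^ 2) := by
  have hN : (1 : ℝ) ≤ N := by
    have : 1 ≤ N := by omega
    exact_mod_cast this
  push_cast
  calc 2 * (16 * (36 * (N : ℝ) ^ 2)) ^ K
      ≤ (16 * (36 * (N : ℝ) ^ 2)) * (16 * (36 * (N : ℝ) ^ 2)) ^ K := by
        gcongr
        nlinarith
    _ = (24 * (N : ℝ)) ^ (2 * N) := by
        rw [← pow_succ', hK, pow_mul]
        congr 1
        ring
    _ ≤ Real.exp (24 * N) ^ (2 * N) := by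
        gcongr
        linarith [Real.add_one_le_exp (24 * (N : ℝ))]
    _ = Real.exp (48 * (N : ℝ) ^ 2) := by
        rw [← Real.exp_nat_mul]
        congr 1
        push_cast
        ring

end sizes

section final

theorem eventually_le_half_mul_two_rpow {s : ℝ} (hs : 1 < s) (x : ℝ) : ∀ᶠ N : ℕ in Filter.atTop,
    x ≤ 1 / 2 * 2 ^ ((s - 1) * ((N : ℝ) - 4)) := by
  have h1 : Filter.Tendsto (fun N : ℕ => (s - 1) * ((N : ℝ) - 4)) Filter.atTop Filter.atTop :=
    (Filter.tendsto_atTop_add_const_right _ (-4) tendsto_natCast_atTop_atTop).const_mul_atTop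
      (by linarith)
  have h2 : Filter.Tendsto (fun N : ℕ => (1 / 2 : ℝ) * 2 ^ ((s - 1) * ((N : ℝ) - 4)))
      Filter.atTop Filter.atTop :=
    ((tendsto_rpow_atTop_of_base_gt_one 2 one_lt_two).comp h1).const_mul_atTop (by norm_num)
  exact h2.eventually_ge_atTop x

theorem mainTheorem4 (s s₀ : ℝ) (hs : 1 < s) (hs₀ : 0 < s₀)
    (V : UnitAddTorus (Fin 2) → ℂ) (hV : MemSobolev s₀ V)
    (hVreal : ∀ n : Mode, (UnitAddTorus.mFourierCoeff V n).im = 0)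
    (κ₀ : ℝ) (hκ₀ : ∀ n : Mode, κ₀ ≤ modeNorm n → |potCoeff V n| ≤ 1 / 100)
    (η : ℝ) (hη : η ∈ Set.Ioo (1 / 4 : ℝ) (1 / 3)) :
    ∃ η₁ η₂ : ℝ, 0 < η₁ ∧ 0 < η₂ ∧ ∃ K₀ : ℝ, 1 ≤ K₀ ∧ ∀ K : ℝ, K₀ ≤ K →
      ∃ (N : ℕ) (gen : ℕ → Finset Mode), 4 ≤ N ∧
        (∀ i ∈ Finset.Icc 1 N, ∀ j ∈ Finset.Icc 1 N, i ≠ j → Disjoint (gen i) (gen j)) ∧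
        (∀ n ∈ unionGen N gen, n ∉ lowModes κ₀) ∧
        Closure κ₀ N gen ∧
        UniqueSpouseChildren κ₀ N gen ∧
        UniqueSiblingParents κ₀ N gen ∧
        Nondegeneracy κ₀ N gen ∧
        Faithfulness κ₀ N gen ∧
        NoSpreadingHigh κ₀ N gen ∧
        NoLowInteraction (potCoeff V) κ₀ η N gen ∧
        NoSpreadingLow (potCoeff V) κ₀ η N gen ∧
        (1 / 2 : ℝ) * 2 ^ ((s - 1) * ((N : ℝ) - 4)) ≤
          (∑ n ∈ gen (N - 1), modeNorm n ^ (2 * s)) / (∑ n ∈ gen 3, modeNorm n ^ (2 * s)) ∧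
        K ^ 2 ≤ (1 / 2 : ℝ) * 2 ^ ((s - 1) * ((N : ℝ) - 4)) ∧
        ∀ j ∈ Finset.Icc 1 N, (gen j).card = 2 ^ (N - 1) ∧
          ∀ n ∈ gen j, Real.exp (η₁ * (N : ℝ) ^ 2) ≤ modeNorm n ∧
            modeNorm n ≤ Real.exp (η₂ * (N : ℝ) ^ 2) := by
  obtain ⟨C, hC⟩ := hV.exists_abs_potCoeff_le hs₀
  refine ⟨Real.log 2, 48 * 1710 + 2, Real.log_pos one_lt_two, by norm_num, 1, le_rfl,
    fun 𝒦 _ => ?_⟩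
  -- `N` is large, depending on `𝒦`, `s`, the radius of the low modes and the size of the potential
  obtain ⟨N, hN4, h𝒦, hsmall, hNκ, hNC⟩ := ((Filter.eventually_ge_atTop 4).and <|
    (eventually_le_half_mul_two_rpow hs (𝒦 ^ 2)).and <|
    (eventually_le_of_pos (r := 2 * s) (by linarith)).and <|
    (tendsto_natCast_atTop_atTop.eventually_ge_atTop κ₀).and <|
    tendsto_natCast_atTop_atTop.eventually_ge_atTop (η + 4 * C)).exists
  obtain ⟨m, rfl⟩ : ∃ m, N = m + 4 := ⟨N - 4, by omega⟩
  set N := m + 4 with hN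
  set Q := sizes N (m + 3) with hQdef
  set M := 2 ^ N ^ 2 with hM
  have hQ : GoodSizes Q := goodSizes_sizes N (m + 3)
  have hN1 : 1 ≤ N := by omega
  have hNM : (N : ℝ) ≤ (M : ℕ) := by
    have h1 : N < 2 ^ N := Nat.lt_two_pow_self
    have h2 : 2 ^ N ≤ M := Nat.pow_le_pow_right two_pos (Nat.le_self_pow two_ne_zero N)
    exact_mod_cast h1.le.trans h2
  have hM1 : 1 ≤ M := Nat.one_le_two_pow
  have hH : 576 * N ^ 2 ≤ (16 * (36 * N ^ 2)) ^ (m + 3) := by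
    refine le_trans (le_of_eq ?_) (Nat.le_self_pow (by omega) _)
    ring
  have hNN : N ≤ N ^ 2 := Nat.le_self_pow two_ne_zero N
  obtain ⟨c, X, Y, ρ, hρ, hY, hX, hc, hgap, hval, hXH, hnear⟩ :=
    exists_generic_near_proto hQ (L := 36 * N ^ 2) (N := N) (M₀ := M)
      (H := 2 * (16 * (36 * N ^ 2)) ^ (m + 3)) (sizes_add_one_le (by omega)) (by omega) hN1 hM1
      le_rfl (by omega) (by omega)
  have hM1' : (1 : ℝ) ≤ (M : ℕ) := by exact_mod_cast hM1
  have hXM : 2 * (M : ℕ) ≤ X := by nlinarith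
  have hhigh := hgap.toMode_value_not_mem_lowModes hM1' hρ (hNκ.trans hNM) hX
  have hlow := fun p => hgap.le_norm_value p
  have e4 : ((N : ℕ) : ℝ) - 4 = m := by rw [hN]; push_cast; ring
  refine ⟨m + 3 + 1, generation Q c, by omega, fun i hi j hj => hc.disjoint_generation hi hj,
    fun n hn => ?_, hc.closure, hc.uniqueSpouseChildren hhigh, hc.uniqueSiblingParents hhigh,
    hc.nondegeneracy hhigh, hc.faithfulness hhigh, hc.noSpreadingHigh,
    hgap.noLowInteraction hM1' hρ (hNκ.trans hNM) hX hval hC (hNC.trans hNM),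
    hgap.noSpreadingLow hM1' hρ (hNκ.trans hNM) hX hval hC (hNC.trans hNM), ?_, h𝒦,
    fun j hj => ⟨hc.card_generation j, fun n hn => ?_⟩⟩
  · obtain ⟨p, -, rfl⟩ := mem_unionGen_generation.1 hn
    exact hhigh p
  · have := growth_of_near_proto (N := (N : ℝ)) (Z := X * Y) hs hQ hc
      (by rw [hN]; push_cast; linarith) (sq_le_sizes_add_one N (m + 3)) (by nlinarith)
      (fun p => by rw [Complex.ofReal_mul]; exact hnear p)
      (fun p => lt_of_lt_of_le (by linarith) (hlow p)) hsmall
    rw [← e4] at this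
    exact this
  · obtain ⟨p, -, rfl⟩ := mem_generation.1 hn
    rw [modeNorm_eq, ofMode_toMode]
    have eM : ((M : ℕ) : ℝ) = Real.exp (Real.log 2 * (N : ℝ) ^ 2) := by
      rw [hM, mul_comm, ← Nat.cast_pow N 2, Real.exp_nat_mul, Real.exp_log two_pos]
      push_cast
      rfl
    constructor
    · refine le_trans ?_ (hlow p)
      change Real.exp (Real.log 2 * (N : ℝ) ^ 2) ≤ _
      rw [← eM]
      linarith
    · change _ ≤ Real.exp ((48 * 1710 + 2) * (N : ℝ) ^ 2)
      have h1 := scale_le_exp (N := N) (K := m + 3) rfl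
      have h2 : ((M : ℕ) : ℝ) ≤ Real.exp ((N : ℝ) ^ 2) := by
        rw [eM]
        gcongr
        have := Real.log_two_lt_d9
        nlinarith [sq_nonneg (N : ℝ)]
      calc _ ≤ _ := (hval p).trans hXH
        _ ≤ Real.exp (48 * (N : ℝ) ^ 2) ^ 1710 * Real.exp ((N : ℝ) ^ 2) ^ 2 := by gcongr
        _ = _ := by
          rw [← Real.exp_nat_mul, ← Real.exp_nat_mul, ← Real.exp_add]
          congr 1
          push_cast
          ring

end final
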